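/- Let $(\Omega,\omega)$ be a smooth symplectic manifold (Hausdorff, second countable) of dimension $2n$, $n\ge 2$, and let $H\colon\Omega\to\mathbb R$ be a $C^\infty$ function with Hamiltonian vector field $X_H$, $\omega(X_H,\cdot)=dH$. A section of $H$ is a smooth embedded hypersurface of $\Omega$ transverse to $X_H$. The Poincaré map from a set $A$ to a set $B$ sends $y\in A$ to the first point, at a positive time, at which the forward trajectory of $y$ meets $B$; being a Poincaré map includes that this point exists for all $y\in A$ and that the hitting time depends continuously on $y$. Let $\Sigma_0,\Sigma_1$ be sections of $H$ such that the Poincaré map $R_H\colon\Sigma_0\to\Sigma_1$ of $X_H$ exists and is a $C^\infty$ diffeomorphism. Let $y_0\in\Sigma_0$, let $x_0$ be a point on the trajectory of $y_0$ strictly between $y_0$ and $R_H(y_0)$, and let $h=H(x_0)$. Put $\Sigma_i^h=\{x\in\Sigma_i: H(x)=h\}$ (a $(2n-2)$-dimensional submanifold, symplectic for the restriction of $\omega$) and $R_H^h=R_H|_{\Sigma_0^h}\colon\Sigma^h_0\to\Sigma^h_1$. Then for every neighborhood $U$ of $x_0$ in $\Omega$ there exists a neighborhood $V^h$ of $y_0$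 in $\Sigma_0^h$ such that, for every neighborhood $\mathcal H$ of $H$ in $C^\infty(\Omega,\mathbb R)$ with the strong (Whitney) $C^\infty$ topology, there exists a neighborhood $\mathcal R^h$ of $R^h_H$ in $C^\infty(\Sigma_0^h,\Sigma_1^h)$ with the weak (compact-open) $C^\infty$ topology such that the following holds. For every smooth map $\widetilde R^h\in\mathcal R^h$ from $\Sigma_0^h$ to $\Sigma_1^h$ that preserves the symplectic forms and satisfies $\widetilde R^h=R^h_H$ on $\Sigma_0^h\setminus V^h$, there exists $\widetilde H\in\mathcal H$ such that $\widetilde H=H$ on $H^{-1}(h)\setminus U$, such that $\{x\in\Sigma_i:\widetilde H(x)=h\}=\Sigma_i^h$ for $i=0,1$, and such that $\widetilde R^h=R^h_{\widetilde H}$, that is, $\widetilde R^h$ is the Poincaré map of $X_{\widetilde H}$ from $\Sigma^h_0$ to $\Sigma_1$. (Since the strong topology is finer than the weak one, the same statement holds with either topology used for both function spaces.) -/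

import Mathlib

open Set
open scoped Manifold ContDiff Topology

noncomputable section

namespace PoincareRealization

/-- The model space `ℝ^d` with its Euclidean norm. -/
abbrev Euc (d : ℕ) : Type := EuclideanSpace ℝ (Fin d)

section General

variable {d : ℕ} {M : Type*} [TopologicalSpace M] [ChartedSpace (Euc d) M]

/-- A (not necessarily continuous) field of alternating 2-forms on the tangent spaces of `M`. -/
abbrev TwoForm (d : ℕ) (M : Type*) [TopologicalSpace M] [ChartedSpace (Euc d) M] : Type _ :=
  (x : M) → (TangentSpace (𝓡 d) x) [⋀^Fin 2]→L[ℝ] ℝ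

/-- The pullback `f^* σ` of a 2-form on `M` under a map `f` from `ℝ^k` to `M`, at the point `z`:
`(f^* σ)_z (u, v) = σ_{f z} (df_z u, df_z v)`. -/
def pullback {k : ℕ} (σ : TwoForm d M) (f : Euc k → M) (z : Euc k) : (Euc k) [⋀^Fin 2]→L[ℝ] ℝ :=
  (σ (f z)).compContinuousLinearMap (mfderiv (𝓡 k) (𝓡 d) f z)

/-- A symplectic form on `M`: a smooth, closed, nondegenerate 2-form. Smoothness and closedness
are those of the coordinate expressions `(e⁻¹)^* σ` in all charts `e` of `M`. -/
structure SymplecticForm (d : ℕ) (M : Type*) [TopologicalSpace M] [ChartedSpace (Euc d) M] where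
  /-- the underlying field of alternating forms -/
  form : TwoForm d M
  smooth : ∀ e ∈ IsManifold.maximalAtlas (𝓡 d) ∞ M,
    ContDiffOn ℝ ∞ (pullback form e.symm) e.target
  closed : ∀ e ∈ IsManifold.maximalAtlas (𝓡 d) ∞ M, ∀ z ∈ e.target,
    extDeriv (pullback form e.symm) z = 0
  nondegenerate : ∀ (x : M) (u : TangentSpace (𝓡 d) x),
    (∀ v : TangentSpace (𝓡 d) x, form x ![u, v] = 0) → u = 0

/-- By nondegeneracy, every covector at `x` is `σ_x (X, ·)` for some (unique) vector `X`. -/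
theorem SymplecticForm.exists_dual (σ : SymplecticForm d M) (x : M)
    (l : TangentSpace (𝓡 d) x →L[ℝ] ℝ) :
    ∃ X : TangentSpace (𝓡 d) x, ∀ v : TangentSpace (𝓡 d) x, σ.form x ![X, v] = l v := by
  have : FiniteDimensional ℝ (TangentSpace (𝓡 d) x) :=
    inferInstanceAs (FiniteDimensional ℝ (Euc d))
  have hup : ∀ u v : TangentSpace (𝓡 d) x, Function.update ![u, 0] 1 v = ![u, v] := by
    intro u v
    ext i : 1
    fin_cases i <;> simp
  let B : TangentSpace (𝓡 d) x →ₗ[ℝ] Module.Dual ℝ (TangentSpace (𝓡 d) x) :=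
    LinearMap.mk₂ ℝ (fun u v => σ.form x ![u, v])
      (fun u u' v => by simpa using (σ.form x).toMultilinearMap.cons_add ![v] u u')
      (fun c u v => by simpa using (σ.form x).toMultilinearMap.cons_smul ![v] c u)
      (fun u v v' => by
        have h := (σ.form x).toMultilinearMap.map_update_add ![u, 0] 1 v v'
        rw [hup, hup, hup] at h
        exact h)
      (fun c u v => by
        have h := (σ.form x).toMultilinearMap.map_update_smul ![u, 0] 1 c v
        rw [hup, hup] at h
        exact h)
  have hB : Function.Injective B := by
    rw [injective_iff_map_eq_zero]
    intro u hu
    exact σ.nondegenerate x u fun v => LinearMap.congr_fun hu v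
  have hs : Function.Surjective B :=
    (LinearMap.injective_iff_surjective_of_finrank_eq_finrank
      (Subspace.dual_finrank_eq (K := ℝ) (V := TangentSpace (𝓡 d) x)).symm).1 hB
  obtain ⟨X, hX⟩ := hs (l : TangentSpace (𝓡 d) x →ₗ[ℝ] ℝ)
  exact ⟨X, fun v => LinearMap.congr_fun hX v⟩

/-- The Hamiltonian vector field `X_H`, defined by `σ (X_H, ·) = dH`. -/
def hamiltonianField (σ : SymplecticForm d M) (H : M → ℝ) (x : M) : TangentSpace (𝓡 d) x :=
  (σ.exists_dual x (mfderiv (𝓡 d) 𝓘(ℝ, ℝ) H x)).choose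

theorem hamiltonianField_spec (σ : SymplecticForm d M) (H : M → ℝ) (x : M)
    (v : TangentSpace (𝓡 d) x) :
    σ.form x ![hamiltonianField σ H x, v] = mfderiv (𝓡 d) 𝓘(ℝ, ℝ) H x v :=
  (σ.exists_dual x (mfderiv (𝓡 d) 𝓘(ℝ, ℝ) H x)).choose_spec v

/-- A section of (the flow of) a vector field `X`: a smooth embedded hypersurface of `M` that is
transverse to `X`. Near each of its points `S` is the zero set of a smooth function whose
derivative along `X` does not vanish at that point. -/
def IsSection (X : (x : M) → TangentSpace (𝓡 d) x) (S : Set M) : Prop :=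
  ∀ x ∈ S, ∃ (O : Set M) (f : M → ℝ), IsOpen O ∧ x ∈ O ∧ ContMDiffOn (𝓡 d) 𝓘(ℝ, ℝ) ∞ f O ∧
    S ∩ O = {z | f z = 0} ∩ O ∧ mfderiv (𝓡 d) 𝓘(ℝ, ℝ) f x (X x) ≠ 0

/-- `γ`, restricted to `[0, T]`, is the arc of the trajectory of `X` from `y` to its first
intersection, at a positive time `T`, with the set `B`. -/
structure IsFirstHitArc (X : (x : M) → TangentSpace (𝓡 d) x) (B : Set M) (y : M) (T : ℝ)
    (γ : ℝ → M) : Prop where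
  pos : 0 < T
  start : γ 0 = y
  integral : IsMIntegralCurveOn γ X (Icc 0 T)
  avoid : ∀ t ∈ Ioo 0 T, γ t ∉ B
  hit : γ T ∈ B

/-- `R` restricted to `A` is the Poincaré map from `A` to `B` of the flow of `X`: every `y ∈ A` is
sent to the first intersection of its forward trajectory with `B`, and the time at which
this happens depends continuously on `y`. -/
def IsPoincareMap (X : (x : M) → TangentSpace (𝓡 d) x) (A B : Set M) (R : M → M) : Prop :=
  ∃ τ : M → ℝ, ContinuousOn τ A ∧
    ∀ y ∈ A, ∃ γ : ℝ → M, IsFirstHitArc X B y (τ y) γ ∧ γ (τ y) = R y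

/-- `x` lies on the trajectory of `y`, strictly between `y` and its first intersection
with `B`. -/
def IsBetween (X : (x : M) → TangentSpace (𝓡 d) x) (B : Set M) (y x : M) : Prop :=
  ∃ (T : ℝ) (γ : ℝ → M), IsFirstHitArc X B y T γ ∧ ∃ s ∈ Ioo 0 T, γ s = x

/-- `f` restricted to `A` is a diffeomorphism from `A` onto `B`, where smoothness on the
subsets `A` and `B` is `ContMDiffOn`. -/
def IsDiffeoOn (d d' : ℕ)
    {M : Type*} [TopologicalSpace M] [ChartedSpace (Euc d) M]
    {N : Type*} [TopologicalSpace N] [ChartedSpace (Euc d') N]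
    (A : Set M) (B : Set N) (f : M → N) : Prop :=
  BijOn f A B ∧ ContMDiffOn (𝓡 d) (𝓡 d') ∞ f A ∧
    ∃ g : N → M, LeftInvOn g f A ∧ ContMDiffOn (𝓡 d') (𝓡 d) ∞ g B

/-- `φ : A → S` is a local parametrization of the `k`-dimensional submanifold `S` of `M`:
a diffeomorphism from an open subset `A` of `ℝ^k` onto a relatively open subset of `S`. -/
def IsLocalParam (d : ℕ) {M : Type*} [TopologicalSpace M] [ChartedSpace (Euc d) M]
    {k : ℕ} (S : Set M) (A : Set (Euc k)) (φ : Euc k → M) : Prop :=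
  IsOpen A ∧ ∃ O : Set M, IsOpen O ∧ IsDiffeoOn k d A (S ∩ O) φ

/-- `f` restricts to a smooth map from `A` to `B`. -/
def IsSmoothMap (d : ℕ) {M : Type*} [TopologicalSpace M] [ChartedSpace (Euc d) M]
    (A B : Set M) (f : M → M) : Prop :=
  MapsTo f A B ∧ ContMDiffOn (𝓡 d) (𝓡 d) ∞ f A

/-- The smooth map `f` from the `k`-dimensional submanifold `S` to `M` preserves the restrictions
of `σ`, that is `f^* σ = σ` on `S`, expressed in all local parametrizations of `S`. -/
def IsSymplecticOn (k : ℕ) (σ : TwoForm d M) (S : Set M) (f : M → M) : Prop :=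
  ∀ (A : Set (Euc k)) (φ : Euc k → M), IsLocalParam d S A φ →
    ∀ z ∈ A, pullback σ (f ∘ φ) z = pullback σ φ z

/-- `𝒩` is a neighbourhood of `f` in the strong (Whitney) `C^∞` topology of `C^∞(M, ℝ)`: it
contains all `g` whose partial derivatives of order at most `r` are `ε i`-close to those of `f` on
the compact set `K i` in the chart `e i`, for some `r`, some locally finite sequence of compact sets
`K i` in the domains of charts `e i`, and some positive numbers `ε i`. -/
def IsWhitneyNhd (f : C^∞⟮𝓡 d, M; 𝓘(ℝ, ℝ), ℝ⟯) (𝒩 : Set C^∞⟮𝓡 d, M; 𝓘(ℝ, ℝ), ℝ⟯) : Prop :=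
  ∃ (r : ℕ) (e : ℕ → OpenPartialHomeomorph M (Euc d)) (K : ℕ → Set M) (ε : ℕ → ℝ),
    (∀ i, e i ∈ IsManifold.maximalAtlas (𝓡 d) ∞ M) ∧
    (∀ i, IsCompact (K i) ∧ K i ⊆ (e i).source) ∧ LocallyFinite K ∧ (∀ i, 0 < ε i) ∧
    ∀ g : C^∞⟮𝓡 d, M; 𝓘(ℝ, ℝ), ℝ⟯,
      (∀ i, ∀ x ∈ K i, ∀ j ≤ r,
        ‖iteratedFDeriv ℝ j (g ∘ (e i).symm) (e i x) -
          iteratedFDeriv ℝ j (f ∘ (e i).symm) (e i x)‖ < ε i) → g ∈ 𝒩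

/-- `𝒩` is a neighbourhood of `f` in the weak (compact-open) `C^∞` topology of `C^∞(S, S')`,
where `S` and `S'` are embedded submanifolds of `M`, `S` of dimension `k`: it contains all smooth
`g : S → S'` whose partial derivatives of order at most `r`, in finitely many local parametrizations
`φ i` of `S` and charts `ψ i` of `M`, are `ε`-close to those of `f` on compact sets `K i`. (The
elements of `𝒩` are maps `M → M` of which only the restriction to `S` matters.) -/
def IsWeakNhd (d : ℕ) {M : Type*} [TopologicalSpace M] [ChartedSpace (Euc d) M]
    (k : ℕ) (S S' : Set M) (f : M → M) (𝒩 : Set (M → M)) : Prop :=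
  ∃ (m r : ℕ) (ε : ℝ) (A : Fin m → Set (Euc k)) (φ : Fin m → Euc k → M)
    (K : Fin m → Set (Euc k)) (ψ : Fin m → OpenPartialHomeomorph M (Euc d)),
    0 < ε ∧ (∀ i, IsLocalParam d S (A i) (φ i)) ∧ (∀ i, IsCompact (K i) ∧ K i ⊆ A i) ∧
    (∀ i, ψ i ∈ IsManifold.maximalAtlas (𝓡 d) ∞ M) ∧
    (∀ i, MapsTo (f ∘ φ i) (K i) (ψ i).source) ∧
    ∀ g : M → M, IsSmoothMap d S S' g →
      (∀ i, MapsTo (g ∘ φ i) (K i) (ψ i).source ∧ ∀ z ∈ K i, ∀ j ≤ r,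
        ‖iteratedFDeriv ℝ j (ψ i ∘ g ∘ φ i) z - iteratedFDeriv ℝ j (ψ i ∘ f ∘ φ i) z‖ < ε) →
      g ∈ 𝒩

/-- The slice `S^h = {x ∈ S : H x = h}`. -/
def slice (S : Set M) (H : M → ℝ) (h : ℝ) : Set M := {x | x ∈ S ∧ H x = h}

end General

end PoincareRealization

end

open PoincareRealization

/-! Everything takes place near the arc from `y₀` to `R y₀`. By Darboux's theorem, in the form where
one canonical pair is prescribed, there is a chart `D₀` at `y₀` with coordinates `(q, p, z)`, `z ∈
ℝ^(2n-2)`, in which the form is standard, `H = h + p`, and `Σ₀` is `{q = 0}` (`darboux_step`,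
`exists_darbouxChart`). Since `X_H = ∂/∂q` in such charts, `D₀` can be carried along the arc by the
flow to charts `D₁` at `x₀` and `D₂` at `R y₀` (`exists_propagates`, `exists_flowCharts`). In these
charts the Poincaré map only translates `q`. On the energy surface it is therefore the identity in
`z`, and a symplectic map close to `R` that equals `R` off a small ball becomes a symplectic map `φ`
of `ℝ^(2n-2)`, close to the identity and equal to it off that ball (`reducedMap`,
`IsReducible.symplectic`, `IsReducible.exists_close`).

It remains to realize `φ` by a small Hamiltonian near `x₀`. Because `φ` is close to the identity it
has a generating function: in the mixed coordinates (old position, new momentum) the displacement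
defines a closed 1-form, which has a primitive `S` that vanishes off the ball because the complement
of the ball is connected. Multiplying `S` by a smooth step `χ(t)` gives an isotopy from the identity
to `φ`, generated by the time-dependent Hamiltonian `K = χ'(t) S`, written in the current point
(`generating_curve`, `exists_generating_family`). The time dependence is removed by letting `q` play
the role of time: on the surface `p + K(q, z) = 0` the orbits of `p + K(q, z)` are graphs over the
orbits of `K`. A cutoff in `p` makes the support compact, and the orbit of `(-δ, 0, z)` arrives at
`(δ, 0, φ z)` (`model_curve`, `exists_model_perturbation`).

The perturbed Hamiltonian is `H` plus this function in the chart `D₁`, supported in a box inside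
`U`. As `R` is injective, different trajectory arcs are disjoint, so arcs return to the box only in
the obvious way. A perturbed orbit thus follows the arc of `y`, crosses the box, and continues along
the arc of the point `y'` with `R y'` equal to the prescribed image
(`FlowCharts.isPoincareMap_perturbed`).

Two analytic tools are developed along the way. Smooth dependence of flows on the initial point
comes from the inverse function theorem in a space of continuous curves
(`exists_smooth_flow_of_contDiff`). Smallness in all derivatives is handled by families of maps
along a filter (`SmallFam`, `BddDer`), which spares explicit constants when inverting and composing
maps. -/

noncomputable section

namespace PoincareRealization

open Filter

universe u

set_option linter.unusedSectionVars false

/-! ### Inverse function theorem on a neighbourhood -/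

section InverseFunction

variable {E F : Type*} [NormedAddCommGroup E] [NormedSpace ℝ E] [CompleteSpace E]
  [NormedAddCommGroup F] [NormedSpace ℝ F]

/-- Inverse function theorem for functions that are smooth near a point, with a smooth inverse. -/
theorem exists_openPartialHomeomorph {f : E → F} {x : E}
    (hf : ∀ᶠ y in 𝓝 x, ContDiffAt ℝ ∞ f y) (f' : E ≃L[ℝ] F)
    (hf' : HasFDerivAt f (f' : E →L[ℝ] F) x) {s : Set E} (hs : s ∈ 𝓝 x) :
    ∃ e : OpenPartialHomeomorph E F, x ∈ e.source ∧ e.source ⊆ s ∧ (e : E → F) = f ∧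
      ContDiffOn ℝ ∞ e e.source ∧ ContDiffOn ℝ ∞ e.symm e.target := by
  have hfx : ContDiffAt ℝ ∞ f x := hf.self_of_nhds
  have hn : (∞ : WithTop ℕ∞) ≠ 0 := by simp
  let e₀ := hfx.toOpenPartialHomeomorph f hf' hn
  have hcont : ContinuousAt (fderiv ℝ f) x := (hfx.fderiv_right (m := 0) (by simp)).continuousAt
  -- Invertibility of the derivative is an open condition. The source is shrunk until it holds
  -- everywhere, which makes the inverse smooth on the whole target and not only at the image of
  -- `x`.
  have hinv : ∀ᶠ y in 𝓝 x, fderiv ℝ f y ∈ range ((↑) : (E ≃L[ℝ] F) → E →L[ℝ] F) :=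
    hcont.eventually_mem (by rw [hf'.fderiv]; exact f'.nhds)
  have hall : {y | y ∈ s ∧ ContDiffAt ℝ ∞ f y ∧
      fderiv ℝ f y ∈ range ((↑) : (E ≃L[ℝ] F) → E →L[ℝ] F)} ∈ 𝓝 x := by
    filter_upwards [hs, hf, hinv] with y h1 h2 h3 using ⟨h1, h2, h3⟩
  obtain ⟨O, hO, hOo, hxO⟩ := mem_nhds_iff.1 hall
  let e := e₀.restrOpen O hOo
  have hsrc : e.source = e₀.source ∩ O := rfl
  refine ⟨e, ⟨hfx.mem_toOpenPartialHomeomorph_source hf' hn, hxO⟩, fun y hy => (hO hy.2).1, rfl,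
    fun y hy => (hO hy.2).2.1.contDiffWithinAt, fun z hz => ?_⟩
  have hz' := hO (e.map_target hz).2
  obtain ⟨g, hg⟩ := hz'.2.2
  refine (e.contDiffAt_symm (f₀' := g) hz ?_ hz'.2.1).contDiffWithinAt
  rw [hg]
  exact (hz'.2.1.differentiableAt hn).hasFDerivAt

end InverseFunction

/-! ### Smoothness of composition operators on spaces of continuous maps -/

section Nemytskii

variable {K E F : Type*} [TopologicalSpace K] [CompactSpace K]
  [NormedAddCommGroup E] [NormedSpace ℝ E] [NormedAddCommGroup F] [NormedSpace ℝ F]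

/-- Pointwise application of a continuous family of operators to a continuous family of vectors. -/
def pointwiseApply (K E F : Type*) [TopologicalSpace K] [CompactSpace K]
    [NormedAddCommGroup E] [NormedSpace ℝ E] [NormedAddCommGroup F] [NormedSpace ℝ F] :
    C(K, E →L[ℝ] F) →L[ℝ] C(K, E) →L[ℝ] C(K, F) :=
  LinearMap.mkContinuous₂
    (LinearMap.mk₂ ℝ (fun (A : C(K, E →L[ℝ] F)) (h : C(K, E)) =>
        (⟨fun s => A s (h s), by fun_prop⟩ : C(K, F)))
      (fun A B h => by ext; simp) (fun c A h => by ext; simp)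
      (fun A h k => by ext; simp) (fun c A h => by ext; simp)) 1
    (fun A h => by
      rw [one_mul, ContinuousMap.norm_le _ (by positivity)]
      intro s
      simp only [LinearMap.mk₂_apply, ContinuousMap.coe_mk]
      exact (A s).le_of_opNorm_le_of_le (A.norm_coe_le_norm s) (h.norm_coe_le_norm s))

theorem pointwiseApply_apply (A : C(K, E →L[ℝ] F)) (h : C(K, E)) (s : K) :
    pointwiseApply K E F A h s = A s (h s) := rfl

/-- Mean value inequality on each segment from `α s` to `α s + h s`. The variation of `f'` along it
is at most `ε` uniformly in `s`, because `β ↦ f' ∘ β` is continuous for the uniform norm; no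
compactness in `E` is involved. -/
theorem hasFDerivAt_postcomp {f : C(E, F)} {f' : C(E, E →L[ℝ] F)}
    (hf : ∀ x, HasFDerivAt f (f' x) x) (α : C(K, E)) :
    HasFDerivAt (fun β : C(K, E) => f.comp β) (pointwiseApply K E F (f'.comp α)) α := by
  rw [hasFDerivAt_iff_isLittleO_nhds_zero, Asymptotics.isLittleO_iff]
  intro ε hε
  have hc : ContinuousAt (fun β : C(K, E) => f'.comp β) α :=
    (ContinuousMap.continuous_postcomp f').continuousAt
  obtain ⟨δ, hδ, H⟩ := (Metric.continuousAt_iff (f := fun β : C(K, E) => f'.comp β)).1 hc ε hε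
  filter_upwards [Metric.ball_mem_nhds (0 : C(K, E)) hδ] with h hh
  rw [mem_ball_zero_iff] at hh
  rw [ContinuousMap.norm_le _ (by positivity)]
  intro s
  simp only [ContinuousMap.sub_apply, ContinuousMap.comp_apply, ContinuousMap.add_apply,
    pointwiseApply_apply]
  have key := (convex_segment (α s) (α s + h s)).norm_image_sub_le_of_norm_hasFDerivWithin_le'
    (f := f) (f' := fun y => f' y) (φ := f' (α s)) (C := ε)
    (fun y _ => (hf y).hasFDerivWithinAt) (fun y hy => ?_) (left_mem_segment ℝ _ _)
    (right_mem_segment ℝ _ _)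
  · rw [add_sub_cancel_left] at key
    exact key.trans (mul_le_mul_of_nonneg_left (h.norm_coe_le_norm s) hε.le)
  · rw [segment_eq_image'] at hy
    obtain ⟨θ, hθ, rfl⟩ := hy
    rw [add_sub_cancel_left]
    -- A point of the segment is the value at `s` of the function `α + θ • h`, which lies in the
    -- same `δ`-ball around `α`.
    have h1 := H (x := α + θ • h) (by
      rw [dist_eq_norm, add_sub_cancel_left, norm_smul, Real.norm_of_nonneg hθ.1]
      exact (mul_le_of_le_one_left (norm_nonneg _) hθ.2).trans_lt hh)
    rw [← dist_eq_norm]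
    exact (ContinuousMap.dist_apply_le_dist (f := f'.comp (α + θ • h)) (g := f'.comp α) s).trans
      h1.le

/-- Induction on the order: the derivative is postcomposition with `f'` followed by the continuous
linear map `pointwiseApply`. The target changes to `E →L[ℝ] F` in the induction, which is why `F` is
quantified inside and shares its universe with `E`. -/
theorem contDiff_postcomp_nat {E : Type u} [NormedAddCommGroup E] [NormedSpace ℝ E] (n : ℕ) :
    ∀ {F : Type u} [NormedAddCommGroup F] [NormedSpace ℝ F] (f : C(E, F)), ContDiff ℝ n f → ContDiff ℝ n (fun β : C(K, E) => f.comp β) := by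
  induction n with
  | zero =>
    intro F _ _ f _
    exact contDiff_zero.2 (ContinuousMap.continuous_postcomp f)
  | succ n ih =>
    intro F _ _ f hf
    have h1 : (1 : WithTop ℕ∞) ≤ (n + 1 : ℕ) := by exact_mod_cast Nat.le_add_left 1 n
    let f' : C(E, E →L[ℝ] F) := ⟨fderiv ℝ f, hf.continuous_fderiv (by positivity)⟩
    have hf' : ContDiff ℝ n f' := hf.fderiv_right (by norm_cast)
    have hder := fun α : C(K, E) => hasFDerivAt_postcomp (f := f) (f' := f')
      (fun x => (hf.differentiable (by positivity) x).hasFDerivAt) α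
    push_cast
    rw [contDiff_succ_iff_fderiv]
    refine ⟨fun α => (hder α).differentiableAt, by simp, ?_⟩
    have : fderiv ℝ (fun β : C(K, E) => f.comp β) =
        fun α => pointwiseApply K E F (f'.comp α) := funext fun α => (hder α).fderiv
    rw [this]
    exact (pointwiseApply K E F).contDiff.comp (ih f' hf')

theorem contDiff_postcomp {E F : Type u} [NormedAddCommGroup E] [NormedSpace ℝ E]
    [NormedAddCommGroup F] [NormedSpace ℝ F] (f : C(E, F)) (hf : ContDiff ℝ ∞ f) :
    ContDiff ℝ ∞ (fun β : C(K, E) => f.comp β) :=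
  contDiff_infty.2 fun n => contDiff_postcomp_nat n f (contDiff_infty.1 hf n)

end Nemytskii

/-! ### Smooth flows from the inverse function theorem -/

section Flow

variable {E : Type u} [NormedAddCommGroup E] [NormedSpace ℝ E] [CompleteSpace E]

/-- The primitive, vanishing at `0`, of a continuous function on `[-1, 1]`. -/
def primitive (E : Type*) [NormedAddCommGroup E] [NormedSpace ℝ E] :
    C(Icc (-1 : ℝ) 1, E) →L[ℝ] C(Icc (-1 : ℝ) 1, E) :=
  LinearMap.mkContinuous
    { toFun := fun f => ⟨fun s => ∫ t in (0 : ℝ)..s, IccExtend (by norm_num : (-1 : ℝ) ≤ 1) f t, by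
        have := intervalIntegral.continuous_primitive (μ := MeasureTheory.volume)
          (fun a b => (f.continuous.Icc_extend' (h := by norm_num)).intervalIntegrable a b) 0
        exact this.comp continuous_subtype_val⟩
      map_add' := fun f g => by
        ext s
        have hf := (f.continuous.Icc_extend' (h := by norm_num)).intervalIntegrable
          (μ := MeasureTheory.volume) 0 s
        have hg := (g.continuous.Icc_extend' (h := by norm_num)).intervalIntegrable
          (μ := MeasureTheory.volume) 0 s
        exact intervalIntegral.integral_add hf hg
      map_smul' := fun c f => by
        ext s
        exact intervalIntegral.integral_smul c _ } 1
    (fun f => by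
      rw [one_mul, ContinuousMap.norm_le _ (norm_nonneg _)]
      intro s
      have h := intervalIntegral.norm_integral_le_of_norm_le_const (a := (0 : ℝ)) (b := s)
        (f := IccExtend (by norm_num : (-1 : ℝ) ≤ 1) f) (C := ‖f‖)
        (fun t _ => f.norm_coe_le_norm _)
      refine h.trans (mul_le_of_le_one_right (norm_nonneg _) ?_)
      rw [sub_zero]
      exact abs_le.2 s.2)

theorem primitive_apply (f : C(Icc (-1 : ℝ) 1, E)) (s : Icc (-1 : ℝ) 1) :
    primitive E f s = ∫ t in (0 : ℝ)..s, IccExtend (by norm_num : (-1 : ℝ) ≤ 1) f t := rfl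

/-- The linear map sending a vector to the constant function. -/
def constMap (K E : Type*) [TopologicalSpace K] [CompactSpace K]
    [NormedAddCommGroup E] [NormedSpace ℝ E] : E →L[ℝ] C(K, E) :=
  LinearMap.mkContinuous
    { toFun := fun x => ContinuousMap.const K x
      map_add' := fun _ _ => rfl
      map_smul' := fun _ _ => rfl } 1
    (fun x => by
      rw [one_mul, ContinuousMap.norm_le _ (norm_nonneg _)]
      exact fun _ => le_rfl)

theorem constMap_apply {K : Type*} [TopologicalSpace K] [CompactSpace K] (x : E) (s : K) :
    constMap K E x s = x := rfl

/-- Reparametrization of `[-1, 1]` by a factor `s ∈ [-1, 1]`. -/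
def scaleMap (s : Icc (-1 : ℝ) 1) : C(Icc (-1 : ℝ) 1, Icc (-1 : ℝ) 1) :=
  ⟨fun r => ⟨s * r, by
    rw [mem_Icc, ← abs_le, abs_mul]
    exact mul_le_one₀ (abs_le.2 s.2) (abs_nonneg _) (abs_le.2 r.2)⟩, by fun_prop⟩

/-- Substitution in the integral. It turns a solution of the integral equation with time parameter
`lam`, rescaled by `s`, into a solution with parameter `s * lam`. -/
theorem primitive_comp_scaleMap (f : C(Icc (-1 : ℝ) 1, E)) (s r : Icc (-1 : ℝ) 1) :
    (s : ℝ) • primitive E (f.comp (scaleMap s)) r = primitive E f (scaleMap s r) := by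
  have hr : ((scaleMap s r : Icc (-1 : ℝ) 1) : ℝ) = s * r := rfl
  rw [primitive_apply, primitive_apply, hr]
  have h := intervalIntegral.smul_integral_comp_mul_left (a := (0 : ℝ)) (b := r)
    (IccExtend (by norm_num : (-1 : ℝ) ≤ 1) f) (s : ℝ)
  rw [mul_zero] at h
  rw [← h]
  congr 1
  refine intervalIntegral.integral_congr fun t ht => ?_
  have ht' : t ∈ Icc (-1 : ℝ) 1 := by
    have h0 : (0 : ℝ) ∈ Icc (-1 : ℝ) 1 := by constructor <;> norm_num
    exact (uIcc_subset_Icc h0 r.2) ht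
  have hst : (s : ℝ) * t ∈ Icc (-1 : ℝ) 1 := (scaleMap s ⟨t, ht'⟩).2
  rw [IccExtend_of_mem _ _ ht', IccExtend_of_mem _ _ hst]
  rfl

/-- A solution curve on a time interval of half-length `|lam|`, reparametrized to `[-1, 1]`, is a
zero of `α - x - lam • ∫ X ∘ α` in the Banach space of continuous curves. At `lam = 0` the
derivative in `α` is the identity, so the inverse function theorem provides a solution `Ψ (lam, x)`
that is smooth in its parameters, and the flow is its value at the endpoint `1`. -/
theorem exists_smooth_flow_of_contDiff {X : E → E} (hX : ContDiff ℝ ∞ X) (x₀ : E) :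
    ∃ Φ : ℝ × E → E, (∀ᶠ p in 𝓝 ((0 : ℝ), x₀), ContDiffAt ℝ ∞ Φ p) ∧
      (∀ᶠ x in 𝓝 x₀, Φ (0, x) = x) ∧
      ∀ᶠ p in 𝓝 ((0 : ℝ), x₀), HasDerivAt (fun t => Φ (t, p.2)) (X (Φ p)) p.1 := by
  let I := Icc (-1 : ℝ) 1
  let Xc : C(E, E) := ⟨X, hX.continuous⟩
  let N : C(I, E) → C(I, E) := fun α => Xc.comp α
  have hN : ContDiff ℝ ∞ N := contDiff_postcomp Xc hX
  let G : (ℝ × E) × C(I, E) → C(I, E) := fun p =>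
    p.2 - constMap I E p.1.2 - p.1.1 • primitive E (N p.2)
  have hG : ContDiff ℝ ∞ G := by
    have h1 : ContDiff ℝ ∞ fun p : (ℝ × E) × C(I, E) => primitive E (N p.2) :=
      (primitive E).contDiff.comp (hN.comp contDiff_snd)
    have h2 : ContDiff ℝ ∞ fun p : (ℝ × E) × C(I, E) => constMap I E p.1.2 :=
      (constMap I E).contDiff.comp (contDiff_snd.comp contDiff_fst)
    exact (contDiff_snd.sub h2).sub ((contDiff_fst.comp contDiff_fst).smul h1)
  let c₀ : C(I, E) := constMap I E x₀
  let v : C(I, E) := primitive E (N c₀)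
  let A : ℝ × E →L[ℝ] C(I, E) :=
    -((constMap I E).comp (ContinuousLinearMap.snd ℝ ℝ E)) -
      (ContinuousLinearMap.fst ℝ ℝ E).smulRight v
  let T : (ℝ × E) × C(I, E) → (ℝ × E) × C(I, E) := fun p => (p.1, G p)
  have hT : ContDiff ℝ ∞ T := contDiff_fst.prodMk hG
  -- The derivative of `T` at the base point is block triangular with identities on the diagonal;
  -- `A` is the derivative of `G` in `(lam, x)`.
  let T' := (ContinuousLinearEquiv.refl ℝ (ℝ × E)).skewProd
    (ContinuousLinearEquiv.refl ℝ (C(I, E))) A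
  have hT' : HasFDerivAt T (T' : (ℝ × E) × C(I, E) →L[ℝ] (ℝ × E) × C(I, E))
      (((0 : ℝ), x₀), c₀) := by
    have hGd : HasFDerivAt G (ContinuousLinearMap.snd ℝ (ℝ × E) C(I, E) +
        A.comp (ContinuousLinearMap.fst ℝ (ℝ × E) C(I, E))) (((0 : ℝ), x₀), c₀) := by
      have hp : HasFDerivAt (fun p : (ℝ × E) × C(I, E) => p.2 - constMap I E p.1.2)
          (ContinuousLinearMap.snd ℝ (ℝ × E) C(I, E) - ((constMap I E).comp
            ((ContinuousLinearMap.snd ℝ ℝ E).comp (ContinuousLinearMap.fst ℝ (ℝ × E) C(I, E)))))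
          (((0 : ℝ), x₀), c₀) := by
        exact (hasFDerivAt_snd).sub
          ((constMap I E).hasFDerivAt.comp _ (hasFDerivAt_snd.comp _ hasFDerivAt_fst))
      have hNd : HasFDerivAt (fun p : (ℝ × E) × C(I, E) => primitive E (N p.2))
          (fderiv ℝ (fun p : (ℝ × E) × C(I, E) => primitive E (N p.2)) (((0 : ℝ), x₀), c₀))
          (((0 : ℝ), x₀), c₀) := by
        refine DifferentiableAt.hasFDerivAt ?_
        exact ((primitive E).contDiff.comp (hN.comp contDiff_snd)).differentiable (by simp) _
      have hl : HasFDerivAt (fun p : (ℝ × E) × C(I, E) => p.1.1)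
          ((ContinuousLinearMap.fst ℝ ℝ E).comp (ContinuousLinearMap.fst ℝ (ℝ × E) C(I, E)))
          (((0 : ℝ), x₀), c₀) := hasFDerivAt_fst.comp _ hasFDerivAt_fst
      refine (hp.sub (hl.smul hNd)).congr_fderiv ?_
      refine ContinuousLinearMap.ext fun w => ?_
      simp [A, v]
      abel
    refine (hasFDerivAt_fst.prodMk hGd).congr_fderiv ?_
    refine ContinuousLinearMap.ext fun w => ?_
    simp [T']
  have hT0 : T (((0 : ℝ), x₀), c₀) = (((0 : ℝ), x₀), 0) := by
    simp [T, G, c₀]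
  obtain ⟨e, hes, -, heT, -, hesymm⟩ := exists_openPartialHomeomorph
    (Eventually.of_forall fun p => hT.contDiffAt) T' hT' univ_mem
  let Ψ : ℝ × E → C(I, E) := fun p => (e.symm (p, 0)).2
  have het : ((((0 : ℝ), x₀), 0) : (ℝ × E) × C(I, E)) ∈ e.target := by
    rw [← hT0, ← heT]
    exact e.map_source hes
  have htgt : ∀ᶠ p in 𝓝 ((0 : ℝ), x₀), ((p, 0) : (ℝ × E) × C(I, E)) ∈ e.target :=
    (Continuous.prodMk_left (0 : C(I, E))).continuousAt.eventually_mem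
      (e.open_target.mem_nhds het)
  have hΨs : ∀ p, ((p, 0) : (ℝ × E) × C(I, E)) ∈ e.target → ContDiffAt ℝ ∞ Ψ p := by
    intro p hp
    have h1 : ContDiffAt ℝ ∞ e.symm (p, 0) := hesymm.contDiffAt (e.open_target.mem_nhds hp)
    exact contDiffAt_snd.comp p (h1.comp p (contDiffAt_id.prodMk contDiffAt_const))
  have hΨeq : ∀ p, ((p, 0) : (ℝ × E) × C(I, E)) ∈ e.target →
      ∀ s : I, Ψ p s = p.2 + p.1 • primitive E (N (Ψ p)) s := by
    intro p hp s
    have h1 := e.right_inv hp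
    rw [heT] at h1
    have h2 : (e.symm (p, 0)).1 = p := congrArg Prod.fst h1
    have h3 : G (e.symm (p, 0)) = 0 := congrArg Prod.snd h1
    have h4 := DFunLike.congr_fun h3 s
    simp only [G, h2, ContinuousMap.sub_apply, ContinuousMap.smul_apply, ContinuousMap.zero_apply,
      constMap_apply] at h4
    rw [sub_sub, sub_eq_zero] at h4
    exact h4
  have hΨ0 : Ψ (0, x₀) = c₀ := by
    have : e.symm ((0, x₀), 0) = ((0, x₀), c₀) := by
      rw [← hT0, ← heT]
      exact e.left_inv hes
    simp [Ψ, this]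
  have hsrc : ∀ᶠ q in 𝓝 (((0 : ℝ), x₀), c₀), q ∈ e.source := e.open_source.mem_nhds hes
  obtain ⟨δ, hδ, hball⟩ := Metric.eventually_nhds_iff.1 hsrc
  have hΨc : ∀ᶠ p in 𝓝 ((0 : ℝ), x₀), dist (Ψ p) c₀ < δ := by
    have := (hΨs _ het).continuousAt.eventually_mem
      (Metric.ball_mem_nhds (Ψ ((0 : ℝ), x₀)) hδ)
    rw [hΨ0] at this
    exact this
  obtain ⟨δ', hδ', hball'⟩ := Metric.eventually_nhds_iff.1 (htgt.and hΨc)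
  let m := min δ δ'
  have hm : 0 < m := lt_min hδ hδ'
  have hone : (1 : ℝ) ∈ Icc (-1 : ℝ) 1 := by constructor <;> norm_num
  have hzero : (0 : ℝ) ∈ Icc (-1 : ℝ) 1 := by constructor <;> norm_num
  -- Local uniqueness: the rescaled curve is again a zero of `G` near `c₀`, hence equal to `Ψ (s *
  -- lam, x)` by injectivity of `e` on its source. This makes the endpoint values for all small
  -- times values of one single curve, so that the time derivative follows from the fundamental
  -- theorem of calculus.
  have hscale : ∀ lam x, |lam| < m → dist x x₀ < m → ∀ s : I,
      Ψ (s * lam, x) ⟨1, hone⟩ = Ψ (lam, x) s := by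
    intro lam x hl hx s
    have hd : dist (lam, x) ((0 : ℝ), x₀) < δ' := by
      rw [Prod.dist_eq, max_lt_iff, Real.dist_0_eq_abs]
      exact ⟨hl.trans_le (min_le_right _ _), hx.trans_le (min_le_right _ _)⟩
    have hsl : |(s : ℝ) * lam| ≤ |lam| := by
      rw [abs_mul]
      exact mul_le_of_le_one_left (abs_nonneg _) (abs_le.2 s.2)
    obtain ⟨h1, h2⟩ := hball' hd
    have h3 : ((((s : ℝ) * lam, x), (Ψ (lam, x)).comp (scaleMap s)) : (ℝ × E) × C(I, E)) ∈
        e.source := by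
      refine hball ?_
      rw [Prod.dist_eq, max_lt_iff, Prod.dist_eq, max_lt_iff, Real.dist_0_eq_abs]
      refine ⟨⟨(hsl.trans_lt hl).trans_le (min_le_left _ _), hx.trans_le (min_le_left _ _)⟩, ?_⟩
      refine lt_of_le_of_lt ?_ h2
      rw [ContinuousMap.dist_le dist_nonneg]
      intro r
      exact ContinuousMap.dist_apply_le_dist (f := Ψ (lam, x)) (g := c₀) (scaleMap s r)
    have h4 : e (((s : ℝ) * lam, x), (Ψ (lam, x)).comp (scaleMap s)) = (((s : ℝ) * lam, x), 0) := by
      rw [heT]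
      refine Prod.ext rfl ?_
      ext r
      simp only [T, G, ContinuousMap.sub_apply, ContinuousMap.smul_apply, ContinuousMap.zero_apply,
        constMap_apply, ContinuousMap.comp_apply]
      rw [hΨeq _ h1 (scaleMap s r), ← primitive_comp_scaleMap, mul_comm, mul_smul]
      simp only [add_sub_cancel_left]
      exact sub_self _
    have h5 := e.left_inv h3
    rw [h4] at h5
    have h6 : Ψ ((s : ℝ) * lam, x) = (Ψ (lam, x)).comp (scaleMap s) := congrArg Prod.snd h5
    rw [h6, ContinuousMap.comp_apply]
    congr 1
    exact Subtype.ext (mul_one _)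
  let Φ : ℝ × E → E := fun p => Ψ p ⟨1, hone⟩
  let lam := m / 2
  have hlam : 0 < lam := half_pos hm
  have hlam' : |lam| < m := by rw [abs_of_pos hlam]; exact half_lt_self hm
  have hΦ : ∀ t x, |t| ≤ lam → dist x x₀ < m → Φ (t, x) =
      x + lam • ∫ r in (0 : ℝ)..(t / lam),
        IccExtend (by norm_num : (-1 : ℝ) ≤ 1) (N (Ψ (lam, x))) r := by
    intro t x ht hx
    have hs : t / lam ∈ Icc (-1 : ℝ) 1 := by
      rw [mem_Icc, ← abs_le, abs_div, abs_of_pos hlam]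
      exact (div_le_one hlam).2 ht
    have h1 := hscale lam x hlam' hx ⟨t / lam, hs⟩
    simp only [div_mul_cancel₀ t hlam.ne'] at h1
    have hd : dist (lam, x) ((0 : ℝ), x₀) < δ' := by
      rw [Prod.dist_eq, max_lt_iff, Real.dist_0_eq_abs]
      exact ⟨hlam'.trans_le (min_le_right _ _), hx.trans_le (min_le_right _ _)⟩
    change Ψ (t, x) _ = _
    rw [h1, hΨeq _ (hball' hd).1]
    rfl
  refine ⟨Φ, ?_, ?_, ?_⟩
  · filter_upwards [htgt] with p hp
    exact (ContinuousMap.evalCLM ℝ (⟨1, hone⟩ : I)).contDiff.contDiffAt.comp p (hΨs p hp)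
  · filter_upwards [Metric.ball_mem_nhds x₀ hm] with x hx
    rw [hΦ 0 x (by simpa using hlam.le) hx]
    simp
  · have hnear : ∀ᶠ p : ℝ × E in 𝓝 ((0 : ℝ), x₀), |p.1| < lam ∧ dist p.2 x₀ < m := by
      refine Metric.eventually_nhds_iff.2 ⟨lam, hlam, fun p hp => ?_⟩
      rw [Prod.dist_eq, max_lt_iff, Real.dist_0_eq_abs] at hp
      exact ⟨hp.1, hp.2.trans (half_lt_self hm)⟩
    filter_upwards [hnear] with p hp
    obtain ⟨t, x⟩ := p
    obtain ⟨ht, hx⟩ := hp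
    have hev : (fun t' => Φ (t', x)) =ᶠ[𝓝 t] fun t' => x + lam • ∫ r in (0 : ℝ)..(t' / lam),
        IccExtend (by norm_num : (-1 : ℝ) ≤ 1) (N (Ψ (lam, x))) r := by
      have : ∀ᶠ t' : ℝ in 𝓝 t, |t'| < lam := continuous_abs.continuousAt.eventually_lt_const ht
      filter_upwards [this] with t' ht'
      exact hΦ t' x ht'.le hx
    have hs : t / lam ∈ Icc (-1 : ℝ) 1 := by
      rw [mem_Icc, ← abs_le, abs_div, abs_of_pos hlam]
      exact (div_le_one hlam).2 ht.le
    have hval : IccExtend (by norm_num : (-1 : ℝ) ≤ 1) (N (Ψ (lam, x))) (t / lam) =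
        X (Φ (t, x)) := by
      rw [IccExtend_of_mem _ _ hs]
      have h1 := hscale lam x hlam' hx ⟨t / lam, hs⟩
      simp only [div_mul_cancel₀ t hlam.ne'] at h1
      change X (Ψ (lam, x) ⟨t / lam, hs⟩) = X (Ψ (t, x) _)
      rw [h1]
    refine HasDerivAt.congr_of_eventuallyEq ?_ hev
    have hint := (((N (Ψ (lam, x))).continuous.Icc_extend'
      (h := by norm_num)).integral_hasStrictDerivAt (0 : ℝ) (t / lam)).hasDerivAt
    have hd := (hint.scomp t ((hasDerivAt_id t).div_const lam)).const_smul lam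
    refine (hd.const_add x).congr_deriv ?_
    rw [smul_smul, mul_one_div_cancel hlam.ne', one_smul]
    exact hval

end Flow

/-! ### Flow boxes adapted to a transverse hypersurface -/

section FlowBox

variable {E : Type u} [NormedAddCommGroup E] [NormedSpace ℝ E] [FiniteDimensional ℝ E]

/-- A bump function equal to one near `x` makes local data global; the construction of the flow uses
a field that is smooth on the whole space. -/
theorem exists_contDiff_eventuallyEq {F : Type*} [NormedAddCommGroup F] [NormedSpace ℝ F]
    {f : E → F} {x : E} (hf : ∀ᶠ y in 𝓝 x, ContDiffAt ℝ ∞ f y) :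
    ∃ g : E → F, ContDiff ℝ ∞ g ∧ g =ᶠ[𝓝 x] f := by
  obtain ⟨r, hr, hball⟩ := Metric.eventually_nhds_iff_ball.1 hf
  let b : ContDiffBump x := ⟨r / 4, r / 2, by positivity, by linarith⟩
  refine ⟨fun y => b y • f y, contDiff_iff_contDiffAt.2 fun y => ?_, ?_⟩
  · by_cases hy : y ∈ Metric.ball x r
    · exact b.contDiffAt.smul (hball y hy)
    · have hy' : y ∉ tsupport b := by
        rw [b.tsupport_eq]
        intro h
        exact hy (Metric.closedBall_subset_ball (by simp [b]; linarith) h)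
      have hev : (fun y => b y • f y) =ᶠ[𝓝 y] fun _ => 0 := by
        filter_upwards [(isClosed_tsupport b).isOpen_compl.mem_nhds hy'] with z hz
        rw [image_eq_zero_of_notMem_tsupport hz, zero_smul]
      exact contDiffAt_const.congr_of_eventuallyEq hev
  · filter_upwards [b.eventuallyEq_one] with y hy
    simp [hy]

theorem exists_smooth_flow {X : E → E} {x₀ : E} (hX : ∀ᶠ y in 𝓝 x₀, ContDiffAt ℝ ∞ X y) :
    ∃ Φ : ℝ × E → E, (∀ᶠ p in 𝓝 ((0 : ℝ), x₀), ContDiffAt ℝ ∞ Φ p) ∧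
      (∀ᶠ x in 𝓝 x₀, Φ (0, x) = x) ∧
      ∀ᶠ p in 𝓝 ((0 : ℝ), x₀), HasDerivAt (fun t => Φ (t, p.2)) (X (Φ p)) p.1 := by
  have : CompleteSpace E := FiniteDimensional.complete ℝ E
  obtain ⟨Y, hY, hYX⟩ := exists_contDiff_eventuallyEq hX
  obtain ⟨Φ, h1, h2, h3⟩ := exists_smooth_flow_of_contDiff hY x₀
  refine ⟨Φ, h1, h2, ?_⟩
  have hc : Tendsto Φ (𝓝 ((0 : ℝ), x₀)) (𝓝 x₀) := by
    have := h1.self_of_nhds.continuousAt.tendsto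
    rwa [h2.self_of_nhds] at this
  filter_upwards [h3, hc.eventually hYX] with p hp hq
  rwa [hq] at hp

/-- Flow box theorem: near a point where `X` is transverse to the zero set of `f`, there are
coordinates `(t, z)` in which `X = ∂/∂t` and the zero set of `f` is `{t = 0}`. -/
theorem exists_flowBox {X : E → E} {f : E → ℝ} {x₀ : E}
    (hX : ∀ᶠ y in 𝓝 x₀, ContDiffAt ℝ ∞ X y) (hf : ∀ᶠ y in 𝓝 x₀, ContDiffAt ℝ ∞ f y)
    (hf0 : f x₀ = 0) (hne : fderiv ℝ f x₀ (X x₀) ≠ 0) :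
    ∃ (Z : Submodule ℝ E) (Φ : OpenPartialHomeomorph (ℝ × Z) E),
      Module.finrank ℝ Z + 1 = Module.finrank ℝ E ∧
      (0, 0) ∈ Φ.source ∧ Φ (0, 0) = x₀ ∧
      ContDiffOn ℝ ∞ Φ Φ.source ∧ ContDiffOn ℝ ∞ Φ.symm Φ.target ∧
      (∀ p ∈ Φ.source, HasDerivAt (fun t => Φ (t, p.2)) (X (Φ p)) p.1) ∧
      ∀ p ∈ Φ.source, f (Φ p) = 0 ↔ p.1 = 0 := by
  have : CompleteSpace E := FiniteDimensional.complete ℝ E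
  have hn : (∞ : WithTop ℕ∞) ≠ 0 := by simp
  let l := fderiv ℝ f x₀
  let v := X x₀
  let c := l v
  have hc : c ≠ 0 := hne
  let Z : Submodule ℝ E := LinearMap.ker (l : E →ₗ[ℝ] ℝ)
  have hfr : Module.finrank ℝ Z + 1 = Module.finrank ℝ E := by
    have h1 := LinearMap.finrank_range_add_finrank_ker (l : E →ₗ[ℝ] ℝ)
    have h2 : LinearMap.range (l : E →ₗ[ℝ] ℝ) = ⊤ := by
      rw [LinearMap.range_eq_top]
      exact LinearMap.surjective fun h => hc (by simpa using LinearMap.congr_fun h v)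
    rw [h2, finrank_top, Module.finrank_self, add_comm] at h1
    exact h1
  -- The projection onto the kernel of `df` along `X x₀`.
  let P : E →L[ℝ] Z := (ContinuousLinearMap.id ℝ E - (c⁻¹ • l).smulRight v).codRestrict Z
    (fun w => by
      change l (w - (c⁻¹ • l w) • v) = 0
      rw [map_sub, map_smul]
      change l w - (c⁻¹ * l w) * c = 0
      field_simp
      simp)
  have hP : ∀ w, (P w : E) = w - (c⁻¹ * l w) • v := fun w => rfl
  have hPZ : ∀ z : Z, P z = z := fun z => by
    apply Subtype.ext
    rw [hP, show l z = 0 from z.2]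
    simp
  have hPv : P v = 0 := by
    apply Subtype.ext
    rw [hP, show l v = c from rfl, inv_mul_cancel₀ hc]
    simp
  let Q : E ≃L[ℝ] ℝ × Z := ContinuousLinearEquiv.equivOfInverse ((c⁻¹ • l).prod P)
    ((ContinuousLinearMap.fst ℝ ℝ Z).smulRight v +
      Z.subtypeL.comp (ContinuousLinearMap.snd ℝ ℝ Z))
    (fun w => by
      change (c⁻¹ * l w) • v + (P w : E) = w
      rw [hP]
      abel)
    (fun p => by
      obtain ⟨t, z⟩ := p
      have hz : l z = 0 := z.2
      refine Prod.ext ?_ ?_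
      · change c⁻¹ * l (t • v + z) = t
        rw [map_add, hz, map_smul]
        change c⁻¹ * (t * c + 0) = t
        field_simp
        simp
      · change P (t • v + z) = z
        rw [map_add, map_smul, hPv, hPZ]
        simp)
  have hQsymm : ∀ t z, Q.symm (t, z) = t • v + z := fun t z => rfl
  let ψ : E → ℝ × Z := fun x => (c⁻¹ * f x, P (x - x₀))
  have hψs : ∀ᶠ y in 𝓝 x₀, ContDiffAt ℝ ∞ ψ y := by
    filter_upwards [hf] with y hy
    exact (contDiffAt_const.mul hy).prodMk
      (P.contDiff.contDiffAt.comp y (contDiffAt_id.sub contDiffAt_const))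
  have hψd : HasFDerivAt ψ (Q : E →L[ℝ] ℝ × Z) x₀ :=
    ((hf.self_of_nhds.differentiableAt hn).hasFDerivAt.const_mul c⁻¹).prodMk
      (P.hasFDerivAt.comp x₀ ((hasFDerivAt_id x₀).sub_const x₀))
  obtain ⟨e, hes, -, heψ, -, hesymm⟩ := exists_openPartialHomeomorph hψs Q hψd univ_mem
  have hψ0 : ψ x₀ = (0, 0) := by simp [ψ, hf0]
  have het : ((0 : ℝ), (0 : Z)) ∈ e.target := by
    rw [← hψ0, ← heψ]
    exact e.map_source hes
  have hesymm0 : e.symm (0, 0) = x₀ := by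
    rw [← hψ0, ← heψ]
    exact e.left_inv hes
  -- A parametrization of the zero set of `f`, whose first coordinate under `ψ` is zero.
  let ι : Z → E := fun z => e.symm (0, z)
  have hι0 : ι 0 = x₀ := hesymm0
  have hιt : ∀ᶠ z in 𝓝 (0 : Z), ((0 : ℝ), z) ∈ e.target :=
    (Continuous.prodMk_right (0 : ℝ)).continuousAt.eventually_mem (e.open_target.mem_nhds het)
  have hιs : ∀ᶠ z in 𝓝 (0 : Z), ContDiffAt ℝ ∞ ι z := by
    filter_upwards [hιt] with z hz
    exact (hesymm.contDiffAt (e.open_target.mem_nhds hz)).comp z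
      (contDiffAt_const.prodMk contDiffAt_id)
  have hιf : ∀ᶠ z in 𝓝 (0 : Z), f (ι z) = 0 := by
    filter_upwards [hιt] with z hz
    have := e.right_inv hz
    rw [heψ] at this
    have h1 : c⁻¹ * f (ι z) = 0 := congrArg Prod.fst this
    exact (mul_eq_zero.1 h1).resolve_left (inv_ne_zero hc)
  have hιd : HasFDerivAt ι Z.subtypeL 0 := by
    have h1 : HasFDerivAt e.symm (Q.symm : ℝ × Z →L[ℝ] E) ((0 : ℝ), (0 : Z)) := by
      refine e.hasFDerivAt_symm het ?_
      rw [hesymm0, heψ]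
      exact hψd
    have h2 : HasFDerivAt (fun z : Z => ((0 : ℝ), z)) (ContinuousLinearMap.inr ℝ ℝ Z) 0 :=
      hasFDerivAt_prodMk_right _ _
    refine (h1.comp (0 : Z) h2).congr_fderiv ?_
    ext z
    simp [hQsymm]
  obtain ⟨φ, hφs, hφ0, hφd⟩ := exists_smooth_flow hX
  have hφ00 : φ (0, x₀) = x₀ := hφ0.self_of_nhds
  -- The flow box: start on the hypersurface at `ι z` and flow for time `t`. At the origin its
  -- derivative is `(t, z) ↦ t • v + z`, which is invertible by transversality.
  let g : ℝ × Z → E := fun p => φ (p.1, ι p.2)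
  have hg0 : g (0, 0) = x₀ := by simp [g, hι0, hφ00]
  have hιc : Tendsto (fun p : ℝ × Z => (p.1, ι p.2)) (𝓝 (0, 0)) (𝓝 (0, x₀)) := by
    have : ContinuousAt (fun p : ℝ × Z => (p.1, ι p.2)) (0, 0) :=
      continuousAt_fst.prodMk (ContinuousAt.comp (f := Prod.snd) (x := ((0 : ℝ), (0 : Z)))
        hιs.self_of_nhds.continuousAt continuousAt_snd)
    have h2 := this.tendsto
    rwa [hι0] at h2
  have hsnd : Tendsto (Prod.snd : ℝ × Z → Z) (𝓝 (0, 0)) (𝓝 0) := continuousAt_snd.tendsto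
  have hgs : ∀ᶠ p in 𝓝 ((0 : ℝ), (0 : Z)), ContDiffAt ℝ ∞ g p := by
    filter_upwards [hιc.eventually hφs, hsnd.eventually hιs] with p h1 h2
    exact ContDiffAt.comp p h1 (contDiffAt_fst.prodMk (h2.comp p contDiffAt_snd))
  have hgd : ∀ᶠ p in 𝓝 ((0 : ℝ), (0 : Z)), HasDerivAt (fun t => g (t, p.2)) (X (g p)) p.1 := by
    filter_upwards [hιc.eventually hφd] with p h1
    exact h1
  have hφfd : HasFDerivAt φ ((ContinuousLinearMap.fst ℝ ℝ E).smulRight v +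
      ContinuousLinearMap.snd ℝ ℝ E) (0, x₀) := by
    have h1 := (hφs.self_of_nhds.differentiableAt hn).hasFDerivAt
    refine h1.congr_fderiv ?_
    have ha : HasDerivAt (fun t => φ (t, x₀)) (fderiv ℝ φ (0, x₀) (1, 0)) 0 :=
      HasFDerivAt.comp_hasDerivAt (f := fun t : ℝ => (t, x₀)) 0 h1
        ((hasDerivAt_id 0).prodMk (hasDerivAt_const 0 x₀))
    have ha' : HasDerivAt (fun t => φ (t, x₀)) v 0 := by
      have := hφd.self_of_nhds
      rwa [hφ00] at this
    have hb : HasFDerivAt (fun x => φ (0, x))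
        ((fderiv ℝ φ (0, x₀)).comp (ContinuousLinearMap.inr ℝ ℝ E)) x₀ :=
      HasFDerivAt.comp (f := fun x : E => ((0 : ℝ), x)) x₀ h1 (hasFDerivAt_prodMk_right _ _)
    have hb' : HasFDerivAt (fun x => φ (0, x)) (ContinuousLinearMap.id ℝ E) x₀ :=
      (hasFDerivAt_id x₀).congr_of_eventuallyEq hφ0
    have e1 := ha.unique ha'
    have e2 := hb.unique hb'
    refine ContinuousLinearMap.ext fun w => ?_
    obtain ⟨t, w⟩ := w
    have h3 := DFunLike.congr_fun e2 w
    have h4 : ((t, w) : ℝ × E) = t • ((1 : ℝ), (0 : E)) + (0, w) := by simp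
    rw [h4, map_add, map_smul, e1]
    simp only [ContinuousLinearMap.comp_apply, ContinuousLinearMap.inr_apply] at h3
    rw [h3]
    simp
  have hgfd : HasFDerivAt g (Q.symm : ℝ × Z →L[ℝ] E) (0, 0) := by
    have h1 : HasFDerivAt (fun p : ℝ × Z => (p.1, ι p.2))
        ((ContinuousLinearMap.fst ℝ ℝ Z).prod (Z.subtypeL.comp (ContinuousLinearMap.snd ℝ ℝ Z)))
        (0, 0) := hasFDerivAt_fst.prodMk
          (HasFDerivAt.comp (f := Prod.snd) ((0 : ℝ), (0 : Z)) hιd hasFDerivAt_snd)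
    have h2 : HasFDerivAt φ ((ContinuousLinearMap.fst ℝ ℝ E).smulRight v +
      ContinuousLinearMap.snd ℝ ℝ E) ((fun p : ℝ × Z => (p.1, ι p.2)) (0, 0)) := by
      simp only [hι0]
      exact hφfd
    refine (h2.comp (0, 0) h1).congr_fderiv ?_
    refine ContinuousLinearMap.ext fun w => ?_
    rw [ContinuousLinearEquiv.coe_coe, show w = (w.1, w.2) from rfl, hQsymm]
    simp
  have hfg : Tendsto g (𝓝 (0, 0)) (𝓝 x₀) := by
    have := hgs.self_of_nhds.continuousAt.tendsto
    rwa [hg0] at this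
  have htrans : ∀ᶠ y in 𝓝 x₀, fderiv ℝ f y (X y) ≠ 0 := by
    have h1 : ContinuousAt (fun y => fderiv ℝ f y (X y)) x₀ :=
      (hf.self_of_nhds.fderiv_right (m := 0) (by simp)).continuousAt.clm_apply
        hX.self_of_nhds.continuousAt
    exact h1.eventually_ne hne
  have hιt0 : Tendsto ι (𝓝 0) (𝓝 x₀) := by
    have := hιs.self_of_nhds.continuousAt.tendsto
    rwa [hι0] at this
  have hall := ((hgd.and (hfg.eventually (hf.and htrans))).and (hsnd.eventually hιf)).and
    (hsnd.eventually (hιt0.eventually hφ0))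
  obtain ⟨r, hr, hball⟩ := Metric.eventually_nhds_iff_ball.1 hall
  obtain ⟨Φ, hΦs, hΦsub, hΦg, hΦ1, hΦ2⟩ := exists_openPartialHomeomorph hgs Q.symm hgfd
    (Metric.ball_mem_nhds _ hr)
  refine ⟨Z, Φ, hfr, hΦs, by rw [hΦg, hg0], hΦ1, hΦ2, fun p hp => ?_, fun p hp => ?_⟩
  · rw [hΦg]
    exact (hball p (hΦsub hp)).1.1.1
  · rw [hΦg]
    obtain ⟨t, z⟩ := p
    have hpb := hΦsub hp
    have hseg : ∀ s : ℝ, |s| ≤ |t| → (s, z) ∈ Metric.ball ((0 : ℝ), (0 : Z)) r := by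
      intro s hs
      rw [Metric.mem_ball, Prod.dist_eq, max_lt_iff, Real.dist_0_eq_abs] at hpb ⊢
      exact ⟨hs.trans_lt hpb.1, hpb.2⟩
    have hz0 : f (g (0, z)) = 0 := by
      have h := hball _ hpb
      change f (φ (0, ι z)) = 0
      rw [h.2]
      exact h.1.2
    have hdz : ∀ s : ℝ, |s| ≤ |t| → HasDerivAt (fun s => f (g (s, z)))
        (fderiv ℝ f (g (s, z)) (X (g (s, z)))) s := fun s hs =>
      ((hball _ (hseg s hs)).1.1.2.1.differentiableAt hn).hasFDerivAt.comp_hasDerivAt s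
        (hball _ (hseg s hs)).1.1.1
    -- Along the flow line through `ι z` the function `f` vanishes at time `0` and has nonzero
    -- derivative, so by Rolle's theorem it has no other zero.
    refine ⟨fun h0 => ?_, fun h0 => ?_⟩
    · by_contra ht
      simp only at ht
      rcases lt_or_gt_of_ne ht with hlt | hgt
      · have hab : ∀ s ∈ Icc t 0, |s| ≤ |t| := fun s hs => by
          rw [abs_of_nonpos hs.2, abs_of_neg hlt]
          linarith [hs.1]
        obtain ⟨s, hs, hs0⟩ := exists_hasDerivAt_eq_zero hlt
          (fun s hs => (hdz s (hab s hs)).continuousAt.continuousWithinAt) (h0.trans hz0.symm)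
          (fun s hs => hdz s (hab s (Ioo_subset_Icc_self hs)))
        exact (hball _ (hseg s (hab s (Ioo_subset_Icc_self hs)))).1.1.2.2 hs0
      · have hab : ∀ s ∈ Icc 0 t, |s| ≤ |t| := fun s hs => by
          rw [abs_of_nonneg hs.1, abs_of_pos hgt]
          exact hs.2
        obtain ⟨s, hs, hs0⟩ := exists_hasDerivAt_eq_zero hgt
          (fun s hs => (hdz s (hab s hs)).continuousAt.continuousWithinAt) (hz0.trans h0.symm)
          (fun s hs => hdz s (hab s (Ioo_subset_Icc_self hs)))
        exact (hball _ (hseg s (hab s (Ioo_subset_Icc_self hs)))).1.1.2.2 hs0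
    · simp only at h0
      rw [h0]
      exact hz0

end FlowBox

/-! ### Closed 2-forms as fields of bilinear forms -/

section Forms

variable {E : Type*} [NormedAddCommGroup E] [NormedSpace ℝ E]
  {F : Type*} [NormedAddCommGroup F] [NormedSpace ℝ F]

/-- A field of bilinear forms is, near `x₀`, a smooth closed differential 2-form. -/
structure IsClosedForm (θ : E → E →L[ℝ] E →L[ℝ] ℝ) (x₀ : E) : Prop where
  smooth : ∀ᶠ x in 𝓝 x₀, ContDiffAt ℝ ∞ θ x
  alt : ∀ᶠ x in 𝓝 x₀, ∀ u v, θ x u v = -θ x v u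
  closed : ∀ᶠ x in 𝓝 x₀, ∀ u v w,
    fderiv ℝ θ x u v w + fderiv ℝ θ x v w u + fderiv ℝ θ x w u v = 0

theorem IsClosedForm.self_eq_zero {θ : E → E →L[ℝ] E →L[ℝ] ℝ} {x₀ : E} (h : IsClosedForm θ x₀) :
    ∀ᶠ x in 𝓝 x₀, ∀ u, θ x u u = 0 := by
  filter_upwards [h.alt] with x hx u
  linarith [hx u u]

theorem IsClosedForm.sub {θ η : E → E →L[ℝ] E →L[ℝ] ℝ} {x₀ : E} (hθ : IsClosedForm θ x₀)
    (hη : IsClosedForm η x₀) : IsClosedForm (fun x => θ x - η x) x₀ where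
  smooth := by filter_upwards [hθ.smooth, hη.smooth] with x h1 h2 using h1.sub h2
  alt := by
    filter_upwards [hθ.alt, hη.alt] with x h1 h2 u v
    simp only [sub_apply, h1 u v, h2 u v]
    ring
  closed := by
    filter_upwards [hθ.smooth, hη.smooth, hθ.closed, hη.closed] with x h1 h2 h3 h4 u v w
    have e : ∀ a b c : E, fderiv ℝ (fun x => θ x - η x) x a b c =
        fderiv ℝ θ x a b c - fderiv ℝ η x a b c := fun _ _ _ => by
      rw [fderiv_fun_sub (h1.differentiableAt (by simp)) (h2.differentiableAt (by simp))]
      rfl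
    rw [e, e, e]
    linear_combination h3 u v w - h4 u v w

/-- The pullback of a field of bilinear forms. -/
def pull (θ : F → F →L[ℝ] F →L[ℝ] ℝ) (f : E → F) (x : E) : E →L[ℝ] E →L[ℝ] ℝ :=
  (θ (f x)).bilinearComp (fderiv ℝ f x) (fderiv ℝ f x)

theorem pull_apply (θ : F → F →L[ℝ] F →L[ℝ] ℝ) (f : E → F) (x u v : E) :
    pull θ f x u v = θ (f x) (fderiv ℝ f x u) (fderiv ℝ f x v) := rfl

/-- In a finite basis the operator is a sum of fixed coordinate forms times its values at the basis
vectors. -/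
theorem contDiffAt_clm {G : Type*} [NormedAddCommGroup G] [NormedSpace ℝ G]
    [FiniteDimensional ℝ E] {L : F → E →L[ℝ] G} {x : F}
    (h : ∀ u, ContDiffAt ℝ ∞ (fun y => L y u) x) : ContDiffAt ℝ ∞ L x := by
  let b := Module.finBasis ℝ E
  have hL : L = fun y => ∑ i, (LinearMap.toContinuousLinearMap (b.coord i)).smulRight
      (L y (b i)) := by
    ext y u
    conv_lhs => rw [← b.sum_repr u]
    simp only [map_sum, map_smul, sum_apply, ContinuousLinearMap.smulRight_apply]
    rfl
  rw [hL]
  exact ContDiffAt.sum fun i _ => contDiffAt_const.smulRight (h (b i))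

theorem contDiffAt_bilinear [FiniteDimensional ℝ E] {θ : F → E →L[ℝ] E →L[ℝ] ℝ} {x : F}
    (h : ∀ u v, ContDiffAt ℝ ∞ (fun y => θ y u v) x) : ContDiffAt ℝ ∞ θ x :=
  contDiffAt_clm fun u => contDiffAt_clm fun v => h u v

theorem two_le_infty : minSmoothness ℝ 2 ≤ (∞ : WithTop ℕ∞) := by
  rw [minSmoothness_of_isRCLikeNormedField]
  exact WithTop.coe_le_coe.2 (le_top : (2 : ℕ∞) ≤ ⊤)

theorem fderiv_bilinear_apply {θ : F → E →L[ℝ] E →L[ℝ] ℝ} {x : F}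
    (h : DifferentiableAt ℝ θ x) (u v : E) (w : F) :
    fderiv ℝ θ x w u v = fderiv ℝ (fun y => θ y u v) x w := by
  have h1 := (h.hasFDerivAt.clm_apply (hasFDerivAt_const u x)).clm_apply (hasFDerivAt_const v x)
  rw [h1.fderiv]
  simp

/-- Besides the pullback of the cyclic identity for `θ`, the derivative produces six terms with
second derivatives of `f`. They cancel in pairs by symmetry of the second derivative and
antisymmetry of `θ`. -/
theorem IsClosedForm.pull [FiniteDimensional ℝ E] {θ : F → F →L[ℝ] F →L[ℝ] ℝ} {f : E → F} {x₀ : E}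
    (hf : ∀ᶠ x in 𝓝 x₀, ContDiffAt ℝ ∞ f x) (hθ : IsClosedForm θ (f x₀)) :
    IsClosedForm (pull θ f) x₀ := by
  have hc := hf.self_of_nhds.continuousAt
  have hsm : ∀ᶠ x in 𝓝 x₀, ContDiffAt ℝ ∞ (PoincareRealization.pull θ f) x := by
    filter_upwards [hf, hc.tendsto.eventually hθ.smooth] with x h1 h2
    refine contDiffAt_bilinear fun u v => ?_
    have h3 : ContDiffAt ℝ ∞ (fderiv ℝ f) x := h1.fderiv_right (by simp)
    exact ((h2.comp x h1).clm_apply (h3.clm_apply contDiffAt_const)).clm_apply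
      (h3.clm_apply contDiffAt_const)
  refine ⟨hsm, ?_, ?_⟩
  · filter_upwards [hc.tendsto.eventually hθ.alt] with x hx u v
    exact hx _ _
  · filter_upwards [hsm, hf, hc.tendsto.eventually (hθ.smooth.and (hθ.alt.and hθ.closed))]
      with x h0 h1 ⟨h2, h3, h4⟩ u v w
    have hd := h0.differentiableAt (by simp)
    have hf' : ContDiffAt ℝ ∞ (fderiv ℝ f) x := h1.fderiv_right (by simp)
    have hfd := (hf'.differentiableAt (by simp)).hasFDerivAt
    have hθd := ((h2.differentiableAt (by simp)).hasFDerivAt.comp x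
      (h1.differentiableAt (by simp)).hasFDerivAt)
    have key : ∀ a b c, fderiv ℝ (PoincareRealization.pull θ f) x a b c =
        fderiv ℝ θ (f x) (fderiv ℝ f x a) (fderiv ℝ f x b) (fderiv ℝ f x c) +
        θ (f x) (fderiv ℝ (fderiv ℝ f) x a b) (fderiv ℝ f x c) +
        θ (f x) (fderiv ℝ f x b) (fderiv ℝ (fderiv ℝ f) x a c) := by
      intro a b c
      rw [fderiv_bilinear_apply hd]
      have h5 := (hθd.clm_apply (hfd.clm_apply (hasFDerivAt_const b x))).clm_apply
        (hfd.clm_apply (hasFDerivAt_const c x))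
      have h6 : (fun y => PoincareRealization.pull θ f y b c) =
        fun y => ((θ ∘ f) y) (fderiv ℝ f y b) (fderiv ℝ f y c) := rfl
      rw [h6, h5.fderiv]
      simp
      ring
    have hsymm : ∀ a b, fderiv ℝ (fderiv ℝ f) x a b = fderiv ℝ (fderiv ℝ f) x b a := fun a b =>
      (h1.isSymmSndFDerivAt two_le_infty).eq a b
    rw [key, key, key]
    have e1 := h3 (fderiv ℝ f x v) (fderiv ℝ (fderiv ℝ f) x u w)
    have e2 := h3 (fderiv ℝ f x w) (fderiv ℝ (fderiv ℝ f) x v u)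
    have e3 := h3 (fderiv ℝ f x u) (fderiv ℝ (fderiv ℝ f) x w v)
    rw [hsymm w u, hsymm u v, hsymm v w]
    have e4 := h4 (fderiv ℝ f x u) (fderiv ℝ f x v) (fderiv ℝ f x w)
    linear_combination e4 + e1 + e2 + e3

/-- The 2-form `dq ∧ dp`. -/
def wedge (q p : E → ℝ) (x : E) : E →L[ℝ] E →L[ℝ] ℝ :=
  (fderiv ℝ q x).smulRight (fderiv ℝ p x) - (fderiv ℝ p x).smulRight (fderiv ℝ q x)

theorem wedge_apply (q p : E → ℝ) (x u v : E) :
    wedge q p x u v = fderiv ℝ q x u * fderiv ℝ p x v - fderiv ℝ p x u * fderiv ℝ q x v := rfl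

/-- `d(dq ∧ dp) = 0` because Hessians are symmetric. -/
theorem isClosedForm_wedge [FiniteDimensional ℝ E] {q p : E → ℝ} {x₀ : E}
    (hq : ∀ᶠ x in 𝓝 x₀, ContDiffAt ℝ ∞ q x) (hp : ∀ᶠ x in 𝓝 x₀, ContDiffAt ℝ ∞ p x) :
    IsClosedForm (wedge q p) x₀ := by
  have hsm : ∀ᶠ x in 𝓝 x₀, ContDiffAt ℝ ∞ (wedge q p) x := by
    filter_upwards [hq, hp] with x h1 h2
    have h1' : ContDiffAt ℝ ∞ (fderiv ℝ q) x := h1.fderiv_right (by simp)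
    have h2' : ContDiffAt ℝ ∞ (fderiv ℝ p) x := h2.fderiv_right (by simp)
    refine contDiffAt_bilinear fun u v => ?_
    exact ((h1'.clm_apply contDiffAt_const).mul (h2'.clm_apply contDiffAt_const)).sub
      ((h2'.clm_apply contDiffAt_const).mul (h1'.clm_apply contDiffAt_const))
  refine ⟨hsm, ?_, ?_⟩
  · filter_upwards with x u v
    simp only [wedge_apply]
    ring
  · filter_upwards [hsm, hq, hp] with x h0 h1 h2 u v w
    have hd := h0.differentiableAt (by simp)
    have h1' : ContDiffAt ℝ ∞ (fderiv ℝ q) x := h1.fderiv_right (by simp)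
    have h2' : ContDiffAt ℝ ∞ (fderiv ℝ p) x := h2.fderiv_right (by simp)
    have d1 := (h1'.differentiableAt (by simp)).hasFDerivAt
    have d2 := (h2'.differentiableAt (by simp)).hasFDerivAt
    have key : ∀ a b c, fderiv ℝ (wedge q p) x a b c =
        fderiv ℝ (fderiv ℝ q) x a b * fderiv ℝ p x c + fderiv ℝ q x b * fderiv ℝ (fderiv ℝ p) x a c -
        (fderiv ℝ (fderiv ℝ p) x a b * fderiv ℝ q x c +
          fderiv ℝ p x b * fderiv ℝ (fderiv ℝ q) x a c) := by
      intro a b c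
      rw [fderiv_bilinear_apply hd]
      have h5 := ((d1.clm_apply (hasFDerivAt_const b x)).mul
          (d2.clm_apply (hasFDerivAt_const c x))).sub
        ((d2.clm_apply (hasFDerivAt_const b x)).mul (d1.clm_apply (hasFDerivAt_const c x)))
      have h6 : (fun y => wedge q p y b c) = fun y => fderiv ℝ q y b * fderiv ℝ p y c -
        fderiv ℝ p y b * fderiv ℝ q y c := rfl
      rw [h6]
      refine (congrArg (fun L : E →L[ℝ] ℝ => L a) h5.fderiv).trans ?_
      simp
      ring
    have s1 : ∀ a b, fderiv ℝ (fderiv ℝ q) x a b = fderiv ℝ (fderiv ℝ q) x b a := fun a b =>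
      (h1.isSymmSndFDerivAt two_le_infty).eq a b
    have s2 : ∀ a b, fderiv ℝ (fderiv ℝ p) x a b = fderiv ℝ (fderiv ℝ p) x b a := fun a b =>
      (h2.isSymmSndFDerivAt two_le_infty).eq a b
    rw [key, key, key, s1 w u, s1 u v, s1 w v, s2 w u, s2 u v, s2 w v]
    ring

end Forms

/-! ### Reduction of closed forms along a vector field -/

section Straightening

variable {E : Type u} [NormedAddCommGroup E] [NormedSpace ℝ E] [FiniteDimensional ℝ E]

/-- Flow box coordinates `(t, π)` for a vector field `X`, with the section `ι` of `π` parametrizing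
the zero set of `f`. Closed forms annihilated by `X` are pullbacks under `π`. -/
theorem exists_straightening {X : E → E} {f : E → ℝ} {x₀ : E}
    (hX : ∀ᶠ y in 𝓝 x₀, ContDiffAt ℝ ∞ X y) (hf : ∀ᶠ y in 𝓝 x₀, ContDiffAt ℝ ∞ f y)
    (hf0 : f x₀ = 0) (hne : fderiv ℝ f x₀ (X x₀) ≠ 0) :
    ∃ (Z : Submodule ℝ E) (t : E → ℝ) (π : E → Z) (ι : Z → E),
      Module.finrank ℝ Z + 1 = Module.finrank ℝ E ∧
      (∀ᶠ y in 𝓝 x₀, ContDiffAt ℝ ∞ t y) ∧ (∀ᶠ y in 𝓝 x₀, ContDiffAt ℝ ∞ π y) ∧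
      (∀ᶠ z in 𝓝 0, ContDiffAt ℝ ∞ ι z) ∧ π x₀ = 0 ∧ ι 0 = x₀ ∧ (∀ᶠ z in 𝓝 0, π (ι z) = z) ∧
      (∀ᶠ y in 𝓝 x₀, fderiv ℝ t y (X y) = 1) ∧ (∀ᶠ y in 𝓝 x₀, fderiv ℝ π y (X y) = 0) ∧
      (∀ᶠ y in 𝓝 x₀, f y = 0 ↔ t y = 0) ∧
      (∀ u, fderiv ℝ π x₀ u = 0 → u = fderiv ℝ t x₀ u • X x₀) ∧
      ∀ η : E → E →L[ℝ] E →L[ℝ] ℝ, IsClosedForm η x₀ →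
        (∀ᶠ y in 𝓝 x₀, ∀ v, η y (X y) v = 0) →
        ∀ᶠ y in 𝓝 x₀, ∀ u v,
          η y u v = pull η ι (π y) (fderiv ℝ π y u) (fderiv ℝ π y v) := by
  have hn : (∞ : WithTop ℕ∞) ≠ 0 := by simp
  obtain ⟨Z, Φ, hfr, hs, hΦ0, hΦ, hΨ, hder, hzero⟩ := exists_flowBox hX hf hf0 hne
  have hxt : x₀ ∈ Φ.target := hΦ0 ▸ Φ.map_source hs
  have hT : ∀ᶠ y in 𝓝 x₀, y ∈ Φ.target := Φ.open_target.mem_nhds hxt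
  have hS : ∀ᶠ p in 𝓝 ((0 : ℝ), (0 : Z)), p ∈ Φ.source := Φ.open_source.mem_nhds hs
  have hΦc : ∀ p ∈ Φ.source, ContDiffAt ℝ ∞ Φ p := fun p hp =>
    hΦ.contDiffAt (Φ.open_source.mem_nhds hp)
  have hΨc : ∀ y ∈ Φ.target, ContDiffAt ℝ ∞ Φ.symm y := fun p hp =>
    hΨ.contDiffAt (Φ.open_target.mem_nhds hp)
  have hΨ0 : Φ.symm x₀ = (0, 0) := by rw [← hΦ0, Φ.left_inv hs]
  have hinj : Tendsto (fun z : Z => ((0 : ℝ), z)) (𝓝 0) (𝓝 (0, 0)) :=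
    (Continuous.prodMk_right (0 : ℝ)).continuousAt.tendsto
  have hΦX : ∀ p ∈ Φ.source, fderiv ℝ Φ p (1, 0) = X (Φ p) := by
    intro p hp
    have h1 := ((hΦc p hp).differentiableAt hn).hasFDerivAt
    have h2 : HasDerivAt (fun s => Φ (s, p.2)) (fderiv ℝ Φ p (1, 0)) p.1 :=
      HasFDerivAt.comp_hasDerivAt (f := fun s : ℝ => (s, p.2)) p.1 h1
        ((hasDerivAt_id p.1).prodMk (hasDerivAt_const p.1 p.2))
    exact h2.unique (hder p hp)
  have hcomp1 : ∀ p ∈ Φ.source, ∀ w, fderiv ℝ Φ.symm (Φ p) (fderiv ℝ Φ p w) = w := by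
    intro p hp w
    have h1 := ((hΦc p hp).differentiableAt hn).hasFDerivAt
    have h2 := ((hΨc _ (Φ.map_source hp)).differentiableAt hn).hasFDerivAt
    have h3 : HasFDerivAt (Φ.symm ∘ Φ) (ContinuousLinearMap.id ℝ _) p :=
      (hasFDerivAt_id p).congr_of_eventuallyEq (Φ.eventually_left_inverse hp)
    exact DFunLike.congr_fun ((h2.comp p h1).unique h3) w
  have hcomp2 : ∀ y ∈ Φ.target, ∀ w, fderiv ℝ Φ (Φ.symm y) (fderiv ℝ Φ.symm y w) = w := by
    intro p hp w
    have h1 := ((hΨc p hp).differentiableAt hn).hasFDerivAt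
    have h2 := ((hΦc _ (Φ.map_target hp)).differentiableAt hn).hasFDerivAt
    have h3 : HasFDerivAt (Φ ∘ Φ.symm) (ContinuousLinearMap.id ℝ _) p :=
      (hasFDerivAt_id p).congr_of_eventuallyEq (Φ.eventually_right_inverse hp)
    exact DFunLike.congr_fun ((h2.comp p h1).unique h3) w
  have hΨX : ∀ y ∈ Φ.target, fderiv ℝ Φ.symm y (X y) = (1, 0) := by
    intro y hy
    have h1 := hΦX _ (Φ.map_target hy)
    have h2 := hcomp1 _ (Φ.map_target hy) (1, 0)
    rwa [h1, Φ.right_inv hy] at h2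
  let t : E → ℝ := fun y => (Φ.symm y).1
  let π : E → Z := fun y => (Φ.symm y).2
  let ι : Z → E := fun z => Φ (0, z)
  have htd : ∀ y ∈ Φ.target, ∀ u, fderiv ℝ t y u = (fderiv ℝ Φ.symm y u).1 := by
    intro y hy u
    rw [(((hΨc y hy).differentiableAt hn).hasFDerivAt.fst).fderiv]
    rfl
  have hπd : ∀ y ∈ Φ.target, ∀ u, fderiv ℝ π y u = (fderiv ℝ Φ.symm y u).2 := by
    intro y hy u
    rw [(((hΨc y hy).differentiableAt hn).hasFDerivAt.snd).fderiv]
    rfl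
  have hιd : ∀ z, ((0 : ℝ), z) ∈ Φ.source → ∀ a, fderiv ℝ ι z a = fderiv ℝ Φ (0, z) (0, a) := by
    intro z hz a
    have h1 := ((hΦc _ hz).differentiableAt hn).hasFDerivAt
    have h2 : HasFDerivAt ι ((fderiv ℝ Φ (0, z)).comp (ContinuousLinearMap.inr ℝ ℝ Z)) z :=
      HasFDerivAt.comp (f := fun z : Z => ((0 : ℝ), z)) z h1 (hasFDerivAt_prodMk_right _ _)
    rw [h2.fderiv]
    rfl
  refine ⟨Z, t, π, ι, hfr, ?_, ?_, ?_, by simp [π, hΨ0], hΦ0, ?_, ?_, ?_, ?_, ?_, ?_⟩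
  · filter_upwards [hT] with y hy using (hΨc y hy).fst
  · filter_upwards [hT] with y hy using (hΨc y hy).snd
  · filter_upwards [hinj.eventually hS] with z hz
    exact (hΦc _ hz).comp z (contDiffAt_const.prodMk contDiffAt_id)
  · filter_upwards [hinj.eventually hS] with z hz
    simp [π, ι, Φ.left_inv hz]
  · filter_upwards [hT] with y hy
    rw [htd y hy, hΨX y hy]
  · filter_upwards [hT] with y hy
    rw [hπd y hy, hΨX y hy]
  · filter_upwards [hT] with y hy
    have := hzero _ (Φ.map_target hy)
    rwa [Φ.right_inv hy] at this
  · intro u hu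
    rw [hπd _ hxt] at hu
    rw [htd _ hxt]
    have h1 : fderiv ℝ Φ.symm x₀ u = (fderiv ℝ Φ.symm x₀ u).1 • fderiv ℝ Φ.symm x₀ (X x₀) := by
      rw [hΨX _ hxt]
      refine Prod.ext ?_ ?_
      · simp
      · simp [hu]
    have h2 := hcomp2 _ hxt u
    rw [h1, map_smul, hcomp2 _ hxt] at h2
    exact h2.symm
  · intro η hη hηX
    have hΦt : Tendsto Φ (𝓝 (0, 0)) (𝓝 x₀) := by
      have := (hΦc _ hs).continuousAt.tendsto
      rwa [hΦ0] at this
    have hcl : IsClosedForm (pull η Φ) ((0 : ℝ), (0 : Z)) :=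
      IsClosedForm.pull (by filter_upwards [hS] with p hp using hΦc p hp) (by rwa [hΦ0])
    have hk : ∀ᶠ p in 𝓝 ((0 : ℝ), (0 : Z)), ∀ v, pull η Φ p (1, 0) v = 0 := by
      filter_upwards [hS, hΦt.eventually hηX] with p h1 h2 v
      rw [pull_apply, hΦX p h1]
      exact h2 _
    -- Cartan's formula by hand: in the cyclic identity for `∂/∂t, u, v`, two of the terms
    -- differentiate the vanishing contraction with `∂/∂t`, so the `t`-derivative of the form is
    -- zero as well.
    have hk' : ∀ᶠ p in 𝓝 ((0 : ℝ), (0 : Z)), ∀ u v, fderiv ℝ (pull η Φ) p (1, 0) u v = 0 := by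
      filter_upwards [eventually_eventually_nhds.2 hk, eventually_eventually_nhds.2 hcl.alt,
        hcl.closed, hcl.smooth] with p h1 h2 h3 h4 u v
      have hd := h4.differentiableAt hn
      have e1 : fderiv ℝ (pull η Φ) p v (1, 0) u = 0 := by
        rw [fderiv_bilinear_apply hd]
        have : (fun y => pull η Φ y (1, 0) u) =ᶠ[𝓝 p] fun _ => 0 := by
          filter_upwards [h1] with y hy using hy u
        rw [this.fderiv_eq]
        simp
      have e2 : fderiv ℝ (pull η Φ) p u v (1, 0) = 0 := by
        rw [fderiv_bilinear_apply hd]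
        have : (fun y => pull η Φ y v (1, 0)) =ᶠ[𝓝 p] fun _ => 0 := by
          filter_upwards [h1, h2] with y hy hy2
          rw [hy2, hy v, neg_zero]
        rw [this.fderiv_eq]
        simp
      have e3 := h3 (1, 0) u v
      linarith
    obtain ⟨r, hr, hball⟩ := Metric.eventually_nhds_iff_ball.1
      ((hk.and hk').and ((hcl.smooth.and hcl.alt).and hS))
    have hconst : ∀ p ∈ Metric.ball ((0 : ℝ), (0 : Z)) r, ∀ u v,
        pull η Φ p u v = pull η Φ (0, p.2) u v := by
      rintro ⟨s, z⟩ hp u v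
      have hz : ∀ s' ∈ Metric.ball (0 : ℝ) r, (s', z) ∈ Metric.ball ((0 : ℝ), (0 : Z)) r := by
        intro s' hs'
        rw [Metric.mem_ball, Prod.dist_eq, max_lt_iff] at hp ⊢
        exact ⟨hs', hp.2⟩
      have hs0 : s ∈ Metric.ball (0 : ℝ) r := by
        rw [Metric.mem_ball, Prod.dist_eq, max_lt_iff] at hp
        exact hp.1
      have hd : ∀ s' ∈ Metric.ball (0 : ℝ) r,
          HasDerivAt (fun s' => pull η Φ (s', z) u v) 0 s' := by
        intro s' hs'
        have hb := hball _ (hz s' hs')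
        have hd := hb.2.1.1.differentiableAt hn
        have h1 : DifferentiableAt ℝ (fun y => pull η Φ y u v) (s', z) :=
          (hd.clm_apply (differentiableAt_const u)).clm_apply (differentiableAt_const v)
        have h2 := HasFDerivAt.comp_hasDerivAt (f := fun s : ℝ => (s, z)) s' h1.hasFDerivAt
          ((hasDerivAt_id s').prodMk (hasDerivAt_const s' z))
        rw [← fderiv_bilinear_apply hd, hb.1.2 u v] at h2
        exact h2
      exact (convex_ball (0 : ℝ) r).is_const_of_fderivWithin_eq_zero (𝕜 := ℝ)
        (f := fun s' => pull η Φ (s', z) u v)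
        (fun s' hs' => (hd s' hs').differentiableAt.differentiableWithinAt)
        (fun s' hs' => by
          have := (hd s' hs').hasFDerivAt.hasFDerivWithinAt (s := Metric.ball (0 : ℝ) r)
          rw [this.fderivWithin (Metric.isOpen_ball.uniqueDiffWithinAt hs')]
          ext
          simp) hs0 (Metric.mem_ball_self hr)
    have hΨt : Tendsto Φ.symm (𝓝 x₀) (𝓝 (0, 0)) := by
      have := (hΨc _ hxt).continuousAt.tendsto
      rwa [hΨ0] at this
    filter_upwards [hT, hΨt.eventually (Metric.ball_mem_nhds _ hr)] with y hy hyb u v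
    have hb0 : ((0 : ℝ), π y) ∈ Metric.ball ((0 : ℝ), (0 : Z)) r := by
      have hyb' : dist (Φ.symm y) (0, 0) < r := hyb
      rw [Metric.mem_ball, Prod.dist_eq, max_lt_iff] at *
      exact ⟨by simpa using hr, hyb'.2⟩
    have hb := hball _ hb0
    have h1 : η y u v = pull η Φ (Φ.symm y) (fderiv ℝ Φ.symm y u) (fderiv ℝ Φ.symm y v) := by
      rw [pull_apply, hcomp2 y hy, hcomp2 y hy, Φ.right_inv hy]
    -- The form does not depend on `t` and does not see the `t`-components of its arguments; what is
    -- left is the restriction to `t = 0`, that is, the pullback under `ι`.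
    have hsplit : ∀ w : ℝ × Z, w = w.1 • ((1 : ℝ), (0 : Z)) + (0, w.2) := fun w => by simp
    have hz1 : ∀ w : ℝ × Z, pull η Φ (0, π y) w (1, 0) = 0 := fun w => by
      rw [hb.2.1.2, hb.1.1, neg_zero]
    rw [h1, hconst _ hyb, pull_apply _ ι, hιd _ hb.2.2, hιd _ hb.2.2, hπd y hy, hπd y hy]
    change pull η Φ (0, π y) _ _ = pull η Φ (0, π y) _ _
    conv_lhs => rw [hsplit (fderiv ℝ Φ.symm y u), hsplit (fderiv ℝ Φ.symm y v)]
    simp only [map_add, map_smul, add_apply, smul_apply,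
      hb.1.1, hz1, smul_zero, zero_add, add_zero]

end Straightening

/-! ### Darboux coordinates with a prescribed first pair -/

section Darboux

variable {E : Type u} [NormedAddCommGroup E] [NormedSpace ℝ E] [FiniteDimensional ℝ E]

/-- A smooth field of nondegenerate bilinear forms identifies smooth 1-forms with smooth vector
fields. -/
theorem exists_dual_field {θ : E → E →L[ℝ] E →L[ℝ] ℝ} {α : E → E →L[ℝ] ℝ} {x₀ : E}
    (hθ : ∀ᶠ x in 𝓝 x₀, ContDiffAt ℝ ∞ θ x) (hα : ∀ᶠ x in 𝓝 x₀, ContDiffAt ℝ ∞ α x)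
    (hnd : ∀ u, θ x₀ u = 0 → u = 0) :
    ∃ X : E → E, (∀ᶠ x in 𝓝 x₀, ContDiffAt ℝ ∞ X x) ∧ ∀ᶠ x in 𝓝 x₀, θ x (X x) = α x := by
  have : CompleteSpace E := FiniteDimensional.complete ℝ E
  have hfr : Module.finrank ℝ E = Module.finrank ℝ (E →L[ℝ] ℝ) := by
    rw [← (LinearMap.toContinuousLinearMap (𝕜 := ℝ) (E := E) (F' := ℝ)).finrank_eq]
    exact Subspace.dual_finrank_eq.symm
  let e₀ : E ≃L[ℝ] (E →L[ℝ] ℝ) := (LinearEquiv.ofInjectiveOfFinrankEq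
    (θ x₀ : E →ₗ[ℝ] (E →L[ℝ] ℝ))
    ((injective_iff_map_eq_zero _).2 hnd) hfr).toContinuousLinearEquiv
  have he₀ : (e₀ : E →L[ℝ] (E →L[ℝ] ℝ)) = θ x₀ := by
    ext u v
    rfl
  have hinv : ∀ᶠ x in 𝓝 x₀, θ x ∈ range ((↑) : (E ≃L[ℝ] (E →L[ℝ] ℝ)) → E →L[ℝ] (E →L[ℝ] ℝ)) :=
    hθ.self_of_nhds.continuousAt.eventually_mem (by rw [← he₀]; exact e₀.nhds)
  refine ⟨fun x => (θ x).inverse (α x), ?_, ?_⟩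
  · filter_upwards [hθ, hα, hinv] with x h1 h2 ⟨e, he⟩
    have h3 : ContDiffAt ℝ ∞ ContinuousLinearMap.inverse (θ x) := by
      rw [← he]
      exact contDiffAt_map_inverse e
    exact (h3.comp x h1).clm_apply h2
  · filter_upwards [hinv] with x ⟨e, he⟩
    rw [← he, ContinuousLinearMap.inverse_equiv]
    exact e.apply_symm_apply _

/-- Local canonical coordinates for a symplectic form. -/
def HasDarboux (m : ℕ) (θ : E → E →L[ℝ] E →L[ℝ] ℝ) (x₀ : E) (q p : Fin m → E → ℝ) : Prop :=
  (∀ i, ∀ᶠ x in 𝓝 x₀, ContDiffAt ℝ ∞ (q i) x) ∧ (∀ i, ∀ᶠ x in 𝓝 x₀, ContDiffAt ℝ ∞ (p i) x) ∧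
    ∀ᶠ x in 𝓝 x₀, ∀ u v, θ x u v = ∑ i, wedge (q i) (p i) x u v

/-- Let `X` be the Hamiltonian field of `H` and `t` the time its flow takes from `{f = 0}`, so that
`dt(X) = 1`. The closed form `η = θ - dt ∧ dH` is annihilated by `X` and by the Hamiltonian field
`Y` of `t`. Dividing out first `X` and then `Y`, it descends to a nondegenerate closed form in
dimension `2m`, to which the induction hypothesis applies. The pair `(t, H - H x₀)` completes the
coordinates; keeping control of it is what makes the later charts see both the energy and the
section. -/
theorem darboux_step {m : ℕ}
    (ih : ∀ {Z : Type u} [NormedAddCommGroup Z] [NormedSpace ℝ Z] [FiniteDimensional ℝ Z],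
      Module.finrank ℝ Z = 2 * m → ∀ (θ : Z → Z →L[ℝ] Z →L[ℝ] ℝ) (z₀ : Z), IsClosedForm θ z₀ →
      (∀ u, θ z₀ u = 0 → u = 0) → ∃ q p, HasDarboux m θ z₀ q p)
    (hd : Module.finrank ℝ E = 2 * (m + 1)) {θ : E → E →L[ℝ] E →L[ℝ] ℝ} {x₀ : E}
    (hθ : IsClosedForm θ x₀) (hnd : ∀ u, θ x₀ u = 0 → u = 0) {H f : E → ℝ}
    (hH : ∀ᶠ x in 𝓝 x₀, ContDiffAt ℝ ∞ H x) (hf : ∀ᶠ x in 𝓝 x₀, ContDiffAt ℝ ∞ f x)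
    (hf0 : f x₀ = 0) (hHf : ∃ Y, θ x₀ Y = fderiv ℝ H x₀ ∧ fderiv ℝ f x₀ Y ≠ 0) :
    ∃ q p, HasDarboux (m + 1) θ x₀ q p ∧ (∀ x, p 0 x = H x - H x₀) ∧
      ∀ᶠ x in 𝓝 x₀, f x = 0 ↔ q 0 x = 0 := by
  have hn : (∞ : WithTop ℕ∞) ≠ 0 := by simp
  have hdH : ∀ᶠ x in 𝓝 x₀, ContDiffAt ℝ ∞ (fderiv ℝ H) x := by
    filter_upwards [hH] with x hx using hx.fderiv_right (by simp)
  obtain ⟨X, hX, hXH⟩ := exists_dual_field hθ.smooth hdH hnd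
  have hne : fderiv ℝ f x₀ (X x₀) ≠ 0 := by
    obtain ⟨Y, hY, hY'⟩ := hHf
    have : X x₀ - Y = 0 := hnd _ (by rw [map_sub, hXH.self_of_nhds, hY, sub_self])
    rwa [sub_eq_zero.1 this]
  obtain ⟨Z, t, π, ι, hZ, ht, hπ, hι, hπ0, hι0, hπι, htX, hπX, hft, hker, hred⟩ :=
    exists_straightening hX hf hf0 hne
  let η : E → E →L[ℝ] E →L[ℝ] ℝ := fun x => θ x - wedge t H x
  have hη : IsClosedForm η x₀ := hθ.sub (isClosedForm_wedge ht hH)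
  have hηval : ∀ x u v, η x u v = θ x u v -
    (fderiv ℝ t x u * fderiv ℝ H x v - fderiv ℝ H x u * fderiv ℝ t x v) := fun x u v => rfl
  have hHX : ∀ᶠ x in 𝓝 x₀, fderiv ℝ H x (X x) = 0 := by
    filter_upwards [hXH, hθ.self_eq_zero] with x h1 h2
    rw [← h1]
    exact h2 _
  have hηX : ∀ᶠ x in 𝓝 x₀, ∀ v, η x (X x) v = 0 := by
    filter_upwards [hXH, hHX, htX] with x h1 h2 h3 v
    rw [hηval, h1, h2, h3]
    ring
  have hred1 := hred η hη hηX
  have hdt : ∀ᶠ x in 𝓝 x₀, ContDiffAt ℝ ∞ (fderiv ℝ t) x := by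
    filter_upwards [ht] with x hx using hx.fderiv_right (by simp)
  obtain ⟨Y, hY, hYt⟩ := exists_dual_field hθ.smooth hdt hnd
  have htY : ∀ᶠ x in 𝓝 x₀, fderiv ℝ t x (Y x) = 0 := by
    filter_upwards [hYt, hθ.self_eq_zero] with x h1 h2
    rw [← h1]
    exact h2 _
  have hHY : ∀ᶠ x in 𝓝 x₀, fderiv ℝ H x (Y x) = -1 := by
    filter_upwards [hYt, hXH, hθ.alt, htX] with x h1 h2 h3 h4
    rw [← h2, h3, h1, h4]
  have hηY : ∀ᶠ x in 𝓝 x₀, ∀ v, η x (Y x) v = 0 := by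
    filter_upwards [hYt, htY, hHY] with x h1 h2 h3 v
    rw [hηval, h1, h2, h3]
    ring
  have hιt : Tendsto ι (𝓝 0) (𝓝 x₀) := by
    have := hι.self_of_nhds.continuousAt.tendsto
    rwa [hι0] at this
  have hdπ : ∀ᶠ x in 𝓝 x₀, ContDiffAt ℝ ∞ (fderiv ℝ π) x := by
    filter_upwards [hπ] with x hx using hx.fderiv_right (by simp)
  have hη' : IsClosedForm (pull η ι) 0 := IsClosedForm.pull hι (by rwa [hι0])
  -- The field `Y` need not descend to the quotient `Z`; its projection along the image of `ι` is
  -- enough, since it lies in the kernel of the reduced form.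
  let X' : Z → Z := fun z => fderiv ℝ π (ι z) (Y (ι z))
  have hX' : ∀ᶠ z in 𝓝 0, ContDiffAt ℝ ∞ X' z := by
    filter_upwards [hι, hιt.eventually hdπ, hιt.eventually hY] with z h1 h2 h3
    exact (h2.comp z h1).clm_apply (h3.comp z h1)
  have hπι' : ∀ᶠ z in 𝓝 (0 : Z), ∀ a, fderiv ℝ π (ι z) (fderiv ℝ ι z a) = a := by
    filter_upwards [eventually_eventually_nhds.2 hπι, hι, hιt.eventually hπ] with z h1 h2 h3 a
    have h4 := (h3.differentiableAt hn).hasFDerivAt.comp z (h2.differentiableAt hn).hasFDerivAt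
    have h5 : HasFDerivAt (π ∘ ι) (ContinuousLinearMap.id ℝ Z) z :=
      (hasFDerivAt_id z).congr_of_eventuallyEq h1
    exact DFunLike.congr_fun (h4.unique h5) a
  have hηX' : ∀ᶠ z in 𝓝 (0 : Z), ∀ v, pull η ι z (X' z) v = 0 := by
    filter_upwards [hπι, hπι', hιt.eventually hred1, hιt.eventually hηY] with z h1 h2 h3 h4 v
    have h5 := h3 (Y (ι z)) (fderiv ℝ ι z v)
    rw [h4, h1, h2] at h5
    exact h5.symm
  have hX'0 : X' 0 ≠ 0 := by
    intro h0
    have h1 : fderiv ℝ π x₀ (Y x₀) = 0 := by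
      have : X' 0 = fderiv ℝ π x₀ (Y x₀) := by simp only [X', hι0]
      rw [← this, h0]
    have h2 := hker _ h1
    have h3 := hHY.self_of_nhds
    rw [h2, map_smul, hHX.self_of_nhds] at h3
    simp at h3
  -- For the second quotient no particular hypersurface is prescribed; any linear functional that
  -- does not vanish on `X' 0` will do.
  obtain ⟨l, hl⟩ : ∃ l : Z →L[ℝ] ℝ, l (X' 0) ≠ 0 := by
    obtain ⟨l, -, hl⟩ := exists_dual_vector ℝ (X' 0) (norm_ne_zero_iff.2 hX'0)
    exact ⟨l, by rw [hl]; simpa using hX'0⟩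
  obtain ⟨Z₂, t₂, π₂, ι₂, hZ₂, ht₂, hπ₂, hι₂, hπ₂0, hι₂0, hπι₂, htX₂, hπX₂, -, -, hred₂⟩ :=
    exists_straightening (f := l) hX' (Eventually.of_forall fun z => l.contDiff.contDiffAt)
      (map_zero l) (by rwa [l.fderiv])
  have hred2 := hred₂ _ hη' hηX'
  have hη'' : IsClosedForm (pull (pull η ι) ι₂) 0 := IsClosedForm.pull hι₂ (by rwa [hι₂0])
  have hπt : Tendsto π (𝓝 x₀) (𝓝 0) := by
    have := hπ.self_of_nhds.continuousAt.tendsto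
    rwa [hπ0] at this
  have hπ₂t : Tendsto π₂ (𝓝 0) (𝓝 0) := by
    have := hπ₂.self_of_nhds.continuousAt.tendsto
    rwa [hπ₂0] at this
  have hcomb : ∀ᶠ x in 𝓝 x₀, ∀ u v, η x u v = pull (pull η ι) ι₂ (π₂ (π x))
      (fderiv ℝ π₂ (π x) (fderiv ℝ π x u)) (fderiv ℝ π₂ (π x) (fderiv ℝ π x v)) := by
    filter_upwards [hred1, hπt.eventually hred2] with x h1 h2 u v
    rw [h1, h2]
  have hnd2 : ∀ a, pull (pull η ι) ι₂ 0 a = 0 → a = 0 := by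
    intro a ha
    have hπι₂0 : fderiv ℝ π₂ 0 (fderiv ℝ ι₂ 0 a) = a := by
      have h2 := (hπ₂.self_of_nhds.differentiableAt hn).hasFDerivAt
      have h3 := (hι₂.self_of_nhds.differentiableAt hn).hasFDerivAt
      rw [← hι₂0] at h2
      have h4 := h2.comp (0 : Z₂) h3
      rw [hι₂0] at h4
      have h5 : HasFDerivAt (π₂ ∘ ι₂) (ContinuousLinearMap.id ℝ Z₂) 0 :=
        (hasFDerivAt_id (0 : Z₂)).congr_of_eventuallyEq hπι₂
      exact DFunLike.congr_fun (h4.unique h5) a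
    have hb := hπι'.self_of_nhds (fderiv ℝ ι₂ 0 a)
    rw [hι0] at hb
    set u := fderiv ℝ ι 0 (fderiv ℝ ι₂ 0 a) with hu
    have h1 : ∀ v, η x₀ u v = 0 := by
      intro v
      rw [hcomb.self_of_nhds, hπ0, hπ₂0, hb, hπι₂0, ha]
      rfl
    -- By nondegeneracy of `θ`, a vector in the kernel of `η` is a combination of `X x₀` and `Y x₀`.
    -- Both project to zero in `Z₂`.
    have h2 : u - (fderiv ℝ t x₀ u • X x₀ - fderiv ℝ H x₀ u • Y x₀) = 0 := by
      refine hnd _ (ContinuousLinearMap.ext fun v => ?_)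
      have h3 := h1 v
      rw [hηval] at h3
      rw [map_sub, map_sub, map_smul, map_smul, hXH.self_of_nhds, hYt.self_of_nhds]
      change θ x₀ u v - (fderiv ℝ t x₀ u * fderiv ℝ H x₀ v - fderiv ℝ H x₀ u * fderiv ℝ t x₀ v) = 0
      exact h3
    have h3 : fderiv ℝ π x₀ u = -(fderiv ℝ H x₀ u • X' 0) := by
      have h4 : X' 0 = fderiv ℝ π x₀ (Y x₀) := by simp only [X', hι0]
      conv_lhs => rw [sub_eq_zero.1 h2]
      rw [map_sub, map_smul, map_smul, hπX.self_of_nhds, h4, smul_zero, zero_sub]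
    rw [hb] at h3
    rw [← hπι₂0, h3, map_neg, map_smul, hπX₂.self_of_nhds, smul_zero, neg_zero]
  obtain ⟨q', p', hq', hp', hqp'⟩ := ih (by omega) _ 0 hη'' hnd2
  have hcpt : Tendsto (fun x => π₂ (π x)) (𝓝 x₀) (𝓝 0) := hπ₂t.comp hπt
  have hcp : ∀ᶠ x in 𝓝 x₀, ContDiffAt ℝ ∞ (fun x => π₂ (π x)) x := by
    filter_upwards [hπ, hπt.eventually hπ₂] with x h1 h2 using h2.comp x h1
  have hcpd : ∀ᶠ x in 𝓝 x₀, ∀ g : Z₂ → ℝ, ContDiffAt ℝ ∞ g (π₂ (π x)) →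
      ∀ u, fderiv ℝ (fun x => g (π₂ (π x))) x u =
        fderiv ℝ g (π₂ (π x)) (fderiv ℝ π₂ (π x) (fderiv ℝ π x u)) := by
    filter_upwards [hπ, hπt.eventually hπ₂] with x h1 h2 g hg u
    have h3 := (hg.differentiableAt hn).hasFDerivAt.comp x
      ((h2.differentiableAt hn).hasFDerivAt.comp x (h1.differentiableAt hn).hasFDerivAt)
    exact DFunLike.congr_fun h3.fderiv u
  let q : Fin (m + 1) → E → ℝ := Fin.cons (α := fun _ => E → ℝ) t (fun i x => q' i (π₂ (π x)))
  let p : Fin (m + 1) → E → ℝ :=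
    Fin.cons (α := fun _ => E → ℝ) (fun x => H x - H x₀) (fun i x => p' i (π₂ (π x)))
  have hq0 : q 0 = t := rfl
  have hp0 : p 0 = fun x => H x - H x₀ := rfl
  have hqs : ∀ i : Fin m, q i.succ = fun x => q' i (π₂ (π x)) := fun _ => rfl
  have hps : ∀ i : Fin m, p i.succ = fun x => p' i (π₂ (π x)) := fun _ => rfl
  refine ⟨q, p, ⟨?_, ?_, ?_⟩, fun x => rfl, hft⟩
  · intro i
    induction i using Fin.cases with
    | zero => exact ht
    | succ i =>
      filter_upwards [hcp, hcpt.eventually (hq' i)] with x h1 h2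
      rw [hqs]
      exact ContDiffAt.comp x h2 h1
  · intro i
    induction i using Fin.cases with
    | zero => filter_upwards [hH] with x hx using hx.sub contDiffAt_const
    | succ i =>
      filter_upwards [hcp, hcpt.eventually (hp' i)] with x h1 h2
      rw [hps]
      exact ContDiffAt.comp x h2 h1
  · have hq'' := hcpt.eventually (eventually_all.2 hq')
    have hp'' := hcpt.eventually (eventually_all.2 hp')
    filter_upwards [hcomb, hcpt.eventually hqp', hcpd, hq'', hp''] with x h1 h2 h3 h4 h5 u v
    rw [Fin.sum_univ_succ]
    have e0 : wedge (t : E → ℝ) (fun x => H x - H x₀) x u v = wedge t H x u v := by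
      rw [wedge_apply, wedge_apply, fderiv_sub_const]
    have e1 : θ x u v = wedge t H x u v + η x u v := by
      rw [hηval, wedge_apply]
      ring
    simp only [hq0, hp0, hqs, hps]
    rw [e0, e1, h1, h2]
    congr 1
    refine Finset.sum_congr rfl fun i _ => ?_
    rw [wedge_apply, wedge_apply, h3 _ (h4 i), h3 _ (h5 i), h3 _ (h4 i), h3 _ (h5 i)]

/-- For the bare Darboux theorem the first pair is free: the linear function `θ x₀ Y` has
Hamiltonian vector `Y` at `x₀`, and a norming functional of `Y` provides the transverse
hypersurface. -/
theorem darboux (m : ℕ) :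
    ∀ {E : Type u} [NormedAddCommGroup E] [NormedSpace ℝ E] [FiniteDimensional ℝ E],
      Module.finrank ℝ E = 2 * m → ∀ (θ : E → E →L[ℝ] E →L[ℝ] ℝ) (x₀ : E), IsClosedForm θ x₀ →
      (∀ u, θ x₀ u = 0 → u = 0) → ∃ q p, HasDarboux m θ x₀ q p := by
  induction m with
  | zero =>
    intro E _ _ _ hd θ x₀ _ _
    have : Subsingleton E := Module.finrank_zero_iff.1 hd
    refine ⟨fun _ _ => 0, fun _ _ => 0, fun i => i.elim0, fun i => i.elim0,
      Eventually.of_forall fun x u v => ?_⟩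
    rw [Subsingleton.elim u 0]
    simp
  | succ m ih =>
    intro E _ _ _ hd θ x₀ hθ hnd
    have : Nontrivial E := Module.nontrivial_of_finrank_pos (R := ℝ) (by omega)
    obtain ⟨Y, hY⟩ := exists_ne (0 : E)
    obtain ⟨l, -, hl⟩ := exists_dual_vector ℝ Y (norm_ne_zero_iff.2 hY)
    obtain ⟨q, p, hqp, -, -⟩ := darboux_step ih hd hθ hnd (H := θ x₀ Y) (f := fun x => l (x - x₀))
      (Eventually.of_forall fun x => (θ x₀ Y).contDiff.contDiffAt)
      (Eventually.of_forall fun x => l.contDiff.contDiffAt.comp x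
        (contDiffAt_id.sub contDiffAt_const)) (by simp)
      ⟨Y, (θ x₀ Y).fderiv.symm, by
        have h := l.hasFDerivAt.comp x₀ ((hasFDerivAt_id x₀).sub_const x₀)
        have h' : fderiv ℝ (fun x => l (x - x₀)) x₀ Y = l Y := by
          refine (congrArg (fun L : E →L[ℝ] ℝ => L Y) h.fderiv).trans ?_
          simp
        rw [h', hl]
        simpa using hY⟩
    exact ⟨q, p, hqp⟩

end Darboux

/-! ### Families of maps that are small in all derivatives -/

section SmallFamilies

variable {ι : Type*} {𝓕 : Filter ι}
  {E : Type*} [NormedAddCommGroup E] [NormedSpace ℝ E]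
  {F : Type*} [NormedAddCommGroup F] [NormedSpace ℝ F]
  {G : Type*} [NormedAddCommGroup G] [NormedSpace ℝ G]

/-- A family of smooth maps tending to zero, with all derivatives, uniformly along `𝓕`. -/
structure SmallFam (𝓕 : Filter ι) (v : ι → E → F) : Prop where
  smooth : ∀ᶠ i in 𝓕, ContDiff ℝ ∞ (v i)
  small : ∀ j : ℕ, ∀ ε > (0 : ℝ), ∀ᶠ i in 𝓕, ∀ x, ‖iteratedFDeriv ℝ j (v i) x‖ ≤ ε

/-- A family of smooth maps whose derivatives of positive order are uniformly bounded along `𝓕`. -/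
structure BddDer (𝓕 : Filter ι) (v : ι → E → F) : Prop where
  smooth : ∀ᶠ i in 𝓕, ContDiff ℝ ∞ (v i)
  bdd : ∀ j : ℕ, 1 ≤ j → ∃ C : ℝ, ∀ᶠ i in 𝓕, ∀ x, ‖iteratedFDeriv ℝ j (v i) x‖ ≤ C

/-- Finitely many bounds are merged by taking maxima. The normalization `1 ≤ C` lets the constant be
raised to powers without becoming smaller. -/
theorem exists_uniform_bound {p : ℕ → ℝ → ι → Prop}
    (mono : ∀ k C C' i, C ≤ C' → p k C i → p k C' i) (n : ℕ)
    (h : ∀ k ≤ n, ∃ C, ∀ᶠ i in 𝓕, p k C i) :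
    ∃ C, 1 ≤ C ∧ ∀ᶠ i in 𝓕, ∀ k ≤ n, p k C i := by
  induction n with
  | zero =>
    obtain ⟨C, hC⟩ := h 0 le_rfl
    refine ⟨max 1 C, le_max_left _ _, hC.mono fun i hi k hk => ?_⟩
    obtain rfl : k = 0 := by omega
    exact mono _ _ _ _ (le_max_right _ _) hi
  | succ n ih =>
    obtain ⟨C, hC1, hC⟩ := ih fun k hk => h k (by omega)
    obtain ⟨C', hC'⟩ := h (n + 1) le_rfl
    refine ⟨max C C', hC1.trans (le_max_left _ _), ?_⟩
    filter_upwards [hC, hC'] with i h1 h2 k hk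
    rcases Nat.lt_or_ge n k with hlt | hge
    · obtain rfl : k = n + 1 := by omega
      exact mono _ _ _ _ (le_max_right _ _) h2
    · exact mono _ _ _ _ (le_max_left _ _) (h1 k hge)

theorem SmallFam.small_le {v : ι → E → F} (hv : SmallFam 𝓕 v) (n : ℕ) {ε : ℝ} (hε : 0 < ε) :
    ∀ᶠ i in 𝓕, ∀ j ≤ n, ∀ x, ‖iteratedFDeriv ℝ j (v i) x‖ ≤ ε := by
  induction n with
  | zero =>
    filter_upwards [hv.small 0 ε hε] with i hi j hj
    obtain rfl : j = 0 := by omega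
    exact hi
  | succ n ih =>
    filter_upwards [ih, hv.small (n + 1) ε hε] with i h1 h2 j hj
    rcases Nat.lt_or_ge n j with hlt | hge
    · obtain rfl : j = n + 1 := by omega
      exact h2
    · exact h1 j hge

/-- The composition of two families, with bounds only up to a given order for the inner one. -/
theorem SmallFam.eventually_comp_le {v : ι → F → G} (hv : SmallFam 𝓕 v) {w : ι → E → F}
    (hw : ∀ᶠ i in 𝓕, ContDiff ℝ ∞ (w i)) (n : ℕ)
    (hb : ∀ j, 1 ≤ j → j ≤ n → ∃ C : ℝ, ∀ᶠ i in 𝓕, ∀ x, ‖iteratedFDeriv ℝ j (w i) x‖ ≤ C)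
    {ε : ℝ} (hε : 0 < ε) :
    ∀ᶠ i in 𝓕, ∀ x, ‖iteratedFDeriv ℝ n (v i ∘ w i) x‖ ≤ ε := by
  obtain ⟨D, hD1, hD⟩ := exists_uniform_bound (𝓕 := 𝓕)
    (p := fun k C i => 1 ≤ k → ∀ x, ‖iteratedFDeriv ℝ k (w i) x‖ ≤ C)
    (fun k C C' i hCC h hk x => (h hk x).trans hCC) n (fun k hk => by
      by_cases h1 : 1 ≤ k
      · obtain ⟨C, hC⟩ := hb k h1 hk
        exact ⟨C, hC.mono fun i hi _ => hi⟩
      · exact ⟨0, Eventually.of_forall fun i h => absurd h h1⟩)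
  have hpos : 0 < (n.factorial : ℝ) * D ^ n := by positivity
  filter_upwards [hv.small_le n (div_pos hε hpos), hD, hv.smooth, hw] with i h1 h2 h3 h4 x
  have hn : (n : ℕ∞ω) ≤ ∞ := by exact_mod_cast le_top
  have := norm_iteratedFDeriv_comp_le (h3.of_le hn) (h4.of_le hn) le_rfl x
    (C := ε / ((n.factorial : ℝ) * D ^ n)) (D := D)
    (fun j hj => h1 j hj _) (fun j hj hjn => (h2 j hjn hj x).trans (le_self_pow₀ hD1 (by omega)))
  refine this.trans (le_of_eq ?_)
  field_simp

theorem SmallFam.comp {v : ι → F → G} (hv : SmallFam 𝓕 v) {w : ι → E → F} (hw : BddDer 𝓕 w) :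
    SmallFam 𝓕 fun i => v i ∘ w i :=
  ⟨by filter_upwards [hv.smooth, hw.smooth] with i h1 h2 using h1.comp h2,
    fun j _ hε => hv.eventually_comp_le hw.smooth j (fun k hk _ => hw.bdd k hk) hε⟩

theorem SmallFam.clm_comp {v : ι → E → F} (hv : SmallFam 𝓕 v) (L : F →L[ℝ] G) :
    SmallFam 𝓕 fun i => L ∘ v i := by
  refine ⟨hv.smooth.mono fun i hi => L.contDiff.comp hi, fun j ε hε => ?_⟩
  filter_upwards [hv.small j (ε / (‖L‖ + 1)) (by positivity), hv.smooth] with i h1 h2 x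
  refine (L.norm_iteratedFDeriv_comp_left h2.contDiffAt (n := j) (by exact_mod_cast le_top)).trans ?_
  calc ‖L‖ * _ ≤ (‖L‖ + 1) * (ε / (‖L‖ + 1)) := by
        gcongr
        · linarith
        · exact h1 x
    _ = ε := by field_simp

theorem BddDer.clm_comp {v : ι → E → F} (hv : BddDer 𝓕 v) (L : F →L[ℝ] G) :
    BddDer 𝓕 fun i => L ∘ v i := by
  refine ⟨hv.smooth.mono fun i hi => L.contDiff.comp hi, fun j hj => ?_⟩
  obtain ⟨C, hC⟩ := hv.bdd j hj
  refine ⟨‖L‖ * C, ?_⟩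
  filter_upwards [hC, hv.smooth] with i h1 h2 x
  refine (L.norm_iteratedFDeriv_comp_left h2.contDiffAt (n := j) (by exact_mod_cast le_top)).trans ?_
  gcongr
  exact h1 x

theorem bddDer_clm (L : E →L[ℝ] F) : BddDer 𝓕 fun _ : ι => (L : E → F) := by
  refine ⟨Eventually.of_forall fun _ => L.contDiff, fun j hj => ⟨‖L‖, Eventually.of_forall ?_⟩⟩
  intro _ x
  obtain ⟨k, rfl⟩ : ∃ k, j = k + 1 := ⟨j - 1, by omega⟩
  have hL : fderiv ℝ L = fun _ => L := by ext1 y; exact L.fderiv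
  rw [← norm_iteratedFDeriv_fderiv, hL]
  rcases eq_or_ne k 0 with rfl | hk
  · simp
  · rw [iteratedFDeriv_const_of_ne hk]
    simp

theorem SmallFam.fderiv {v : ι → E → F} (hv : SmallFam 𝓕 v) :
    SmallFam 𝓕 fun i => fderiv ℝ (v i) := by
  refine ⟨hv.smooth.mono fun i hi => hi.fderiv_right (by simp), fun j ε hε => ?_⟩
  simp_rw [norm_iteratedFDeriv_fderiv]
  exact hv.small (j + 1) ε hε

/-- Order zero is a separate assumption, since a small derivative does not bound the values on an
unbounded space. -/
theorem SmallFam.of_fderiv {v : ι → E → F} (hd : ∀ᶠ i in 𝓕, Differentiable ℝ (v i))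
    (h0 : ∀ ε > (0 : ℝ), ∀ᶠ i in 𝓕, ∀ x, ‖v i x‖ ≤ ε)
    (hv : SmallFam 𝓕 fun i => _root_.fderiv ℝ (v i)) : SmallFam 𝓕 v := by
  refine ⟨?_, fun j ε hε => ?_⟩
  · filter_upwards [hd, hv.smooth] with i h1 h2
    rw [contDiff_infty_iff_fderiv]
    exact ⟨h1, h2⟩
  · rcases j with _ | j
    · simpa using h0 ε hε
    · have := hv.small j ε hε
      simp_rw [norm_iteratedFDeriv_fderiv] at this
      exact this

theorem SmallFam.smul {v : ι → E → F} (hv : SmallFam 𝓕 v) {f : E → ℝ} (hf : ContDiff ℝ ∞ f)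
    (hb : ∀ j, ∃ C : ℝ, ∀ x, ‖iteratedFDeriv ℝ j f x‖ ≤ C) :
    SmallFam 𝓕 fun i x => f x • v i x := by
  refine ⟨hv.smooth.mono fun i hi => hf.smul hi, fun n ε hε => ?_⟩
  obtain ⟨C, hC1, hC⟩ := exists_uniform_bound (𝓕 := (⊤ : Filter Unit))
    (p := fun k C _ => ∀ x, ‖iteratedFDeriv ℝ k f x‖ ≤ C)
    (fun k C C' i hCC h x => (h x).trans hCC) n (fun k _ => by
      obtain ⟨C, hC⟩ := hb k
      exact ⟨C, Eventually.of_forall fun _ => hC⟩)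
  simp only [eventually_top] at hC
  replace hC := hC ()
  set M : ℝ := ∑ i ∈ Finset.range (n + 1), (n.choose i : ℝ) * C with hM
  have hM0 : 0 ≤ M := Finset.sum_nonneg fun i _ => by positivity
  filter_upwards [hv.small_le n (ε := ε / (M + 1)) (by positivity), hv.smooth] with i h1 h2 x
  refine (norm_iteratedFDeriv_smul_le hf h2 x (n := n) (by exact_mod_cast le_top)).trans ?_
  calc _ ≤ ∑ i ∈ Finset.range (n + 1), (n.choose i : ℝ) * C * (ε / (M + 1)) := by
        refine Finset.sum_le_sum fun k hk => ?_
        have hk' : k ≤ n := by simpa [Nat.lt_succ_iff] using hk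
        gcongr
        · exact hC k hk' x
        · exact h1 _ (by omega) x
    _ = M * (ε / (M + 1)) := by rw [← Finset.sum_mul]
    _ ≤ (M + 1) * (ε / (M + 1)) := by gcongr; linarith
    _ = ε := by field_simp

/-- Solving an identity `A = 1 - B A` with `B` small for bounds on the derivatives of `A`. -/
theorem bdd_iteratedFDeriv_step {A B : E → (G →L[ℝ] G)} (hA : ContDiff ℝ ∞ A)
    (hB : ContDiff ℝ ∞ B) (hAB : ∀ x, A x = ContinuousLinearMap.id ℝ G - (B x).comp (A x))
    (hB0 : ∀ x, ‖B x‖ ≤ 1 / 2) (n : ℕ) {C : ℝ} (hC : 0 ≤ C)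
    (hBn : ∀ j ≤ n, ∀ x, ‖iteratedFDeriv ℝ j B x‖ ≤ C)
    (hAn : ∀ j < n, ∀ x, ‖iteratedFDeriv ℝ j A x‖ ≤ C) (x : E) :
    ‖iteratedFDeriv ℝ n A x‖ ≤
      2 * (1 + ∑ k ∈ Finset.range n, (n.choose (k + 1) : ℝ) * C * C) := by
  have hn : (n : ℕ∞ω) ≤ ∞ := by exact_mod_cast le_top
  set cL := ContinuousLinearMap.compL ℝ G G G
  have hcL : ‖cL‖ ≤ 1 := ContinuousLinearMap.norm_compL_le ℝ G G G
  have hprod : ContDiff ℝ ∞ fun y => cL (B y) (A y) := hB.clm_comp hA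
  have heq : A = (fun _ => ContinuousLinearMap.id ℝ G) - fun y => cL (B y) (A y) := by
    ext1 y
    exact hAB y
  have hsub : iteratedFDeriv ℝ n A x = iteratedFDeriv ℝ n (fun _ : E => ContinuousLinearMap.id ℝ G) x
      - iteratedFDeriv ℝ n (fun y => cL (B y) (A y)) x := by
    conv_lhs => rw [heq]
    exact iteratedFDeriv_sub_apply contDiff_const.contDiffAt (hprod.of_le hn).contDiffAt
  have hconst : ‖iteratedFDeriv ℝ n (fun _ : E => ContinuousLinearMap.id ℝ G) x‖ ≤ 1 := by
    rcases eq_or_ne n 0 with rfl | h0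
    · rw [norm_iteratedFDeriv_zero]
      exact ContinuousLinearMap.norm_id_le
    · rw [iteratedFDeriv_const_of_ne h0]
      simp
  have hbil := cL.norm_iteratedFDeriv_le_of_bilinear_of_le_one hB hA x hn hcL
  -- The Leibniz term in which `B` is not differentiated contains the unknown `D^n A` with a factor
  -- at most `1 / 2`. It is absorbed into the left side, hence the factor `2` in the bound.
  rw [Finset.sum_range_succ'] at hbil
  simp only [Nat.choose_zero_right, Nat.cast_one, norm_iteratedFDeriv_zero, one_mul,
    Nat.sub_zero] at hbil
  have hs : ∑ k ∈ Finset.range n, (n.choose (k + 1) : ℝ) * ‖iteratedFDeriv ℝ (k + 1) B x‖ *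
      ‖iteratedFDeriv ℝ (n - (k + 1)) A x‖ ≤
      ∑ k ∈ Finset.range n, (n.choose (k + 1) : ℝ) * C * C := by
    refine Finset.sum_le_sum fun k hk => ?_
    have hk' : k < n := by simpa using hk
    gcongr
    · exact hBn _ (by omega) x
    · exact hAn _ (by omega) x
  have h0 : ‖B x‖ * ‖iteratedFDeriv ℝ n A x‖ ≤ 1 / 2 * ‖iteratedFDeriv ℝ n A x‖ := by
    gcongr
    exact hB0 x
  have := norm_sub_le (iteratedFDeriv ℝ n (fun _ : E => ContinuousLinearMap.id ℝ G) x)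
    (iteratedFDeriv ℝ n (fun y => cL (B y) (A y)) x)
  rw [← hsub] at this
  linarith

/-- A smooth map with small derivative is a perturbation of the identity that is globally
invertible, with smooth inverse. -/
theorem exists_smooth_inverse [CompleteSpace E] {v : E → E} (hv : ContDiff ℝ ∞ v)
    (hs : ∀ x, ‖fderiv ℝ v x‖ ≤ 1 / 2) :
    ∃ w : E → E, ContDiff ℝ ∞ w ∧ (∀ x, w (x + v x) = x) ∧ ∀ y, w y + v (w y) = y := by
  have hvd : Differentiable ℝ v := hv.differentiable (by simp)
  have happ : ApproximatesLinearOn (fun x => x + v x)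
      ((ContinuousLinearEquiv.refl ℝ E : E ≃L[ℝ] E) : E →L[ℝ] E) univ (1 / 2) := by
    rw [ApproximatesLinearOn]
    have hL : LipschitzWith (1 / 2) v := lipschitzWith_of_nnnorm_fderiv_le hvd fun x => by
      rw [← NNReal.coe_le_coe]; simpa using hs x
    refine fun x _ y _ => ?_
    have := hL.norm_sub_le x y
    simp only [ContinuousLinearEquiv.coe_refl, ContinuousLinearMap.id_apply]
    rwa [show x + v x - (y + v y) - (x - y) = v x - v y by abel]
  have hc : Subsingleton E ∨ (1 / 2 : NNReal) <
      ‖((ContinuousLinearEquiv.refl ℝ E).symm : E →L[ℝ] E)‖₊⁻¹ := by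
    rcases subsingleton_or_nontrivial E with h | h
    · exact Or.inl h
    · right
      have : ‖((ContinuousLinearEquiv.refl ℝ E).symm : E →L[ℝ] E)‖₊ = 1 := by
        simp
      rw [this, inv_one]
      exact NNReal.half_lt_self one_ne_zero
  set e : E ≃ₜ E := ApproximatesLinearOn.toHomeomorph _ happ hc
  have he : ∀ x, e x = x + v x := fun x => rfl
  have hun : ∀ x, ‖-(fderiv ℝ v x)‖ < 1 := fun x => by
    rw [norm_neg]; exact (hs x).trans_lt (by norm_num)
  let f₀' : E → E ≃L[ℝ] E := fun x =>
    ContinuousLinearEquiv.ofUnit (Units.oneSub (-(fderiv ℝ v x)) (hun x))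
  have hd : ∀ x, HasFDerivAt e (f₀' x : E →L[ℝ] E) x := by
    intro x
    have : (f₀' x : E →L[ℝ] E) = ContinuousLinearMap.id ℝ E + fderiv ℝ v x := by
      ext y
      change (1 - -(fderiv ℝ v x)) y = _
      simp
    rw [this]
    exact (hasFDerivAt_id x).add (hvd x).hasFDerivAt
  have hsm : ContDiff ℝ ∞ e := contDiff_id.add hv
  refine ⟨e.symm, e.contDiff_symm hd hsm, fun x => ?_, fun y => ?_⟩
  · rw [← he, e.symm_apply_apply]
  · rw [← he, e.apply_symm_apply]

/-- The inverse of `x + v x` is only asserted to have bounded derivatives of positive order, which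
suffices for composing small families with it. The bounds come from `Dw = 1 - (Dv ∘ w) Dw`. -/
theorem SmallFam.exists_inverse [CompleteSpace E] [NeBot 𝓕] {v : ι → E → E} (hv : SmallFam 𝓕 v) :
    ∃ w : ι → E → E, BddDer 𝓕 w ∧
      ∀ᶠ i in 𝓕, (∀ x, w i (x + v i x) = x) ∧ ∀ y, w i y + v i (w i y) = y := by
  have h1 : ∀ᶠ i in 𝓕, ContDiff ℝ ∞ (v i) ∧ ∀ x, ‖_root_.fderiv ℝ (v i) x‖ ≤ 1 / 2 := by
    filter_upwards [hv.smooth, hv.small 1 (1 / 2) (by norm_num)] with i h1 h2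
    refine ⟨h1, fun x => ?_⟩
    rw [← norm_iteratedFDeriv_one]
    exact h2 x
  have hex : ∀ᶠ i in 𝓕, ∃ w : E → E, ContDiff ℝ ∞ w ∧ (∀ x, w (x + v i x) = x) ∧
      ∀ y, w y + v i (w y) = y := h1.mono fun i hi => exists_smooth_inverse hi.1 hi.2
  obtain ⟨w, hw⟩ := hex.choice
  have hws : ∀ᶠ i in 𝓕, ContDiff ℝ ∞ (w i) := hw.mono fun i hi => hi.1
  refine ⟨w, ⟨hws, ?_⟩, hw.mono fun i hi => hi.2⟩
  have hA : ∀ᶠ i in 𝓕, ∀ y, _root_.fderiv ℝ (w i) y = ContinuousLinearMap.id ℝ E -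
      (_root_.fderiv ℝ (v i) (w i y)).comp (_root_.fderiv ℝ (w i) y) := by
    filter_upwards [hw, hv.smooth] with i ⟨h1, _, h3⟩ h4 y
    have e1 : HasFDerivAt (fun y => w i y + v i (w i y))
        (_root_.fderiv ℝ (w i) y + (_root_.fderiv ℝ (v i) (w i y)).comp (_root_.fderiv ℝ (w i) y)) y :=
      ((h1.differentiable (by simp)) y).hasFDerivAt.add
        (((h4.differentiable (by simp)) _).hasFDerivAt.comp y
          ((h1.differentiable (by simp)) y).hasFDerivAt)
    have e2 : HasFDerivAt (fun y => w i y + v i (w i y)) (ContinuousLinearMap.id ℝ E) y := by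
      rw [funext h3]
      exact hasFDerivAt_id y
    rw [eq_sub_iff_add_eq]
    exact e1.unique e2
  -- Strong induction: bounds on `Dw` up to order `n - 1` bound the derivatives of `w` up to order
  -- `n`, hence those of `Dv ∘ w`, and then the identity for `Dw` gives order `n`.
  have key : ∀ n : ℕ, ∃ C : ℝ, ∀ᶠ i in 𝓕, ∀ x, ‖iteratedFDeriv ℝ n (_root_.fderiv ℝ (w i)) x‖ ≤ C := by
    intro n
    induction n using Nat.strong_induction_on with
    | _ n ih =>
      have hB : ∃ C, 1 ≤ C ∧ ∀ᶠ i in 𝓕, ∀ k ≤ n, ∀ x,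
          ‖iteratedFDeriv ℝ k (_root_.fderiv ℝ (v i) ∘ w i) x‖ ≤ C :=
        ⟨1, le_rfl, by
          have : ∀ m ≤ n, ∀ᶠ i in 𝓕, ∀ x,
              ‖iteratedFDeriv ℝ m (_root_.fderiv ℝ (v i) ∘ w i) x‖ ≤ 1 := by
            intro m hm
            refine hv.fderiv.eventually_comp_le hws m (fun j hj hjm => ?_) one_pos
            obtain ⟨k, rfl⟩ : ∃ k, j = k + 1 := ⟨j - 1, by omega⟩
            simp_rw [← norm_iteratedFDeriv_fderiv]
            exact ih k (by omega)
          have h2 := (Finset.eventually_all (Finset.range (n + 1))).2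
            (fun m hm => this m (by simpa [Nat.lt_succ_iff] using hm))
          exact h2.mono fun i hi k hk => hi k (by simpa [Nat.lt_succ_iff] using hk)⟩
      obtain ⟨C₁, hC₁, hB⟩ := hB
      obtain ⟨C₂, hC₂, hA'⟩ := exists_uniform_bound (𝓕 := 𝓕)
        (p := fun k C i => k < n → ∀ x, ‖iteratedFDeriv ℝ k (_root_.fderiv ℝ (w i)) x‖ ≤ C)
        (fun k C C' i hCC h hk x => (h hk x).trans hCC) n (fun k hk => by
          by_cases h1 : k < n
          · obtain ⟨C, hC⟩ := ih k h1
            exact ⟨C, hC.mono fun i hi _ => hi⟩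
          · exact ⟨0, Eventually.of_forall fun i h => absurd h h1⟩)
      refine ⟨2 * (1 + ∑ k ∈ Finset.range n, (n.choose (k + 1) : ℝ) * max C₁ C₂ * max C₁ C₂), ?_⟩
      filter_upwards [h1, hA, hB, hA', hws] with i g1 g2 g3 g4 g5 x
      refine bdd_iteratedFDeriv_step (B := _root_.fderiv ℝ (v i) ∘ w i) (g5.fderiv_right (by simp))
        ((g1.1.fderiv_right (by simp)).comp g5) g2 (fun y => g1.2 _) n
        ((zero_le_one.trans hC₁).trans (le_max_left _ _))
        (fun j hj x => (g3 j hj x).trans (le_max_left _ _))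
        (fun j hj x => (g4 j hj.le hj x).trans (le_max_right _ _)) x
  intro j hj
  obtain ⟨k, rfl⟩ : ∃ k, j = k + 1 := ⟨j - 1, by omega⟩
  simp_rw [← norm_iteratedFDeriv_fderiv]
  exact key k

end SmallFamilies


/-! ### Smooth steps with bounded derivatives -/

section Cutoff

theorem exists_bound_comp_clm {E : Type*} [NormedAddCommGroup E] [NormedSpace ℝ E] {f : ℝ → ℝ}
    (hf : ContDiff ℝ ∞ f) (hb : ∀ j, ∃ C : ℝ, ∀ x, ‖iteratedFDeriv ℝ j f x‖ ≤ C) (L : E →L[ℝ] ℝ)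
    (j : ℕ) : ∃ C : ℝ, ∀ x, ‖iteratedFDeriv ℝ j (f ∘ L) x‖ ≤ C := by
  obtain ⟨C, hC⟩ := hb j
  refine ⟨C * ∏ _i : Fin j, ‖L‖, fun x => ?_⟩
  rw [L.iteratedFDeriv_comp_right hf x (i := j) (by exact_mod_cast le_top)]
  refine (ContinuousMultilinearMap.norm_compContinuousLinearMap_le _ _).trans ?_
  gcongr
  exact hC _

theorem exists_bound_of_hasCompactSupport {f : ℝ → ℝ} (hf : ContDiff ℝ ∞ f)
    (hs : HasCompactSupport f) (j : ℕ) : ∃ C : ℝ, ∀ x, ‖iteratedFDeriv ℝ j f x‖ ≤ C :=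
  (hf.continuous_iteratedFDeriv (m := j) (by exact_mod_cast le_top)).bounded_above_of_compact_support
    (hs.iteratedFDeriv j)

/-- A smooth step from `0` to `1`, with derivative supported in `[-δ/2, δ/2]`. -/
theorem exists_smooth_step {δ : ℝ} (hδ : 0 < δ) :
    ∃ χ : ℝ → ℝ, ContDiff ℝ ∞ χ ∧ (∀ t ≤ -(δ / 2), χ t = 0) ∧ (∀ t, δ / 2 ≤ t → χ t = 1) ∧
      (∀ t, δ / 2 < |t| → deriv χ t = 0) ∧
      (∀ j, ∃ C : ℝ, ∀ x, ‖iteratedFDeriv ℝ j χ x‖ ≤ C) ∧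
      ContDiff ℝ ∞ (deriv χ) ∧ ∀ j, ∃ C : ℝ, ∀ x, ‖iteratedFDeriv ℝ j (deriv χ) x‖ ≤ C := by
  -- The affine change of variable sends `[-δ/2, δ/2]` to `[0, 1]`.
  set χ : ℝ → ℝ := fun t => Real.smoothTransition (t / δ + 1 / 2) with hχ
  have hsm : ContDiff ℝ ∞ χ := Real.smoothTransition.contDiff.comp (by fun_prop)
  have h0 : ∀ t ≤ -(δ / 2), χ t = 0 := fun t ht => by
    refine Real.smoothTransition.zero_of_nonpos ?_
    have : t / δ ≤ -(1 / 2) := by rw [div_le_iff₀ hδ]; linarith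
    linarith
  have h1 : ∀ t, δ / 2 ≤ t → χ t = 1 := fun t ht => by
    refine Real.smoothTransition.one_of_one_le ?_
    have : 1 / 2 ≤ t / δ := by rw [le_div_iff₀ hδ]; linarith
    linarith
  have hd : ∀ t, δ / 2 < |t| → deriv χ t = 0 := fun t ht => by
    rcases lt_abs.1 ht with h | h
    · have : χ =ᶠ[𝓝 t] fun _ => 1 := by
        filter_upwards [lt_mem_nhds h] with y hy using h1 y hy.le
      rw [this.deriv_eq, deriv_const]
    · have : χ =ᶠ[𝓝 t] fun _ => 0 := by
        filter_upwards [gt_mem_nhds (show t < -(δ / 2) by linarith)] with y hy using h0 y hy.le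
      rw [this.deriv_eq, deriv_const]
  have hdsm : ContDiff ℝ ∞ (deriv χ) := (contDiff_infty_iff_deriv.1 hsm).2
  have hcs : HasCompactSupport (deriv χ) := by
    refine HasCompactSupport.intro (isCompact_Icc (a := -(δ / 2)) (b := δ / 2)) fun t ht => hd t ?_
    by_contra hcon
    exact ht (abs_le.1 (not_lt.1 hcon))
  refine ⟨χ, hsm, h0, h1, hd, fun j => ?_, hdsm, exists_bound_of_hasCompactSupport hdsm hcs⟩
  rcases j with _ | j
  · refine ⟨1, fun x => ?_⟩
    rw [norm_iteratedFDeriv_zero, Real.norm_of_nonneg (Real.smoothTransition.nonneg _)]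
    exact Real.smoothTransition.le_one _
  · obtain ⟨C, hC⟩ := exists_bound_of_hasCompactSupport hdsm hcs j
    refine ⟨C, fun x => ?_⟩
    rw [norm_iteratedFDeriv_eq_norm_iteratedDeriv, iteratedDeriv_succ']
    rw [← norm_iteratedFDeriv_eq_norm_iteratedDeriv]
    exact hC x

end Cutoff

/-! ### Primitives supported in a ball -/

section Exterior

variable {E : Type*} [NormedAddCommGroup E] [NormedSpace ℝ E]

/-- In polar form the exterior is the image of a ray times the unit sphere, which is connected
because the dimension exceeds one. -/
theorem isPreconnected_norm_gt (h : 1 < Module.rank ℝ E) {ρ : ℝ} (hρ : 0 ≤ ρ) :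
    IsPreconnected {x : E | ρ < ‖x‖} := by
  have hs := isPreconnected_sphere h (0 : E) 1
  have heq : {x : E | ρ < ‖x‖} = (fun a : ℝ × E => a.1 • a.2) '' (Ioi ρ ×ˢ Metric.sphere 0 1) := by
    ext x
    simp only [mem_ofPred_eq, mem_image, mem_prod, mem_Ioi, mem_sphere_iff_norm, sub_zero,
      Prod.exists]
    constructor
    · intro hx
      have hx0 : ‖x‖ ≠ 0 := by linarith
      refine ⟨‖x‖, ‖x‖⁻¹ • x, ⟨hx, ?_⟩, ?_⟩
      · rw [norm_smul, norm_inv, norm_norm, inv_mul_cancel₀ hx0]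
      · rw [smul_smul, mul_inv_cancel₀ hx0, one_smul]
    · rintro ⟨a, y, ⟨ha, hy⟩, rfl⟩
      rw [norm_smul, hy, mul_one, Real.norm_of_nonneg (by linarith)]
      exact ha
  rw [heq]
  exact (isPreconnected_Ioi.prod hs).image _ (by fun_prop)

/-- A closed smooth 1-form vanishing outside a ball has a primitive vanishing outside that ball. -/
theorem exists_primitive_eq_zero_outside (h : 1 < Module.rank ℝ E) {ρ : ℝ} (hρ : 0 < ρ)
    {α : E → E →L[ℝ] ℝ} (hα : ContDiff ℝ ∞ α) (hsymm : ∀ x u v, fderiv ℝ α x u v = fderiv ℝ α x v u)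
    (h0 : ∀ x, ρ < ‖x‖ → α x = 0) :
    ∃ S : E → ℝ, (∀ x, HasFDerivAt S (α x) x) ∧ ∀ x, ρ < ‖x‖ → S x = 0 := by
  have hne : ∃ y : E, ρ < ‖y‖ := by
    have : Nontrivial E := by
      by_contra hcon
      rw [not_nontrivial_iff_subsingleton] at hcon
      rw [rank_subsingleton'] at h
      exact absurd h (by simp)
    exact NormedSpace.exists_lt_norm ℝ E ρ
  obtain ⟨y, hy⟩ := hne
  obtain ⟨S, hS⟩ := convex_univ.exists_forall_hasFDerivAt_of_fderiv_symmetric isOpen_univ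
    (hα.differentiable (by simp)).differentiableOn
    (fun x _ u v => hsymm x u v)
  have hS' : ∀ x, HasFDerivAt S (α x) x := fun x => hS x (mem_univ x)
  -- Any primitive is constant on the connected exterior; subtracting its value at one exterior
  -- point makes it vanish there.
  refine ⟨fun x => S x - S y, fun x => (hS' x).sub_const _, fun x hx => sub_eq_zero.2 ?_⟩
  refine (isOpen_lt continuous_const continuous_norm).is_const_of_fderiv_eq_zero (𝕜 := ℝ)
    (isPreconnected_norm_gt h hρ.le) (fun z _ => (hS' z).differentiableAt.differentiableWithinAt)
    (fun z hz => ?_) hx hy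
  rw [(hS' z).fderiv, h0 z hz]
  rfl

/-- `S` vanishes at a point of norm `2 * ρ`, and this point is at distance at most `3 * ρ` from
every point of the ball. -/
theorem norm_le_of_primitive {ρ C : ℝ} (h : 1 < Module.rank ℝ E) (hρ : 0 < ρ)
    {S : E → ℝ} {α : E → E →L[ℝ] ℝ} (hS : ∀ x, HasFDerivAt S (α x) x)
    (h0 : ∀ x, ρ < ‖x‖ → S x = 0) (hC : 0 ≤ C) (hα : ∀ x, ‖α x‖ ≤ C) (x : E) :
    ‖S x‖ ≤ C * (3 * ρ) := by
  have : Nontrivial E := by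
    by_contra hcon
    rw [not_nontrivial_iff_subsingleton] at hcon
    rw [rank_subsingleton'] at h
    exact absurd h (by simp)
  rcases lt_or_ge ρ ‖x‖ with hx | hx
  · rw [h0 x hx, norm_zero]; positivity
  obtain ⟨y, hy⟩ := exists_norm_eq E (show 0 ≤ 2 * ρ by positivity)
  have := convex_univ.norm_image_sub_le_of_norm_hasFDerivWithin_le (𝕜 := ℝ) (f := S) (f' := α)
    (fun x _ => (hS x).hasFDerivWithinAt) (fun x _ => hα x) (mem_univ y) (mem_univ x)
  rw [h0 y (by linarith), sub_zero] at this
  refine this.trans ?_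
  gcongr
  exact (norm_sub_le _ _).trans (by linarith)

end Exterior

/-! ### Linear algebra of generating functions -/

section Symplectic

variable {F : Type*} [NormedAddCommGroup F] [InnerProductSpace ℝ F]

/-- The standard symplectic form on `F × F`. -/
def stdForm (F : Type*) [NormedAddCommGroup F] [InnerProductSpace ℝ F] :
    F × F →L[ℝ] F × F →L[ℝ] ℝ :=
  (innerSL ℝ).bilinearComp (ContinuousLinearMap.fst ℝ F F) (ContinuousLinearMap.snd ℝ F F) -
    (innerSL ℝ).bilinearComp (ContinuousLinearMap.snd ℝ F F) (ContinuousLinearMap.fst ℝ F F)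

theorem stdForm_apply (a b : F × F) :
    stdForm F a b = inner ℝ a.1 b.2 - inner ℝ a.2 b.1 := by
  simp [stdForm, ContinuousLinearMap.bilinearComp_apply]

/-- The generating 1-form of a symplectic map is closed. -/
theorem stdForm_generating_symm {a b A B : F × F} (h : stdForm F A B = stdForm F a b) :
    stdForm F (A - a) (b.1, B.2) = stdForm F (B - b) (a.1, A.2) := by
  simp only [stdForm_apply, Prod.fst_sub, Prod.snd_sub, inner_sub_left] at h ⊢
  have e1 := real_inner_comm A.1 B.2
  have e2 := real_inner_comm A.2 B.1
  have e3 := real_inner_comm a.1 b.2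
  have e4 := real_inner_comm a.2 b.1
  have e5 := real_inner_comm a.1 B.2
  have e6 := real_inner_comm A.2 b.1
  linarith

/-- The identity behind the fact that the curves `z + χ g` solve the Hamiltonian system generated
by `χ' S`. -/
theorem stdForm_curve_identity {g g' ζ gζ η : F × F} {a b : ℝ}
    (hη : η = a • ((0 : F), g.2) + b • ((0 : F), g'.2))
    (hs : stdForm F g' ζ = stdForm F gζ η) :
    stdForm F (a • g + b • g') (ζ + b • (gζ.1, (0 : F))) = a * stdForm F g ζ := by
  subst hη
  rw [stdForm_apply, stdForm_apply] at hs ⊢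
  simp only [Prod.fst_add, Prod.snd_add, Prod.smul_fst, Prod.smul_snd, inner_add_left,
    inner_add_right, inner_smul_left, inner_smul_right, smul_zero, inner_zero_right,
    add_zero, conj_trivial, sub_zero] at hs ⊢
  have e1 := real_inner_comm g.2 gζ.1
  have e2 := real_inner_comm g'.2 gζ.1
  linear_combination b * hs + a * b * e1 + b * b * e2

end Symplectic


/-! ### Symplectic maps near the identity as time-dependent Hamiltonian flows -/

section Generating

variable {F : Type*} [NormedAddCommGroup F] [InnerProductSpace ℝ F]

/-- The Hamiltonian `χ' S` in the coordinates `y + χ (g₁, 0)` generates the isotopy `z + χ g`. -/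
theorem generating_curve {χ : ℝ → ℝ} (hχ : ContDiff ℝ ∞ χ) (hχ' : ContDiff ℝ ∞ (deriv χ))
    {g : F × F → F × F}
    (hg : ContDiff ℝ ∞ g) {S : F × F → ℝ} (hS : ∀ y, HasFDerivAt S (stdForm F (g y)) y)
    (hsymm : ∀ y u v, stdForm F (fderiv ℝ g y u) v = stdForm F (fderiv ℝ g y v) u)
    {T X : ℝ × (F × F) → ℝ × (F × F)} (hT : ContDiff ℝ ∞ T) (hX : ContDiff ℝ ∞ X)
    (hT1 : ∀ x, T (x + χ x.1 • ((0 : ℝ), ((g x.2).1, (0 : F)))) = x)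
    (hT2 : ∀ y, T y + χ (T y).1 • ((0 : ℝ), ((g (T y).2).1, (0 : F))) = y)
    (hX1 : ∀ x, X (x + χ x.1 • (0, ((0 : F), -(g x.2).2))) = x)
    (hX2 : ∀ y, X y + χ (X y).1 • ((0 : ℝ), ((0 : F), -(g (X y).2).2)) = y)
    {ρ : ℝ} (hg0 : ∀ y, ρ < ‖y‖ → g y = 0) (z₀ : F × F) :
    ∃ c c' Y : ℝ → F × F, (∀ t, c t = z₀ + χ t • g (Y t)) ∧
      (∀ t y, y + χ t • ((0 : F), -(g y).2) = z₀ → Y t = y) ∧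
      ∀ t, HasDerivAt c (c' t) t ∧
        (∀ v, stdForm F (c' t) v =
          fderiv ℝ (fun x : ℝ × (F × F) => deriv χ x.1 * S (T x).2) (t, c t) (0, v)) ∧
        ‖c t‖ ≤ max ρ ‖z₀‖ := by
  have hXfst : ∀ y, (X y).1 = y.1 := fun y => by
    have := congrArg Prod.fst (hX2 y)
    simpa using this
  have hTfst : ∀ y, (T y).1 = y.1 := fun y => by
    have := congrArg Prod.fst (hT2 y)
    simpa using this
  -- The mixed coordinates of the isotopy: `Y t` has the position of the starting point `z₀` and the
  -- momentum of the current point `c t`.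
  set Y : ℝ → F × F := fun t => (X (t, z₀)).2 with hYdef
  have hXY : ∀ t, X (t, z₀) = (t, Y t) := fun t => Prod.ext (hXfst _) rfl
  have hY : ∀ t, Y t + χ t • ((0 : F), -(g (Y t)).2) = z₀ := fun t => by
    have := congrArg Prod.snd (hX2 (t, z₀))
    rw [hXY] at this
    simpa using this
  have hYuniq : ∀ t y, y + χ t • ((0 : F), -(g y).2) = z₀ → Y t = y := fun t y hy => by
    have h1 := hX1 (t, y)
    have h2 : (t, y) + χ (t, y).1 • ((0 : ℝ), ((0 : F), -(g (t, y).2).2)) = (t, z₀) := by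
      refine Prod.ext (by simp) ?_
      exact hy
    rw [h2] at h1
    rw [hYdef]
    simp only [h1]
  have hYd : ∀ t, DifferentiableAt ℝ Y t := fun t => by
    have h1 : Differentiable ℝ X := hX.differentiable (by simp)
    exact ((h1 (t, z₀)).comp t (by fun_prop : DifferentiableAt ℝ (fun t : ℝ => (t, z₀)) t)).snd
  have hgd : Differentiable ℝ g := hg.differentiable (by simp)
  have hχd : ∀ t, HasDerivAt χ (deriv χ t) t := fun t => (hχ.differentiable (by simp) t).hasDerivAt
  have hgY : ∀ t, HasDerivAt (fun t => g (Y t)) (fderiv ℝ g (Y t) (deriv Y t)) t := fun t =>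
    (hgd (Y t)).hasFDerivAt.comp_hasDerivAt t (hYd t).hasDerivAt
  have hYeq : ∀ t, Y t = z₀ + χ t • ((0 : F), (g (Y t)).2) := fun t => by
    calc Y t = (Y t + χ t • ((0 : F), -(g (Y t)).2)) + χ t • ((0 : F), (g (Y t)).2) := by
          simp [Prod.ext_iff]
      _ = _ := by rw [hY t]
  have hη : ∀ t, deriv Y t = deriv χ t • ((0 : F), (g (Y t)).2) +
      χ t • ((0 : F), (fderiv ℝ g (Y t) (deriv Y t)).2) := fun t => by
    have h1 : HasDerivAt (fun t => ((0 : F), (g (Y t)).2))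
        ((0 : F), (fderiv ℝ g (Y t) (deriv Y t)).2) t :=
      (hasDerivAt_const t (0 : F)).prodMk
        ((ContinuousLinearMap.snd ℝ F F).hasFDerivAt.comp_hasDerivAt t (hgY t))
    have h2 := ((hχd t).smul h1).const_add z₀
    have h3 : (fun t => z₀ + (χ • fun t => ((0 : F), (g (Y t)).2)) t) = Y :=
      funext fun t => (hYeq t).symm
    rw [h3] at h2
    exact h2.deriv.trans (add_comm _ _)
  have hcY : ∀ t, z₀ + χ t • g (Y t) = Y t + χ t • ((g (Y t)).1, (0 : F)) := fun t => by
    conv_lhs => rw [← hY t]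
    simp [Prod.ext_iff, add_assoc]
  refine ⟨fun t => z₀ + χ t • g (Y t),
    fun t => deriv χ t • g (Y t) + χ t • fderiv ℝ g (Y t) (deriv Y t), Y, fun t => rfl, hYuniq,
    fun t => ⟨?_, fun v => ?_, ?_⟩⟩
  · have := ((hχd t).smul (hgY t)).const_add z₀
    rw [add_comm (χ t • _)] at this
    exact this
  -- `T` recovers the mixed coordinates from the current point, so the Hamiltonian is evaluated at
  -- `S (Y t)` along the curve.
  · have hTt : T (t, z₀ + χ t • g (Y t)) = (t, Y t) := by
      have := hT1 (t, Y t)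
      rw [hcY]
      convert this using 2
      simp
    set ct := z₀ + χ t • g (Y t) with hct
    have hline : HasDerivAt (fun r : ℝ => (t, ct + r • v)) ((0 : ℝ), v) 0 := by
      have h1 : HasDerivAt (fun r : ℝ => ct + r • v) v 0 := by
        simpa using ((hasDerivAt_id (0 : ℝ)).smul_const v).const_add ct
      exact (hasDerivAt_const (0 : ℝ) t).prodMk h1
    have hTd : Differentiable ℝ T := hT.differentiable (by simp)
    have hl0 : (fun r : ℝ => (t, ct + r • v)) 0 = (t, ct) := by simp
    set ζ : F × F := (fderiv ℝ T (t, ct) (0, v)).2 with hζ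
    have hτ : HasDerivAt (fun r : ℝ => (T (t, ct + r • v)).2) ζ 0 := by
      have h1 : HasFDerivAt T (fderiv ℝ T (t, ct)) ((fun r : ℝ => (t, ct + r • v)) 0) := by
        rw [hl0]
        exact (hTd _).hasFDerivAt
      exact (ContinuousLinearMap.snd ℝ ℝ (F × F)).hasFDerivAt.comp_hasDerivAt 0
        (h1.comp_hasDerivAt 0 hline)
    have hτ0 : (T (t, ct + (0 : ℝ) • v)).2 = Y t := by
      rw [zero_smul, add_zero, hTt]
    have hgτ : HasDerivAt (fun r : ℝ => g (T (t, ct + r • v)).2) (fderiv ℝ g (Y t) ζ) 0 := by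
      have h1 : HasFDerivAt g (fderiv ℝ g (Y t)) ((fun r : ℝ => (T (t, ct + r • v)).2) 0) := by
        simp only [hτ0]
        exact (hgd _).hasFDerivAt
      exact h1.comp_hasDerivAt 0 hτ
    -- The defining identity of `T` is differentiated in the direction `v`, which expresses `v` by
    -- the corresponding variation `ζ` of the mixed coordinates.
    have hv : v = ζ + χ t • ((fderiv ℝ g (Y t) ζ).1, (0 : F)) := by
      have h1 : HasDerivAt (fun r : ℝ => (T (t, ct + r • v)).2 +
          χ t • ((g (T (t, ct + r • v)).2).1, (0 : F)))
          (ζ + χ t • ((fderiv ℝ g (Y t) ζ).1, (0 : F))) 0 :=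
        hτ.add ((((ContinuousLinearMap.fst ℝ F F).hasFDerivAt.comp_hasDerivAt 0 hgτ).prodMk
          (hasDerivAt_const (0 : ℝ) (0 : F))).const_smul (χ t))
      have h2 : HasDerivAt (fun r : ℝ => (T (t, ct + r • v)).2 +
          χ t • ((g (T (t, ct + r • v)).2).1, (0 : F))) v 0 := by
        have : (fun r : ℝ => (T (t, ct + r • v)).2 +
          χ t • ((g (T (t, ct + r • v)).2).1, (0 : F))) = fun r => ct + r • v := by
          ext1 r
          have := congrArg Prod.snd (hT2 (t, ct + r • v))
          rw [hTfst] at this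
          exact this
        rw [this]
        simpa using ((hasDerivAt_id (0 : ℝ)).smul_const v).const_add ct
      exact h2.unique h1
    have hK : fderiv ℝ (fun x : ℝ × (F × F) => deriv χ x.1 * S (T x).2) (t, ct) (0, v) =
        deriv χ t * stdForm F (g (Y t)) ζ := by
      have hSd : Differentiable ℝ S := fun y => (hS y).differentiableAt
      have hχ'd : Differentiable ℝ (deriv χ) := hχ'.differentiable (by simp)
      have hKd : Differentiable ℝ (fun x : ℝ × (F × F) => deriv χ x.1 * S (T x).2) :=
        (hχ'd.comp differentiable_fst).mul (hSd.comp (differentiable_snd.comp hTd))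
      have h1 : HasFDerivAt (fun x : ℝ × (F × F) => deriv χ x.1 * S (T x).2)
          (fderiv ℝ (fun x : ℝ × (F × F) => deriv χ x.1 * S (T x).2) (t, ct))
          ((fun r : ℝ => (t, ct + r • v)) 0) := by
        rw [hl0]
        exact (hKd _).hasFDerivAt
      have h2 := h1.comp_hasDerivAt 0 hline
      have h3 : HasFDerivAt S (stdForm F (g (Y t))) ((fun r : ℝ => (T (t, ct + r • v)).2) 0) := by
        simp only [hτ0]
        exact hS _
      have h4 := (h3.comp_hasDerivAt 0 hτ).const_mul (deriv χ t)
      exact h2.unique h4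
    rw [hK]
    conv_lhs => rw [hv]
    exact stdForm_curve_identity (hη t) (hsymm _ _ _)
  · change ‖z₀ + χ t • g (Y t)‖ ≤ _
    rw [hcY]
    have hYb : ‖Y t‖ ≤ max ρ ‖z₀‖ := by
      rcases lt_or_ge ρ ‖Y t‖ with h | h
      · have := hY t
        rw [hg0 _ h] at this
        have h' : Y t = z₀ := by rw [← this]; simp [Prod.ext_iff]
        rw [h']; exact le_max_right _ _
      · exact h.trans (le_max_left _ _)
    -- If the current point lies outside the ball, `g` vanishes there. Then it and `Y t` have the
    -- same image under the map inverted by `T`, so they coincide.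
    rcases lt_or_ge ρ ‖Y t + χ t • ((g (Y t)).1, (0 : F))‖ with h | h
    · set c := Y t + χ t • ((g (Y t)).1, (0 : F)) with hc
      have h1 := hT1 (t, c)
      have h2 := hT1 (t, Y t)
      have e1 : (t, c) + χ (t, c).1 • ((0 : ℝ), ((g (t, c).2).1, (0 : F))) = (t, c) := by
        simp [hg0 _ h, Prod.ext_iff]
      have e2 : (t, Y t) + χ (t, Y t).1 • ((0 : ℝ), ((g (t, Y t).2).1, (0 : F))) = (t, c) := by
        refine Prod.ext (by simp) ?_
        exact hc.symm
      rw [e1] at h1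
      rw [e2, h1] at h2
      have : c = Y t := congrArg Prod.snd h2
      rw [this]
      exact hYb
    · exact h.trans (le_max_left _ _)

variable {ι : Type*} {𝓕 : Filter ι}

/-- A family of symplectic maps close to the identity, supported in a ball, is generated by a family
of small Hamiltonians with support in that ball. -/
theorem exists_generating_family [FiniteDimensional ℝ F] [Nontrivial F] [NeBot 𝓕]
    {φ : ι → F × F → F × F} {ρ δ : ℝ} (hρ : 0 < ρ) (hδ : 0 < δ)
    (hsm : SmallFam 𝓕 fun i z => φ i z - z) (hid : ∀ᶠ i in 𝓕, ∀ z, ρ < ‖z‖ → φ i z = z)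
    (hsymp : ∀ᶠ i in 𝓕, ∀ z u v,
      stdForm F (fderiv ℝ (φ i) z u) (fderiv ℝ (φ i) z v) = stdForm F u v) :
    ∃ K : ι → ℝ × (F × F) → ℝ, SmallFam 𝓕 K ∧ ∀ᶠ i in 𝓕,
      (∀ t z, (δ / 2 < |t| ∨ ρ < ‖z‖) → K i (t, z) = 0) ∧
      ∀ z₀, ∃ c c' : ℝ → F × F, c (-δ) = z₀ ∧ c δ = φ i z₀ ∧ ∀ t, HasDerivAt c (c' t) t ∧
        (∀ v, stdForm F (c' t) v = fderiv ℝ (K i) (t, c t) (0, v)) ∧ ‖c t‖ ≤ max ρ ‖z₀‖ := by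
  have hrank : 1 < Module.rank ℝ (F × F) := by
    rw [← Module.finrank_eq_rank, Module.finrank_prod]
    have := Module.finrank_pos (R := ℝ) (M := F)
    exact_mod_cast (by omega : 1 < Module.finrank ℝ F + Module.finrank ℝ F)
  obtain ⟨χ, hχ, hχ0, hχ1, hχ'0, hχb, hχ', hχ'b⟩ := exists_smooth_step hδ
  set v : ι → F × F → F × F := fun i z => φ i z - z with hv
  let J₀ : F × F →L[ℝ] F × F :=
    (ContinuousLinearMap.inr ℝ F F).comp (ContinuousLinearMap.snd ℝ F F)
  have hsm₀ : SmallFam 𝓕 fun i => J₀ ∘ v i := hsm.clm_comp J₀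
  -- The map `z + J₀ (v z)` passes from `z` to the mixed coordinates (old position, new momentum).
  -- With its inverse `w`, `g = v ∘ w` is the displacement in mixed coordinates.
  obtain ⟨w, hw, hw12⟩ := hsm₀.exists_inverse
  set g : ι → F × F → F × F := fun i => v i ∘ w i with hgdef
  have hg : SmallFam 𝓕 g := hsm.comp hw
  let J₁ : F × F →L[ℝ] ℝ × (F × F) := (ContinuousLinearMap.inr ℝ ℝ (F × F)).comp
    ((ContinuousLinearMap.inl ℝ F F).comp (ContinuousLinearMap.fst ℝ F F))
  let J₂ : F × F →L[ℝ] ℝ × (F × F) := (ContinuousLinearMap.inr ℝ ℝ (F × F)).comp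
    ((ContinuousLinearMap.inr ℝ F F).comp (-ContinuousLinearMap.snd ℝ F F))
  let p₂ : ℝ × (F × F) →L[ℝ] F × F := ContinuousLinearMap.snd ℝ ℝ (F × F)
  let p₁ : ℝ × (F × F) →L[ℝ] ℝ := ContinuousLinearMap.fst ℝ ℝ (F × F)
  have hχp : ContDiff ℝ ∞ (χ ∘ p₁) := hχ.comp p₁.contDiff
  have hχ'p : ContDiff ℝ ∞ (deriv χ ∘ p₁) := hχ'.comp p₁.contDiff
  have hgp : SmallFam 𝓕 fun i => g i ∘ p₂ := hg.comp (bddDer_clm p₂)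
  -- With time as a parameter, `T` computes mixed coordinates from the current point of the isotopy
  -- and `X` from its starting point.
  obtain ⟨T, hT, hT12⟩ := ((hgp.clm_comp J₁).smul hχp
    (exists_bound_comp_clm hχ hχb p₁)).exists_inverse
  obtain ⟨X, hX, hX12⟩ := ((hgp.clm_comp J₂).smul hχp
    (exists_bound_comp_clm hχ hχb p₁)).exists_inverse
  -- the support of `g`
  have hg0 : ∀ᶠ i in 𝓕, ∀ y, ρ < ‖y‖ → g i y = 0 := by
    filter_upwards [hid, hw12] with i h1 h2 y hy
    have hvy : v i y = 0 := by simp [hv, h1 y hy]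
    have := h2.1 y
    simp only [Function.comp_apply, hvy, map_zero, add_zero] at this
    simp [hgdef, this, hvy]
  -- closedness
  have hsymm : ∀ᶠ i in 𝓕, ∀ y a b, stdForm F (fderiv ℝ (g i) y a) b =
      stdForm F (fderiv ℝ (g i) y b) a := by
    filter_upwards [hsymp, hw12, hsm.smooth, hw.smooth] with i h1 h2 h3 h4 y a b
    have hwd : HasFDerivAt (w i) (fderiv ℝ (w i) y) y :=
      (h4.differentiable (by simp) y).hasFDerivAt
    have hvd : HasFDerivAt (v i) (fderiv ℝ (v i) (w i y)) (w i y) :=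
      (h3.differentiable (by simp) _).hasFDerivAt
    have hgd : HasFDerivAt (g i) ((fderiv ℝ (v i) (w i y)).comp (fderiv ℝ (w i) y)) y :=
      hvd.comp y hwd
    have hφ : fderiv ℝ (φ i) (w i y) = fderiv ℝ (v i) (w i y) + ContinuousLinearMap.id ℝ _ := by
      have : φ i = fun z => v i z + z := by ext1 z; simp [hv]
      rw [this]
      exact (hvd.add (hasFDerivAt_id _)).fderiv
    have hθ : ∀ a, a = fderiv ℝ (w i) y a + J₀ (fderiv ℝ (v i) (w i y) (fderiv ℝ (w i) y a)) := by
      have e1 : HasFDerivAt (fun y => w i y + J₀ (v i (w i y))) (fderiv ℝ (w i) y +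
        J₀.comp ((fderiv ℝ (v i) (w i y)).comp (fderiv ℝ (w i) y))) y :=
        hwd.add (J₀.hasFDerivAt.comp y hgd)
      have e2 : HasFDerivAt (fun y => w i y + J₀ (v i (w i y))) (ContinuousLinearMap.id ℝ _) y := by
        have : (fun y => w i y + J₀ (v i (w i y))) = id := funext h2.2
        rw [this]
        exact hasFDerivAt_id y
      intro a
      exact DFunLike.congr_fun (e2.unique e1) a
    -- The vectors `a` and `b` are the mixed components of `a'`, `b'` and their images under the
    -- derivative of `φ i`; this is what `hθ` says. In these terms invariance of the form is the
    -- symmetry of the derivative of the 1-form.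
    have e := stdForm_generating_symm (h1 (w i y) (fderiv ℝ (w i) y a) (fderiv ℝ (w i) y b))
    rw [hgd.fderiv]
    set a' := fderiv ℝ (w i) y a
    set b' := fderiv ℝ (w i) y b
    have ha := hθ a
    have hb := hθ b
    simp only [hφ, add_apply, ContinuousLinearMap.id_apply, add_sub_cancel_right] at e
    simp only [ContinuousLinearMap.comp_apply]
    convert e using 2
    · rw [hb]
      refine Prod.ext ?_ ?_
      · simp [J₀]; rfl
      · simp [J₀, add_comm]; rfl
    · rw [ha]
      refine Prod.ext ?_ ?_
      · simp [J₀]; rfl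
      · simp [J₀, add_comm]; rfl
  have hα : SmallFam 𝓕 fun i => stdForm F ∘ g i := hg.clm_comp (G := F × F →L[ℝ] ℝ) (stdForm F)
  have hex : ∀ᶠ i in 𝓕, ∃ S : F × F → ℝ, (∀ x, HasFDerivAt S (stdForm F (g i x)) x) ∧
      ∀ x, ρ < ‖x‖ → S x = 0 := by
    filter_upwards [hα.smooth, hsymm, hg0, hg.smooth] with i h1 h2 h3 h4
    refine exists_primitive_eq_zero_outside (α := fun x => stdForm F (g i x)) hrank hρ h1
      (fun x a b => ?_) (fun x hx => by simp [h3 x hx])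
    have : HasFDerivAt (fun x => stdForm F (g i x)) ((stdForm F).comp (fderiv ℝ (g i) x)) x :=
      HasFDerivAt.comp (G := F × F →L[ℝ] ℝ) x (stdForm F).hasFDerivAt
        (h4.differentiable (by simp) x).hasFDerivAt
    rw [this.fderiv]
    exact h2 x a b
  obtain ⟨S, hS⟩ := hex.choice
  have hSsmall : SmallFam 𝓕 S := by
    refine SmallFam.of_fderiv (hS.mono fun i hi x => (hi.1 x).differentiableAt) (fun ε hε => ?_) ?_
    · filter_upwards [hS, hα.small 0 (ε / (3 * ρ)) (by positivity)] with i h1 h2 x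
      have := norm_le_of_primitive hrank hρ h1.1 h1.2 (C := ε / (3 * ρ)) (by positivity)
        (fun x => by simpa using h2 x) x
      refine this.trans (le_of_eq ?_)
      field_simp
    · have heq : ∀ᶠ i in 𝓕, fderiv ℝ (S i) = stdForm F ∘ g i :=
        hS.mono fun i hi => funext fun x => (hi.1 x).fderiv
      refine ⟨?_, fun j ε hε => ?_⟩
      · filter_upwards [heq, hα.smooth] with i h1 h2
        rwa [h1]
      · filter_upwards [heq, hα.small j ε hε] with i h1 h2
        rwa [h1]
  -- The Hamilton–Jacobi equation: the Hamiltonian is the time derivative of the generating function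
  -- `χ(t) S`, expressed in the current point.
  refine ⟨fun i x => deriv χ (p₁ x) • S i (p₂ (T i x)), ?_, ?_⟩
  · exact (hSsmall.comp (hT.clm_comp p₂)).smul hχ'p (exists_bound_comp_clm hχ' hχ'b p₁)
  · filter_upwards [hT12, hX12, hg0, hsymm, hS, hg.smooth, hT.smooth, hX.smooth, hw12] with
      i h1 h2 h3 h4 h5 h6 h7 h8 h9
    refine ⟨fun t z htz => ?_, fun z₀ => ?_⟩
    · rcases htz with ht | hz
      · have : deriv χ (p₁ (t, z)) = 0 := hχ'0 t ht
        rw [this, zero_smul]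
      · have := h1.1 (t, z)
        have e : (g i ∘ p₂) (t, z) = 0 := h3 z hz
        simp only [Function.comp_apply] at e
        simp only [Function.comp_apply, e, map_zero, smul_zero, add_zero] at this
        rw [this]
        have : S i (p₂ (t, z)) = 0 := h5.2 z hz
        rw [this, smul_zero]
    · obtain ⟨c, c', Y, hc, hY, hcc⟩ := generating_curve hχ hχ' h6 h5.1 h4 h7 h8 h1.1 h1.2 h2.1 h2.2
        h3 z₀
      refine ⟨c, c', ?_, ?_, hcc⟩
      · rw [hc, hχ0 _ (by linarith), zero_smul, add_zero]
      -- At time `δ` the step equals one and the mixed coordinates are `z₀ + J₀ (v z₀)`, where `g`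
      -- is the full displacement `φ z₀ - z₀`.
      · have h10 : g i (z₀ + J₀ (v i z₀)) = v i z₀ := by
          have := h9.1 z₀
          simp only [Function.comp_apply] at this
          simp [hgdef, this]
        have := hY δ (z₀ + J₀ (v i z₀)) (by
          rw [h10, hχ1 _ (by linarith), one_smul, add_assoc, add_eq_left]
          simp [J₀])
        rw [hc, this, h10, hχ1 _ (by linarith), one_smul]
        simp [hv]

end Generating


/-! ### Charts with values in arbitrary normed spaces -/

section SmoothCharts

/-- `D` is a diffeomorphism between open subsets of `M` and of the normed space `V`. -/
structure SmoothChart (d : ℕ) {M : Type*} [TopologicalSpace M] [ChartedSpace (Euc d) M]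
    {V : Type*} [NormedAddCommGroup V] [NormedSpace ℝ V] (D : OpenPartialHomeomorph M V) :
    Prop where
  smooth : ContMDiffOn (𝓡 d) 𝓘(ℝ, V) ∞ D D.source
  smooth_symm : ContMDiffOn 𝓘(ℝ, V) (𝓡 d) ∞ D.symm D.target

variable {d : ℕ} {M : Type*} [TopologicalSpace M] [ChartedSpace (Euc d) M] [IsManifold (𝓡 d) ∞ M]
  {V : Type*} [NormedAddCommGroup V] [NormedSpace ℝ V]

theorem smoothChart_of_mem_maximalAtlas {e : OpenPartialHomeomorph M (Euc d)}
    (he : e ∈ IsManifold.maximalAtlas (𝓡 d) ∞ M) :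
    SmoothChart d e :=
  ⟨contMDiffOn_of_mem_maximalAtlas he, contMDiffOn_symm_of_mem_maximalAtlas he⟩

variable {D : OpenPartialHomeomorph M V}

theorem SmoothChart.mdifferentiable (hD : SmoothChart d D) : D.MDifferentiable (𝓡 d) 𝓘(ℝ, V) :=
  ⟨hD.smooth.mdifferentiableOn (by simp), hD.smooth_symm.mdifferentiableOn (by simp)⟩

theorem SmoothChart.hasMFDerivAt_symm (hD : SmoothChart d D) {w : V} (hw : w ∈ D.target) :
    HasMFDerivAt 𝓘(ℝ, V) (𝓡 d) D.symm w (mfderiv 𝓘(ℝ, V) (𝓡 d) D.symm w) :=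
  (hD.mdifferentiable.mdifferentiableAt_symm hw).hasMFDerivAt

theorem SmoothChart.hasMFDerivAt (hD : SmoothChart d D) {x : M} (hx : x ∈ D.source) :
    HasMFDerivAt (𝓡 d) 𝓘(ℝ, V) D x (mfderiv (𝓡 d) 𝓘(ℝ, V) D x) :=
  (hD.mdifferentiable.mdifferentiableAt hx).hasMFDerivAt

/-- The derivative of a chart, with values in the model space. -/
def chartDeriv (d : ℕ) {M : Type*} [TopologicalSpace M] [ChartedSpace (Euc d) M]
    {V : Type*} [NormedAddCommGroup V] [NormedSpace ℝ V] (D : OpenPartialHomeomorph M V) (x : M) :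
    TangentSpace (𝓡 d) x →L[ℝ] V :=
  mfderiv (𝓡 d) 𝓘(ℝ, V) D x

/-- The derivative of the inverse of a chart, defined on the model space. -/
def chartDerivSymm (d : ℕ) {M : Type*} [TopologicalSpace M] [ChartedSpace (Euc d) M]
    {V : Type*} [NormedAddCommGroup V] [NormedSpace ℝ V] (D : OpenPartialHomeomorph M V) (w : V) :
    V →L[ℝ] TangentSpace (𝓡 d) (D.symm w) :=
  mfderiv 𝓘(ℝ, V) (𝓡 d) D.symm w

theorem SmoothChart.derivSymm_deriv (hD : SmoothChart d D) {w : V} (hw : w ∈ D.target)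
    (u : TangentSpace (𝓡 d) (D.symm w)) :
    chartDerivSymm d D w (chartDeriv d D (D.symm w) u) = u := by
  have := hD.mdifferentiable.symm_comp_deriv (D.map_target hw)
  rw [D.right_inv hw] at this
  exact DFunLike.congr_fun this u

theorem SmoothChart.deriv_derivSymm (hD : SmoothChart d D) {w : V} (hw : w ∈ D.target)
    (a : V) : chartDeriv d D (D.symm w) (chartDerivSymm d D w a) = a := by
  have := hD.mdifferentiable.comp_symm_deriv hw
  exact DFunLike.congr_fun this a

theorem SmoothChart.trans {V' : Type*} [NormedAddCommGroup V'] [NormedSpace ℝ V']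
    (hD : SmoothChart d D) {G : OpenPartialHomeomorph V V'} (hG : ContDiffOn ℝ ∞ G G.source)
    (hG' : ContDiffOn ℝ ∞ G.symm G.target) : SmoothChart d (D.trans G) := by
  refine ⟨?_, ?_⟩
  · refine (hG.contMDiffOn).comp (hD.smooth.mono ?_) ?_
    · intro x hx
      simp only [mfld_simps] at hx
      exact hx.1
    · intro x hx
      simp only [mfld_simps] at hx
      exact hx.2
  · refine hD.smooth_symm.comp (hG'.contMDiffOn.mono ?_) ?_
    · intro x hx
      simp only [mfld_simps] at hx
      exact hx.1
    · intro x hx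
      simp only [mfld_simps] at hx
      exact hx.2

/-- A curve in the image of a chart that solves the equation in the chart is an integral curve. -/
theorem SmoothChart.isMIntegralCurveOn (hD : SmoothChart d D)
    {X : (x : M) → TangentSpace (𝓡 d) x} {c c' : ℝ → V} {s : Set ℝ}
    (hc : ∀ t ∈ s, HasDerivWithinAt c (c' t) s t) (ht : ∀ t ∈ s, c t ∈ D.target)
    (hX : ∀ t ∈ s, X (D.symm (c t)) = chartDerivSymm d D (c t) (c' t)) :
    IsMIntegralCurveOn (fun t => D.symm (c t)) X s := by
  intro t hts
  have h1 : HasMFDerivWithinAt 𝓘(ℝ, ℝ) 𝓘(ℝ, V) c s t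
      ((1 : ℝ →L[ℝ] ℝ).smulRight (c' t)) := (hc t hts).hasFDerivWithinAt.hasMFDerivWithinAt
  have h2 := (hD.hasMFDerivAt_symm (ht t hts)).comp_hasMFDerivWithinAt t h1
  rw [hX t hts]
  refine h2.congr_mfderiv ?_
  ext
  change chartDerivSymm d D (c t) ((1 : ℝ) • c' t) = (1 : ℝ) • chartDerivSymm d D (c t) (c' t)
  rw [one_smul, one_smul]

end SmoothCharts

/-! ### Gluing, prolongation and uniqueness of integral curves -/

section Curves

variable {d : ℕ} {M : Type*} [TopologicalSpace M] [ChartedSpace (Euc d) M]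
  {X : (x : M) → TangentSpace (𝓡 d) x}

theorem IsMIntegralCurveOn.congr_of_eqOn {γ γ' : ℝ → M} {s : Set ℝ} (h : IsMIntegralCurveOn γ X s)
    (he : EqOn γ' γ s) : IsMIntegralCurveOn γ' X s := by
  intro t ht
  have := (h t ht).congr_mono (f₁ := γ') (t := s) he (he ht) subset_rfl
  rw [he ht]
  exact this

theorem IsMIntegralCurveOn.congr_field {Y : (x : M) → TangentSpace (𝓡 d) x} {γ : ℝ → M} {s : Set ℝ}
    (h : IsMIntegralCurveOn γ X s) (he : ∀ t ∈ s, X (γ t) = Y (γ t)) :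
    IsMIntegralCurveOn γ Y s := by
  intro t ht
  rw [← he t ht]
  exact h t ht

/-- Concatenation of integral curves. -/
theorem IsMIntegralCurveOn.union_Icc {γ : ℝ → M} {a b c : ℝ} (hab : a ≤ b) (hbc : b ≤ c)
    (h₁ : IsMIntegralCurveOn γ X (Icc a b)) (h₂ : IsMIntegralCurveOn γ X (Icc b c)) :
    IsMIntegralCurveOn γ X (Icc a c) := by
  intro t ht
  rcases lt_trichotomy t b with h | rfl | h
  · refine (h₁ t ⟨ht.1, h.le⟩).mono_of_mem_nhdsWithin ?_
    filter_upwards [self_mem_nhdsWithin, mem_nhdsWithin_of_mem_nhds (gt_mem_nhds h)] with y hy hyb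
    exact ⟨hy.1, hyb.le⟩
  · have := (h₁ t ⟨hab, le_rfl⟩).union (h₂ t ⟨le_rfl, hbc⟩)
    rwa [Icc_union_Icc_eq_Icc hab hbc] at this
  · refine (h₂ t ⟨h.le, ht.2⟩).mono_of_mem_nhdsWithin ?_
    filter_upwards [self_mem_nhdsWithin, mem_nhdsWithin_of_mem_nhds (lt_mem_nhds h)] with y hy hyb
    exact ⟨hyb.le, hy.2⟩

theorem IsMIntegralCurveOn.glue {γ₁ γ₂ : ℝ → M} {a b c : ℝ} (hab : a ≤ b) (hbc : b ≤ c)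
    (h₁ : IsMIntegralCurveOn γ₁ X (Icc a b)) (h₂ : IsMIntegralCurveOn γ₂ X (Icc b c))
    (hb : γ₁ b = γ₂ b) :
    IsMIntegralCurveOn (fun t => if t ≤ b then γ₁ t else γ₂ t) X (Icc a c) := by
  refine IsMIntegralCurveOn.union_Icc hab hbc (IsMIntegralCurveOn.congr_of_eqOn h₁ fun t ht => ?_)
    (IsMIntegralCurveOn.congr_of_eqOn h₂ fun t ht => ?_)
  · exact if_pos ht.2
  · rcases eq_or_lt_of_le ht.1 with rfl | h
    · simp [hb]
    · exact if_neg (not_le.2 h)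

theorem IsMIntegralCurveOn.shift {γ : ℝ → M} {a b : ℝ} (h : IsMIntegralCurveOn γ X (Icc a b))
    (r : ℝ) : IsMIntegralCurveOn (fun t => γ (t + r)) X (Icc (a - r) (b - r)) := by
  have := h.comp_add r
  refine IsMIntegralCurveOn.mono this fun t ht => ?_
  exact ⟨by linarith [ht.1], by linarith [ht.2]⟩

variable [IsManifold (𝓡 d) ∞ M] [T2Space M]

theorem exists_extension_right (hX : ContMDiff (𝓡 d) (𝓡 d).tangent 1
      (fun x => (⟨x, X x⟩ : TangentBundle (𝓡 d) M))) {γ : ℝ → M} {a b : ℝ} (hab : a ≤ b)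
    (h : IsMIntegralCurveOn γ X (Icc a b)) :
    ∃ ε > 0, ∃ γ', IsMIntegralCurveOn γ' X (Icc a (b + ε)) ∧ EqOn γ' γ (Icc a b) := by
  have : IsManifold (𝓡 d) 1 M := IsManifold.of_le (n := ∞) (by simp)
  obtain ⟨β, hβ, hβX⟩ := exists_isMIntegralCurveAt_of_contMDiffAt_boundaryless b (hX (γ b))
  obtain ⟨ε, hε, hβε⟩ := isMIntegralCurveAt_iff'.1 hβX
  refine ⟨ε / 2, by positivity, fun t => if t ≤ b then γ t else β t,
    IsMIntegralCurveOn.glue hab (by linarith) h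
      (IsMIntegralCurveOn.mono hβε fun t ht => ?_) hβ.symm,
    fun t ht => if_pos ht.2⟩
  rw [Real.ball_eq_Ioo]
  exact ⟨by linarith [ht.1], by linarith [ht.2]⟩

theorem exists_extension_left (hX : ContMDiff (𝓡 d) (𝓡 d).tangent 1
      (fun x => (⟨x, X x⟩ : TangentBundle (𝓡 d) M))) {γ : ℝ → M} {a b : ℝ} (hab : a ≤ b)
    (h : IsMIntegralCurveOn γ X (Icc a b)) :
    ∃ ε > 0, ∃ γ', IsMIntegralCurveOn γ' X (Icc (a - ε) b) ∧ EqOn γ' γ (Icc a b) := by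
  have : IsManifold (𝓡 d) 1 M := IsManifold.of_le (n := ∞) (by simp)
  obtain ⟨β, hβ, hβX⟩ := exists_isMIntegralCurveAt_of_contMDiffAt_boundaryless a (hX (γ a))
  obtain ⟨ε, hε, hβε⟩ := isMIntegralCurveAt_iff'.1 hβX
  refine ⟨ε / 2, by positivity, fun t => if t ≤ a then β t else γ t,
    IsMIntegralCurveOn.glue (by linarith) hab
      (IsMIntegralCurveOn.mono hβε fun t ht => ?_) h hβ,
    fun t ht => ?_⟩
  · rw [Real.ball_eq_Ioo]
    exact ⟨by linarith [ht.1], by linarith [ht.2]⟩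
  · rcases eq_or_lt_of_le ht.1 with rfl | h
    · simp [hβ]
    · exact if_neg (not_le.2 h)

/-- Arcs on closed intervals are prolonged a little on both sides, so that uniqueness on open
intervals applies to them. -/
theorem exists_extension (hX : ContMDiff (𝓡 d) (𝓡 d).tangent 1
      (fun x => (⟨x, X x⟩ : TangentBundle (𝓡 d) M))) {γ : ℝ → M} {a b : ℝ} (hab : a ≤ b)
    (h : IsMIntegralCurveOn γ X (Icc a b)) :
    ∃ ε > 0, ∃ γ', IsMIntegralCurveOn γ' X (Icc (a - ε) (b + ε)) ∧ EqOn γ' γ (Icc a b) := by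
  obtain ⟨ε₁, h₁, γ₁, hγ₁, he₁⟩ := exists_extension_right hX hab h
  obtain ⟨ε₂, h₂, γ₂, hγ₂, he₂⟩ := exists_extension_left hX (by linarith) hγ₁
  refine ⟨min ε₁ ε₂, lt_min h₁ h₂, γ₂, IsMIntegralCurveOn.mono hγ₂ fun t ht => ⟨?_, ?_⟩,
    fun t ht => ?_⟩
  · linarith [ht.1, min_le_right ε₁ ε₂]
  · linarith [ht.2, min_le_left ε₁ ε₂]
  · rw [he₂ ⟨ht.1, by linarith [ht.2]⟩, he₁ ht]

/-- Uniqueness of integral curves on closed intervals. -/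
theorem eqOn_Icc_of_isMIntegralCurveOn (hX : ContMDiff (𝓡 d) (𝓡 d).tangent 1
      (fun x => (⟨x, X x⟩ : TangentBundle (𝓡 d) M))) {γ γ' : ℝ → M} {a b t₀ : ℝ}
    (h : IsMIntegralCurveOn γ X (Icc a b)) (h' : IsMIntegralCurveOn γ' X (Icc a b))
    (ht₀ : t₀ ∈ Icc a b) (heq : γ t₀ = γ' t₀) : EqOn γ γ' (Icc a b) := by
  have : IsManifold (𝓡 d) 1 M := IsManifold.of_le (n := ∞) (by simp)
  have hab : a ≤ b := ht₀.1.trans ht₀.2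
  obtain ⟨ε₁, h₁, γ₁, hγ₁, he₁⟩ := exists_extension hX hab h
  obtain ⟨ε₂, h₂, γ₂, hγ₂, he₂⟩ := exists_extension hX hab h'
  have hm : 0 < min ε₁ ε₂ := lt_min h₁ h₂
  have key := isMIntegralCurveOn_Ioo_eqOn_of_contMDiff_boundaryless (γ := γ₁) (γ' := γ₂)
    (a := a - min ε₁ ε₂) (b := b + min ε₁ ε₂) (t₀ := t₀)
    ⟨by linarith [ht₀.1], by linarith [ht₀.2]⟩ hX
    (IsMIntegralCurveOn.mono hγ₁ fun t ht => ⟨by linarith [ht.1, min_le_left ε₁ ε₂],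
      by linarith [ht.2, min_le_left ε₁ ε₂]⟩)
    (IsMIntegralCurveOn.mono hγ₂ fun t ht => ⟨by linarith [ht.1, min_le_right ε₁ ε₂],
      by linarith [ht.2, min_le_right ε₁ ε₂]⟩)
    (by rw [he₁ ht₀, he₂ ht₀, heq])
  intro t ht
  rw [← he₁ ht, ← he₂ ht]
  exact key ⟨by linarith [ht.1], by linarith [ht.2]⟩

end Curves


/-! ### Alternating forms as bilinear forms -/

section Bilinear

variable {E : Type*} [NormedAddCommGroup E] [NormedSpace ℝ E]

/-- An alternating 2-form as a bilinear form. -/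
def altBilin (η : E [⋀^Fin 2]→L[ℝ] ℝ) : E →L[ℝ] E →L[ℝ] ℝ :=
  (ContinuousLinearMap.compL ℝ E (E [⋀^Fin 0]→L[ℝ] ℝ) ℝ
    (ContinuousAlternatingMap.apply ℝ E ℝ ![])).comp
      ((ContinuousAlternatingMap.curryLeftLI (𝕜 := ℝ) (E := E) (F := ℝ)
        (n := 0)).toContinuousLinearMap.comp η.curryLeft)

theorem altBilin_apply (η : E [⋀^Fin 2]→L[ℝ] ℝ) (u v : E) : altBilin η u v = η ![u, v] := rfl

theorem alternating_two_swap (η : E [⋀^Fin 2]→L[ℝ] ℝ) (u v : E) : η ![u, v] = -η ![v, u] := by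
  have h := η.map_swap ![v, u] (i := 0) (j := 1) (by decide)
  rw [show η ![v, u] = η.toAlternatingMap ![v, u] from rfl, ← h]
  change η _ = η _
  congr 1
  ext i
  fin_cases i <;> rfl

/-- The exterior derivative is an alternating sum of directional derivatives; antisymmetry in the
middle term turns it into the cyclic sum of `IsClosedForm`. -/
theorem isClosedForm_of_extDeriv [FiniteDimensional ℝ E] {η : E → E [⋀^Fin 2]→L[ℝ] ℝ} {O : Set E}
    (hO : IsOpen O) (hη : ContDiffOn ℝ ∞ η O) (hc : ∀ z ∈ O, extDeriv η z = 0) {z₀ : E}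
    (hz₀ : z₀ ∈ O) : IsClosedForm (fun z => altBilin (η z)) z₀ := by
  have hd : ∀ z ∈ O, ContDiffAt ℝ ∞ η z := fun z hz => hη.contDiffAt (hO.mem_nhds hz)
  have hv : ∀ z ∈ O, ∀ v : Fin 2 → E, ContDiffAt ℝ ∞ (fun y => η y v) z := fun z hz v =>
    (ContinuousAlternatingMap.apply ℝ E ℝ v).contDiff.contDiffAt.comp z (hd z hz)
  have hs : ∀ z ∈ O, ContDiffAt ℝ ∞ (fun z => altBilin (η z)) z := fun z hz =>
    contDiffAt_bilinear fun u v => hv z hz ![u, v]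
  have hmem := hO.mem_nhds hz₀
  refine ⟨by filter_upwards [hmem] with z hz using hs z hz,
    Eventually.of_forall fun z u v => alternating_two_swap _ _ _, ?_⟩
  filter_upwards [hmem] with z hz u v w
  have hdiff : DifferentiableAt ℝ (fun z => altBilin (η z)) z := (hs z hz).differentiableAt (by simp)
  rw [fderiv_bilinear_apply hdiff, fderiv_bilinear_apply hdiff, fderiv_bilinear_apply hdiff]
  have h := extDeriv_apply ((hd z hz).differentiableAt (by simp)) ![u, v, w]
  rw [hc z hz, Fin.sum_univ_three] at h
  have e0 : (0 : Fin 3).removeNth ![u, v, w] = ![v, w] := by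
    ext i : 1; fin_cases i <;> rfl
  have e1 : (1 : Fin 3).removeNth ![u, v, w] = ![u, w] := by
    ext i : 1; fin_cases i <;> rfl
  have e2 : (2 : Fin 3).removeNth ![u, v, w] = ![u, v] := by
    ext i : 1; fin_cases i <;> rfl
  rw [e0, e1, e2] at h
  have e3 : (fun y => altBilin (η y) w u) = fun y => -(η y ![u, w]) :=
    funext fun y => alternating_two_swap _ _ _
  rw [e3, fderiv_fun_neg]
  simp only [altBilin_apply]
  simp at h
  simp only [neg_apply]
  linarith

end Bilinear

/-! ### The Hamiltonian field in charts and conservation of energy -/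

section Hamiltonian

variable {d : ℕ} {M : Type*} [TopologicalSpace M] [ChartedSpace (Euc d) M] [IsManifold (𝓡 d) ∞ M]
  (σ : SymplecticForm d M) {H : M → ℝ}

/-- The coordinate expression of a symplectic form, as a field of bilinear forms. -/
def chartForm (e : OpenPartialHomeomorph M (Euc d)) (z : Euc d) : Euc d →L[ℝ] Euc d →L[ℝ] ℝ :=
  altBilin (pullback σ.form e.symm z)

theorem pair_comp {E F : Type*} (f : E → F) (u v : E) : f ∘ ![u, v] = ![f u, f v] := by
  ext i
  fin_cases i <;> rfl

theorem chartForm_apply (e : OpenPartialHomeomorph M (Euc d)) (z u v : Euc d) :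
    chartForm σ e z u v = σ.form (e.symm z)
      ![chartDerivSymm d e z u, chartDerivSymm d e z v] := by
  change σ.form (e.symm z) (chartDerivSymm d e z ∘ ![u, v]) = _
  rw [pair_comp]

theorem isClosedForm_chartForm {e : OpenPartialHomeomorph M (Euc d)}
    (he : e ∈ IsManifold.maximalAtlas (𝓡 d) ∞ M) {z : Euc d} (hz : z ∈ e.target) :
    IsClosedForm (chartForm σ e) z :=
  isClosedForm_of_extDeriv e.open_target (σ.smooth e he) (σ.closed e he) hz

theorem form_self (x : M) (u : TangentSpace (𝓡 d) x) : σ.form x ![u, u] = 0 :=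
  (σ.form x).map_eq_zero_of_eq _ (i := 0) (j := 1) rfl (by decide)

theorem form_sub_left (x : M) (u u' v : TangentSpace (𝓡 d) x) :
    σ.form x ![u - u', v] = σ.form x ![u, v] - σ.form x ![u', v] := by
  have := (altBilin (E := Euc d) (σ.form x)).map_sub u u'
  exact DFunLike.congr_fun this v

theorem eq_of_form_eq (x : M) (u u' : TangentSpace (𝓡 d) x)
    (h : ∀ v, σ.form x ![u, v] = σ.form x ![u', v]) : u = u' := by
  rw [← sub_eq_zero]
  refine σ.nondegenerate x _ fun v => ?_
  rw [form_sub_left, h v, sub_self]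

theorem chartForm_nondegenerate {e : OpenPartialHomeomorph M (Euc d)}
    (he : e ∈ IsManifold.maximalAtlas (𝓡 d) ∞ M) {z : Euc d} (hz : z ∈ e.target) (u : Euc d)
    (hu : chartForm σ e z u = 0) : u = 0 := by
  have hD := smoothChart_of_mem_maximalAtlas he
  have h0 : chartDerivSymm d e z u = 0 := by
    refine σ.nondegenerate _ _ fun v => ?_
    have := chartForm_apply σ e z u (chartDeriv d e (e.symm z) v)
    rw [hD.derivSymm_deriv hz, hu] at this
    exact this.symm
  rw [← hD.deriv_derivSymm hz u, h0]
  exact map_zero _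

/-- The Hamiltonian field in a chart. -/
theorem chartForm_hamiltonianField {e : OpenPartialHomeomorph M (Euc d)}
    (he : e ∈ IsManifold.maximalAtlas (𝓡 d) ∞ M) {z : Euc d} (hz : z ∈ e.target)
    (hH : MDifferentiableAt (𝓡 d) 𝓘(ℝ, ℝ) H (e.symm z)) :
    chartForm σ e z (chartDeriv d e (e.symm z) (hamiltonianField σ H (e.symm z))) =
      fderiv ℝ (H ∘ e.symm) z := by
  have hD := smoothChart_of_mem_maximalAtlas he
  ext v
  rw [chartForm_apply, hD.derivSymm_deriv hz, hamiltonianField_spec, ← mfderiv_eq_fderiv]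
  exact (DFunLike.congr_fun (hH.hasMFDerivAt.comp z (hD.hasMFDerivAt_symm hz)).mfderiv v).symm

/-- In a chart the field solves a nondegenerate linear equation with smooth coefficients and right
side. Class `C^1` is all that uniqueness of trajectories requires. -/
theorem contMDiff_hamiltonianField (hH : ContMDiff (𝓡 d) 𝓘(ℝ, ℝ) ∞ H) :
    ContMDiff (𝓡 d) (𝓡 d).tangent 1
      (fun x => (⟨x, hamiltonianField σ H x⟩ : TangentBundle (𝓡 d) M)) := by
  have : IsManifold (𝓡 d) (1 + 1) M := IsManifold.of_le (n := ∞)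
    (by exact WithTop.coe_le_coe.2 (le_top : (1 + 1 : ℕ∞) ≤ ⊤))
  have : IsManifold (𝓡 d) 1 M := IsManifold.of_le (n := ∞) (by simp)
  intro x₀
  set e := chartAt (Euc d) x₀ with he_def
  have he : e ∈ IsManifold.maximalAtlas (𝓡 d) ∞ M := IsManifold.chart_mem_maximalAtlas x₀
  have hx₀ : x₀ ∈ e.source := mem_chart_source _ x₀
  have hz₀ : e x₀ ∈ e.target := e.map_source hx₀
  have hHd : ∀ x, MDifferentiableAt (𝓡 d) 𝓘(ℝ, ℝ) H x := fun x =>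
    (hH x).mdifferentiableAt (by simp)
  have hHe : ∀ z ∈ e.target, ContDiffAt ℝ ∞ (H ∘ e.symm) z := fun z hz => by
    rw [← contMDiffAt_iff_contDiffAt]
    exact (hH _).comp z
      ((smoothChart_of_mem_maximalAtlas he).smooth_symm.contMDiffAt (e.open_target.mem_nhds hz))
  obtain ⟨X, hX, hXe⟩ := exists_dual_field (isClosedForm_chartForm σ he hz₀).smooth
    (α := fderiv ℝ (H ∘ e.symm))
    (by filter_upwards [e.open_target.mem_nhds hz₀] with z hz
        exact (hHe z hz).fderiv_right (by simp))
    (chartForm_nondegenerate σ he hz₀)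
  rw [Bundle.contMDiffAt_section]
  have hcont : ContinuousAt e x₀ := e.continuousAt hx₀
  have h1 : ContMDiffAt (𝓡 d) 𝓘(ℝ, Euc d) 1 (fun x => X (e x)) x₀ := by
    have h2 : ContMDiffAt (𝓡 d) 𝓘(ℝ, Euc d) ∞ (X ∘ e) x₀ :=
      (hX.self_of_nhds.contMDiffAt).comp x₀
        ((smoothChart_of_mem_maximalAtlas he).smooth.contMDiffAt (e.open_source.mem_nhds hx₀))
    exact h2.of_le (by simp)
  refine h1.congr_of_eventuallyEq ?_
  filter_upwards [e.open_source.mem_nhds hx₀, hcont.tendsto.eventually hXe] with x hx hxe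
  have hz : e x ∈ e.target := e.map_source hx
  have h3 := chartForm_hamiltonianField σ he hz (hHd _)
  rw [e.left_inv hx] at h3
  have h4 : chartDeriv d e x (hamiltonianField σ H x) = X (e x) := by
    have h5 : chartForm σ e (e x) (chartDeriv d e x (hamiltonianField σ H x) -
        X (e x)) = 0 := by
      rw [map_sub, hxe, sub_eq_zero]
      exact h3
    exact sub_eq_zero.1 (chartForm_nondegenerate σ he hz _ h5)
  rw [← h4]
  have h6 := TangentBundle.continuousLinearMapAt_trivializationAt (I := 𝓡 d) (x₀ := x₀) hx
  have h7 : extChartAt (𝓡 d) x₀ = (e : M → Euc d) := by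
    ext1 y
    simp [he_def]
  rw [h7] at h6
  have h8 := DFunLike.congr_fun h6 (hamiltonianField σ H x)
  rw [Bundle.Trivialization.continuousLinearMapAt_apply, Bundle.Trivialization.linearMapAt_apply,
    if_pos (by simpa using hx)] at h8
  exact h8

/-- Conservation of energy. -/
theorem hamiltonian_eq_of_isMIntegralCurveOn (hH : ContMDiff (𝓡 d) 𝓘(ℝ, ℝ) ∞ H) {γ : ℝ → M}
    {a b : ℝ} (hγ : IsMIntegralCurveOn γ (hamiltonianField σ H) (Icc a b)) {t : ℝ}
    (ht : t ∈ Icc a b) : H (γ t) = H (γ a) := by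
  have hd : ∀ t ∈ Icc a b, HasDerivWithinAt (H ∘ γ) 0 (Icc a b) t := by
    intro t ht
    have h1 := (((hH (γ t)).mdifferentiableAt (by simp)).hasMFDerivAt).comp_hasMFDerivWithinAt t
      (hγ t ht)
    have h2 : HasFDerivWithinAt (H ∘ γ) (0 : ℝ →L[ℝ] ℝ) (Icc a b) t := by
      refine (h1.congr_mfderiv (f₁' := (0 : ℝ →L[ℝ] ℝ)) ?_).hasFDerivWithinAt
      ext
      change mfderiv (𝓡 d) 𝓘(ℝ, ℝ) H (γ t) ((1 : ℝ) • hamiltonianField σ H (γ t)) = (0 : ℝ)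
      rw [one_smul, ← hamiltonianField_spec, form_self]
    simpa using h2.hasDerivWithinAt
  refine constant_of_has_deriv_right_zero (f := H ∘ γ)
    (fun t ht => (hd t ht).continuousWithinAt) (fun t ht => ?_) t ht
  exact (hd t ⟨ht.1, ht.2.le⟩).mono_of_mem_nhdsWithin (Icc_mem_nhdsGE_of_mem ht)

end Hamiltonian


/-! ### Darboux coordinates as maps to the model space -/

/-- The model space of Darboux charts: time and energy, and the remaining coordinates. -/
abbrev DarbouxModel (m : ℕ) : Type := (ℝ × ℝ) × (Euc m × Euc m)

/-- The standard symplectic form on the model space. -/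
def modelForm {m : ℕ} (a b : DarbouxModel m) : ℝ :=
  a.1.1 * b.1.2 - a.1.2 * b.1.1 + stdForm (Euc m) a.2 b.2

section Straightening

variable {E : Type} [NormedAddCommGroup E] [NormedSpace ℝ E] [FiniteDimensional ℝ E] {m : ℕ}

/-- The map to the model space given by Darboux coordinates. -/
def darbouxMap (q p : Fin (m + 1) → E → ℝ) (z₀ z : E) : DarbouxModel m :=
  ((q 0 z, p 0 z), (WithLp.toLp 2 fun i => q i.succ z - q i.succ z₀,
    WithLp.toLp 2 fun i => p i.succ z - p i.succ z₀))

theorem contDiffAt_darbouxMap {q p : Fin (m + 1) → E → ℝ} {z₀ z : E}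
    (hq : ∀ i, ContDiffAt ℝ ∞ (q i) z) (hp : ∀ i, ContDiffAt ℝ ∞ (p i) z) :
    ContDiffAt ℝ ∞ (darbouxMap q p z₀) z := by
  refine ((hq 0).prodMk (hp 0)).prodMk (ContDiffAt.prodMk ?_ ?_)
  · exact contDiffAt_euclidean.2 fun i => (hq i.succ).sub contDiffAt_const
  · exact contDiffAt_euclidean.2 fun i => (hp i.succ).sub contDiffAt_const

/-- The components of the derivative are the differentials of the coordinate functions, and the
subtracted constants do not matter for these. -/
theorem modelForm_fderiv_darbouxMap {q p : Fin (m + 1) → E → ℝ} {z₀ z : E}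
    (hq : ∀ i, ContDiffAt ℝ ∞ (q i) z) (hp : ∀ i, ContDiffAt ℝ ∞ (p i) z) (u v : E) :
    modelForm (fderiv ℝ (darbouxMap q p z₀) z u) (fderiv ℝ (darbouxMap q p z₀) z v) =
      ∑ i, wedge (q i) (p i) z u v := by
  have hd : HasFDerivAt (darbouxMap q p z₀) (fderiv ℝ (darbouxMap q p z₀) z) z :=
    ((contDiffAt_darbouxMap hq hp).differentiableAt (by simp)).hasFDerivAt
  have key : ∀ (L : DarbouxModel m →L[ℝ] ℝ) (f : E → ℝ), (∀ y, L (darbouxMap q p z₀ y) = f y) →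
      ∀ u, L (fderiv ℝ (darbouxMap q p z₀) z u) = fderiv ℝ f z u := fun L f hL u => by
    have h1 := L.hasFDerivAt.comp z hd
    have h2 : L ∘ darbouxMap q p z₀ = f := funext hL
    rw [h2] at h1
    rw [h1.fderiv]
    rfl
  have hq0 : ∀ u, (fderiv ℝ (darbouxMap q p z₀) z u).1.1 = fderiv ℝ (q 0) z u :=
    key ((ContinuousLinearMap.fst ℝ ℝ ℝ).comp (ContinuousLinearMap.fst ℝ (ℝ × ℝ) _)) _ fun y => rfl
  have hp0 : ∀ u, (fderiv ℝ (darbouxMap q p z₀) z u).1.2 = fderiv ℝ (p 0) z u :=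
    key ((ContinuousLinearMap.snd ℝ ℝ ℝ).comp (ContinuousLinearMap.fst ℝ (ℝ × ℝ) _)) _ fun y => rfl
  have hqs : ∀ i u, (fderiv ℝ (darbouxMap q p z₀) z u).2.1 i = fderiv ℝ (q i.succ) z u := by
    intro i u
    have := key ((EuclideanSpace.proj i).comp ((ContinuousLinearMap.fst ℝ (Euc m) (Euc m)).comp
      (ContinuousLinearMap.snd ℝ (ℝ × ℝ) _))) (fun z => q i.succ z - q i.succ z₀) (fun y => rfl) u
    rw [fderiv_sub_const] at this
    exact this
  have hps : ∀ i u, (fderiv ℝ (darbouxMap q p z₀) z u).2.2 i = fderiv ℝ (p i.succ) z u := by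
    intro i u
    have := key ((EuclideanSpace.proj i).comp ((ContinuousLinearMap.snd ℝ (Euc m) (Euc m)).comp
      (ContinuousLinearMap.snd ℝ (ℝ × ℝ) _))) (fun z => p i.succ z - p i.succ z₀) (fun y => rfl) u
    rw [fderiv_sub_const] at this
    exact this
  rw [modelForm, stdForm_apply, Fin.sum_univ_succ, hq0, hp0, hq0, hp0, PiLp.inner_apply,
    PiLp.inner_apply, ← Finset.sum_sub_distrib]
  simp only [wedge_apply, hqs, hps, RCLike.inner_apply, conj_trivial]
  congr 1
  refine Finset.sum_congr rfl fun i _ => ?_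
  ring

/-- The derivative at `z₀` pulls the model form back to a nondegenerate form, hence is injective,
hence an isomorphism by dimension; the inverse function theorem does the rest. -/
theorem exists_darboux_diffeo (hE : Module.finrank ℝ E = 2 * (m + 1))
    {θ : E → E →L[ℝ] E →L[ℝ] ℝ} {z₀ : E} (hnd : ∀ u, θ z₀ u = 0 → u = 0)
    {q p : Fin (m + 1) → E → ℝ} (hqp : HasDarboux (m + 1) θ z₀ q p) {s : Set E} (hs : s ∈ 𝓝 z₀) :
    ∃ G : OpenPartialHomeomorph E (DarbouxModel m), z₀ ∈ G.source ∧ G.source ⊆ s ∧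
      (∀ z, G z = darbouxMap q p z₀ z) ∧ ContDiffOn ℝ ∞ G G.source ∧
      ContDiffOn ℝ ∞ G.symm G.target ∧
      ∀ z ∈ G.source, ∀ u v, θ z u v = modelForm (fderiv ℝ G z u) (fderiv ℝ G z v) := by
  have : CompleteSpace E := FiniteDimensional.complete ℝ E
  obtain ⟨hq, hp, hform⟩ := hqp
  have hall : ∀ᶠ z in 𝓝 z₀, (∀ i, ContDiffAt ℝ ∞ (q i) z) ∧ (∀ i, ContDiffAt ℝ ∞ (p i) z) ∧
      ∀ u v, θ z u v = ∑ i, wedge (q i) (p i) z u v :=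
    (eventually_all.2 hq).and ((eventually_all.2 hp).and hform)
  have hsm : ∀ᶠ z in 𝓝 z₀, ContDiffAt ℝ ∞ (darbouxMap q p z₀) z :=
    hall.mono fun z hz => contDiffAt_darbouxMap hz.1 hz.2.1
  have hmf : ∀ᶠ z in 𝓝 z₀, ∀ u v, θ z u v =
      modelForm (fderiv ℝ (darbouxMap q p z₀) z u) (fderiv ℝ (darbouxMap q p z₀) z v) :=
    hall.mono fun z hz u v => by rw [hz.2.2, modelForm_fderiv_darbouxMap hz.1 hz.2.1]
  set L := fderiv ℝ (darbouxMap q p z₀) z₀ with hL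
  have hinj : Function.Injective L := by
    rw [injective_iff_map_eq_zero]
    intro u hu
    refine hnd u ?_
    ext v
    rw [hmf.self_of_nhds u v, ← hL, hu]
    simp [modelForm]
  have hfr : Module.finrank ℝ E = Module.finrank ℝ (DarbouxModel m) := by
    rw [hE]
    simp
    ring
  let e₀ : E ≃L[ℝ] DarbouxModel m := (LinearEquiv.ofInjectiveOfFinrankEq
    (L : E →ₗ[ℝ] DarbouxModel m) hinj hfr).toContinuousLinearEquiv
  have he₀ : (e₀ : E →L[ℝ] DarbouxModel m) = L := by
    ext1 u
    rfl
  obtain ⟨G, hz₀, hGs, hG, hG1, hG2⟩ := exists_openPartialHomeomorph hsm e₀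
    (by rw [he₀]; exact (hsm.self_of_nhds.differentiableAt (by simp)).hasFDerivAt)
    (inter_mem hs hmf)
  refine ⟨G, hz₀, fun z hz => (hGs hz).1, fun z => by rw [hG], hG1, hG2, fun z hz u v => ?_⟩
  rw [hG]
  exact (hGs hz).2 u v

end Straightening

/-! ### Darboux charts on the manifold -/

section Charts

variable {d m : ℕ} {M : Type*} [TopologicalSpace M] [ChartedSpace (Euc d) M]
  [IsManifold (𝓡 d) ∞ M]

theorem SmoothChart.fderiv_comp_symm {V : Type*} [NormedAddCommGroup V] [NormedSpace ℝ V]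
    {D : OpenPartialHomeomorph M V} (hD : SmoothChart d D) {f : M → ℝ} {w : V} (hw : w ∈ D.target)
    (hf : MDifferentiableAt (𝓡 d) 𝓘(ℝ, ℝ) f (D.symm w)) (a : V) :
    fderiv ℝ (f ∘ D.symm) w a = mfderiv (𝓡 d) 𝓘(ℝ, ℝ) f (D.symm w) (chartDerivSymm d D w a) := by
  rw [← mfderiv_eq_fderiv]
  exact DFunLike.congr_fun (hf.hasMFDerivAt.comp w (hD.hasMFDerivAt_symm hw)).mfderiv a

/-- A chart in which the symplectic form is standard and `H - h` is the energy coordinate. -/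
structure IsDarbouxChart (σ : SymplecticForm d M) (H : M → ℝ) (h : ℝ)
    (D : OpenPartialHomeomorph M (DarbouxModel m)) : Prop extends SmoothChart d D where
  symp : ∀ w ∈ D.target, ∀ a b, σ.form (D.symm w)
    ![chartDerivSymm d D w a, chartDerivSymm d D w b] = modelForm a b
  ham : ∀ w ∈ D.target, H (D.symm w) = h + w.1.2

variable {σ : SymplecticForm d M} {H : M → ℝ} {h : ℝ}
  {D : OpenPartialHomeomorph M (DarbouxModel m)}

theorem IsDarbouxChart.ham_apply (hD : IsDarbouxChart σ H h D) {x : M} (hx : x ∈ D.source) :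
    H x = h + (D x).1.2 := by
  have := hD.ham (D x) (D.map_source hx)
  rwa [D.left_inv hx] at this

theorem IsDarbouxChart.form_eq (hD : IsDarbouxChart σ H h D) {x : M} (hx : x ∈ D.source)
    (u v : TangentSpace (𝓡 d) x) :
    σ.form x ![u, v] = modelForm (chartDeriv d D x u) (chartDeriv d D x v) := by
  obtain ⟨w, hw, rfl⟩ : ∃ w ∈ D.target, x = D.symm w := ⟨D x, D.map_source hx, (D.left_inv hx).symm⟩
  rw [← hD.symp w hw, hD.derivSymm_deriv hw, hD.derivSymm_deriv hw]

/-- The Hamiltonian vector field in a Darboux chart. -/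
theorem IsDarbouxChart.hamiltonianField_eq (hD : IsDarbouxChart σ H h D) {H' : M → ℝ}
    {w : DarbouxModel m} (hw : w ∈ D.target) {G : DarbouxModel m → ℝ}
    (hH' : MDifferentiableAt (𝓡 d) 𝓘(ℝ, ℝ) H' (D.symm w)) (hG : H' ∘ D.symm =ᶠ[𝓝 w] G)
    {a : DarbouxModel m} (ha : ∀ b, modelForm a b = fderiv ℝ G w b) :
    hamiltonianField σ H' (D.symm w) = chartDerivSymm d D w a := by
  refine eq_of_form_eq σ _ _ _ fun v => ?_
  rw [hamiltonianField_spec, ← hD.derivSymm_deriv hw v, hD.symp w hw, ha, ← hG.fderiv_eq]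
  exact (hD.fderiv_comp_symm hw hH' _).symm

theorem IsDarbouxChart.hamiltonianField_self (hD : IsDarbouxChart σ H h D)
    (hH : ContMDiff (𝓡 d) 𝓘(ℝ, ℝ) ∞ H) {w : DarbouxModel m} (hw : w ∈ D.target) :
    hamiltonianField σ H (D.symm w) = chartDerivSymm d D w ((1, 0), 0) := by
  refine hD.hamiltonianField_eq hw ((hH _).mdifferentiableAt (by simp)) (G := fun w => h + w.1.2)
    ?_ fun b => ?_
  · filter_upwards [D.open_target.mem_nhds hw] with y hy using hD.ham y hy
  · have : HasFDerivAt (fun w : DarbouxModel m => h + w.1.2)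
        ((ContinuousLinearMap.snd ℝ ℝ ℝ).comp (ContinuousLinearMap.fst ℝ (ℝ × ℝ) _)) w :=
      ((ContinuousLinearMap.snd ℝ ℝ ℝ).comp
        (ContinuousLinearMap.fst ℝ (ℝ × ℝ) (Euc m × Euc m))).hasFDerivAt.const_add h
    rw [this.fderiv]
    simp [modelForm]

/-- Integral curves of the Hamiltonian field are straight lines in a Darboux chart. -/
theorem IsDarbouxChart.isMIntegralCurveOn_line (hD : IsDarbouxChart σ H h D)
    (hH : ContMDiff (𝓡 d) 𝓘(ℝ, ℝ) ∞ H) (w : DarbouxModel m) (r : ℝ) {s : Set ℝ}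
    (hs : ∀ t ∈ s, w + (t - r) • ((1, 0), 0) ∈ D.target) :
    IsMIntegralCurveOn (fun t => D.symm (w + (t - r) • ((1, 0), 0))) (hamiltonianField σ H) s := by
  refine hD.isMIntegralCurveOn (c := fun t => w + (t - r) • ((1, 0), 0))
    (c' := fun _ => ((1, 0), 0)) (fun t ht => ?_) hs fun t ht => hD.hamiltonianField_self hH (hs t ht)
  have : HasDerivAt (fun t : ℝ => t - r) 1 t := (hasDerivAt_id t).sub_const r
  simpa using ((this.smul_const (((1, 0), 0) : DarbouxModel m)).const_add w).hasDerivWithinAt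

/-- This is `darboux_step` in a chart of the manifold, with `H` as the prescribed momentum and `f`
as the defining function of the section. Time zero in the new chart is the section, and the momentum
is the energy above `H x₁`. -/
theorem exists_darbouxChart (hd : d = 2 * (m + 1)) (hH : ContMDiff (𝓡 d) 𝓘(ℝ, ℝ) ∞ H) {x₁ : M}
    {f : M → ℝ} {O : Set M} (hO : IsOpen O) (hxO : x₁ ∈ O) (hf : ContMDiffOn (𝓡 d) 𝓘(ℝ, ℝ) ∞ f O)
    (hf0 : f x₁ = 0) (hfX : mfderiv (𝓡 d) 𝓘(ℝ, ℝ) f x₁ (hamiltonianField σ H x₁) ≠ 0) :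
    ∃ D : OpenPartialHomeomorph M (DarbouxModel m), IsDarbouxChart σ H (H x₁) D ∧ x₁ ∈ D.source ∧
      D.source ⊆ O ∧ D x₁ = 0 ∧ ∀ x ∈ D.source, f x = 0 ↔ (D x).1.1 = 0 := by
  set e := chartAt (Euc d) x₁ with he_def
  have he : e ∈ IsManifold.maximalAtlas (𝓡 d) ∞ M := IsManifold.chart_mem_maximalAtlas x₁
  have heS := smoothChart_of_mem_maximalAtlas he
  have hx₁ : x₁ ∈ e.source := mem_chart_source _ x₁
  set z₀ := e x₁ with hz₀_def
  have hz₀ : z₀ ∈ e.target := e.map_source hx₁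
  have hes : e.symm z₀ = x₁ := e.left_inv hx₁
  have hsymm : ContinuousAt e.symm z₀ := e.symm.continuousAt hz₀
  have hfs : ∀ᶠ z in 𝓝 z₀, z ∈ e.target ∧ e.symm z ∈ O := by
    refine Filter.Eventually.and (e.open_target.mem_nhds hz₀) ?_
    exact hsymm.tendsto.eventually_mem (by rw [hes]; exact hO.mem_nhds hxO)
  have hesm : ∀ z ∈ e.target, ContMDiffAt 𝓘(ℝ, Euc d) (𝓡 d) ∞ e.symm z := fun z hz =>
    heS.smooth_symm.contMDiffAt (e.open_target.mem_nhds hz)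
  have hHe : ∀ᶠ z in 𝓝 z₀, ContDiffAt ℝ ∞ (H ∘ e.symm) z := by
    filter_upwards [hfs] with z hz
    rw [← contMDiffAt_iff_contDiffAt]
    exact (hH _).comp z (hesm z hz.1)
  have hfe : ∀ᶠ z in 𝓝 z₀, ContDiffAt ℝ ∞ (f ∘ e.symm) z := by
    filter_upwards [hfs] with z hz
    rw [← contMDiffAt_iff_contDiffAt]
    exact (hf.contMDiffAt (hO.mem_nhds hz.2)).comp z (hesm z hz.1)
  have hY1 := chartForm_hamiltonianField σ he hz₀ ((hH _).mdifferentiableAt (by simp))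
  have hY2 : fderiv ℝ (f ∘ e.symm) z₀
      (chartDeriv d e (e.symm z₀) (hamiltonianField σ H (e.symm z₀))) ≠ 0 := by
    have hfd : MDifferentiableAt (𝓡 d) 𝓘(ℝ, ℝ) f (e.symm z₀) := by
      rw [hes]
      exact (hf.contMDiffAt (hO.mem_nhds hxO)).mdifferentiableAt (by simp)
    have h1 := heS.fderiv_comp_symm hz₀ hfd
      (chartDeriv d e (e.symm z₀) (hamiltonianField σ H (e.symm z₀)))
    rw [heS.derivSymm_deriv hz₀] at h1
    rw [← hes] at hfX
    exact fun h2 => hfX (h1.symm.trans h2)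
  have hfin : Module.finrank ℝ (Euc d) = 2 * (m + 1) := by simp [hd]
  have hnd := chartForm_nondegenerate σ he hz₀
  obtain ⟨q, p, hqp, hp0, hfq⟩ := darboux_step (darboux m) hfin (isClosedForm_chartForm σ he hz₀)
    hnd hHe hfe (by rw [Function.comp_apply, hes, hf0]) ⟨_, hY1, hY2⟩
  obtain ⟨G, hGz, hGs, hG, hG1, hG2, hGf⟩ := exists_darboux_diffeo hfin hnd hqp
    (inter_mem hfs hfq)
  have hq0 : q 0 z₀ = 0 := by
    have := hfq.self_of_nhds.1 (by rw [Function.comp_apply, hes, hf0])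
    exact this
  refine ⟨e.trans G, ⟨heS.trans hG1 hG2, ?_, ?_⟩, ?_, ?_, ?_, ?_⟩
  · intro w hw a b
    have hwG : w ∈ G.target := hw.1
    have hwe : G.symm w ∈ e.target := hw.2
    have hGd : HasFDerivAt G.symm (fderiv ℝ G.symm w) w :=
      ((hG2.contDiffAt (G.open_target.mem_nhds hwG)).differentiableAt (by simp)).hasFDerivAt
    have hGd' : HasFDerivAt G (fderiv ℝ G (G.symm w)) (G.symm w) :=
      ((hG1.contDiffAt (G.open_source.mem_nhds (G.map_target hwG))).differentiableAt
        (by simp)).hasFDerivAt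
    have hinv : ∀ a, fderiv ℝ G (G.symm w) (fderiv ℝ G.symm w a) = a := by
      have h1 : HasFDerivAt (G ∘ G.symm) (ContinuousLinearMap.id ℝ _) w := by
        refine (hasFDerivAt_id w).congr_of_eventuallyEq ?_
        filter_upwards [G.open_target.mem_nhds hwG] with y hy using G.right_inv hy
      exact fun a => DFunLike.congr_fun ((hGd'.comp w hGd).unique h1) a
    have hder : ∀ a, chartDerivSymm d (e.trans G) w a =
        chartDerivSymm d e (G.symm w) (fderiv ℝ G.symm w a) := fun a =>
      DFunLike.congr_fun ((heS.hasMFDerivAt_symm hwe).comp w hGd.hasMFDerivAt).mfderiv a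
    rw [hder, hder]
    have := chartForm_apply σ e (G.symm w) (fderiv ℝ G.symm w a) (fderiv ℝ G.symm w b)
    rw [hGf _ (G.map_target hwG), hinv, hinv] at this
    exact this.symm
  · intro w hw
    have hwG : w ∈ G.target := hw.1
    have h1 := hG (G.symm w)
    rw [G.right_inv hwG] at h1
    have h2 : w.1.2 = p 0 (G.symm w) := congrArg (fun y => y.1.2) h1
    rw [h2, hp0]
    change H (e.symm (G.symm w)) = _
    simp [hes]
  · exact ⟨hx₁, hGz⟩
  · intro x hx
    have hxe : x ∈ e.source := hx.1
    have h1 : e.symm (e x) ∈ O := (hGs hx.2).1.2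
    rwa [e.left_inv hxe] at h1
  · change G (e x₁) = 0
    rw [hG]
    have : p 0 z₀ = 0 := by rw [hp0]; simp
    simp only [darbouxMap, ← hz₀_def, hq0, this, sub_self]
    rfl
  · intro x hx
    have hxe : x ∈ e.source := hx.1
    have h1 : (f ∘ e.symm) (e x) = 0 ↔ q 0 (e x) = 0 := (hGs hx.2).2
    rw [Function.comp_apply, e.left_inv hxe] at h1
    rw [h1]
    change _ ↔ (G (e x)).1.1 = 0
    rw [hG]
    rfl

end Charts


/-! ### Transport of Darboux charts along a trajectory -/

section Propagation

variable {d m : ℕ} {M : Type*} [TopologicalSpace M] [ChartedSpace (Euc d) M]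
  [IsManifold (𝓡 d) ∞ M] {σ : SymplecticForm d M} {H : M → ℝ} {h : ℝ}

/-- The time direction of the model space. -/
def timeDir (m : ℕ) : DarbouxModel m := ((1, 0), 0)

theorem norm_timeDir : ‖timeDir m‖ = 1 := by
  simp [timeDir, Prod.norm_def]

/-- Where the field does not vanish there is always a transverse hypersurface: the hyperplane
orthogonal to the field in a chart. -/
theorem exists_darbouxChart_of_ne_zero (hd : d = 2 * (m + 1)) (hH : ContMDiff (𝓡 d) 𝓘(ℝ, ℝ) ∞ H)
    {x₁ : M} (hX : hamiltonianField σ H x₁ ≠ 0) :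
    ∃ D : OpenPartialHomeomorph M (DarbouxModel m), IsDarbouxChart σ H (H x₁) D ∧ x₁ ∈ D.source ∧
      D x₁ = 0 := by
  set e := chartAt (Euc d) x₁ with he_def
  have he : e ∈ IsManifold.maximalAtlas (𝓡 d) ∞ M := IsManifold.chart_mem_maximalAtlas x₁
  have heS := smoothChart_of_mem_maximalAtlas he
  have hx₁ : x₁ ∈ e.source := mem_chart_source _ x₁
  set v : Euc d := chartDeriv d e x₁ (hamiltonianField σ H x₁) with hv
  have hv0 : v ≠ 0 := by
    intro h0
    have h1 := heS.derivSymm_deriv (e.map_source hx₁)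
    rw [e.left_inv hx₁] at h1
    exact hX ((h1 (hamiltonianField σ H x₁)).symm.trans
      ((congrArg (chartDerivSymm d e (e x₁)) h0).trans (map_zero _)))
  have hesm : ContMDiffOn (𝓡 d) 𝓘(ℝ, ℝ) ∞ (fun x => innerSL ℝ v (e x - e x₁)) e.source := by
    have h1 : ContDiff ℝ ∞ (fun z : Euc d => innerSL ℝ v (z - e x₁)) := by fun_prop
    exact h1.contMDiff.comp_contMDiffOn heS.smooth
  obtain ⟨D, hD, hxD, -, hD0, -⟩ := exists_darbouxChart (σ := σ) hd hH e.open_source hx₁ hesm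
    (by simp) (by
      have h1 : HasFDerivAt (fun z : Euc d => innerSL ℝ v (z - e x₁)) (innerSL ℝ v) (e x₁) :=
        (innerSL ℝ v).hasFDerivAt.comp (e x₁) ((hasFDerivAt_id _).sub_const _)
      have h2 := (h1.hasMFDerivAt.comp x₁ (heS.hasMFDerivAt hx₁)).mfderiv
      intro h3
      have h4 : mfderiv (𝓡 d) 𝓘(ℝ, ℝ) (fun x => innerSL ℝ v (e x - e x₁)) x₁
        (hamiltonianField σ H x₁) = innerSL ℝ v v := DFunLike.congr_fun h2 _
      have h5 : innerSL ℝ v v = (0 : ℝ) := h4.symm.trans h3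
      rw [innerSL_apply_apply, inner_self_eq_zero] at h5
      exact hv0 h5)
  exact ⟨D, hD, hxD, hD0⟩

variable [T2Space M]

/-- A trajectory that meets an equilibrium is constant by uniqueness. -/
theorem hamiltonianField_ne_zero_of_isMIntegralCurveOn (hH : ContMDiff (𝓡 d) 𝓘(ℝ, ℝ) ∞ H)
    {γ : ℝ → M} {a b : ℝ} (hγ : IsMIntegralCurveOn γ (hamiltonianField σ H) (Icc a b))
    (ha : hamiltonianField σ H (γ a) ≠ 0) {t : ℝ} (ht : t ∈ Icc a b) :
    hamiltonianField σ H (γ t) ≠ 0 := by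
  intro h0
  have hconst : IsMIntegralCurveOn (fun _ => γ t) (hamiltonianField σ H) (Icc a b) := by
    intro s _
    refine (hasMFDerivWithinAt_const (γ t) _ s).congr_mfderiv ?_
    change _ = (1 : ℝ →L[ℝ] ℝ).smulRight (hamiltonianField σ H (γ t))
    rw [h0]
    exact (ContinuousLinearMap.smulRight_zero _).symm
  have := eqOn_Icc_of_isMIntegralCurveOn (contMDiff_hamiltonianField σ hH) hγ hconst ht rfl
    ⟨le_rfl, ht.1.trans ht.2⟩
  rw [this] at ha
  exact ha h0

/-- The flow for time `s` is the identity in the charts `D₀` and `D`, near the origin. -/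
def Propagates (σ : SymplecticForm d M) (H : M → ℝ) (D₀ D : OpenPartialHomeomorph M (DarbouxModel m))
    (s : ℝ) : Prop :=
  ∀ᶠ w in 𝓝 (0 : DarbouxModel m), w ∈ D.target ∧ ∃ c : ℝ → M, c 0 = D₀.symm w ∧ c s = D.symm w ∧
    IsMIntegralCurveOn c (hamiltonianField σ H) (Icc 0 s)

theorem contDiff_translate (a : DarbouxModel m) :
    ContDiff ℝ ∞ (fun w : DarbouxModel m => w + a) := by fun_prop

theorem SmoothChart.contDiffOn_transition {V V' : Type*} [NormedAddCommGroup V] [NormedSpace ℝ V]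
    [NormedAddCommGroup V'] [NormedSpace ℝ V'] {D : OpenPartialHomeomorph M V}
    {D' : OpenPartialHomeomorph M V'} (hD : SmoothChart d D) (hD' : SmoothChart d D') :
    ContDiffOn ℝ ∞ (D.symm.trans D') (D.symm.trans D').source := by
  rw [← contMDiffOn_iff_contDiffOn]
  refine hD'.smooth.comp (hD.smooth_symm.mono fun w hw => ?_) fun w hw => ?_
  · exact hw.1
  · exact hw.2

/-- The new chart is `D₁` composed with the backward flow over the time `s₂ - s₁`. Inside the flow
box `D` this flow is a translation, which preserves the model form and the energy, so no global flow
has to be constructed. -/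
theorem propagates_step (hH : ContMDiff (𝓡 d) 𝓘(ℝ, ℝ) ∞ H)
    {D₀ D₁ D : OpenPartialHomeomorph M (DarbouxModel m)} {x₁ : M} {s₁ s₂ : ℝ} (hs : s₁ ≤ s₂)
    (hs₁ : 0 ≤ s₁)
    (hD₁ : IsDarbouxChart σ H h D₁) (hx₁ : x₁ ∈ D₁.source) (hD₁0 : D₁ x₁ = 0)
    (hp : Propagates σ H D₀ D₁ s₁) (hD : IsDarbouxChart σ H h D) (hxD : x₁ ∈ D.source) {r : ℝ}
    (hr : 0 < r) (hline : ∀ t ∈ Icc 0 (s₂ - s₁), ∀ w, ‖w - D x₁‖ < r → w + t • timeDir m ∈ D.target) :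
    ∃ D₂ : OpenPartialHomeomorph M (DarbouxModel m), IsDarbouxChart σ H h D₂ ∧
      D.symm (D x₁ + (s₂ - s₁) • timeDir m) ∈ D₂.source ∧
      D₂ (D.symm (D x₁ + (s₂ - s₁) • timeDir m)) = 0 ∧ Propagates σ H D₀ D₂ s₂ := by
  set a := (s₂ - s₁) • timeDir m with ha
  set Tr : OpenPartialHomeomorph (DarbouxModel m) (DarbouxModel m) :=
    (Homeomorph.addRight (-a)).toOpenPartialHomeomorph with hTr
  set G := Tr.trans (D.symm.trans D₁) with hG
  have hTrs : ∀ w, Tr.symm w = w + a := fun w => by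
    change w + - -a = w + a
    rw [neg_neg]
  have hTra : ∀ w, Tr w = w + -a := fun w => rfl
  have h1 : ContDiffOn ℝ ∞ G G.source := by
    refine (hD.toSmoothChart.contDiffOn_transition hD₁.toSmoothChart).comp
      (contDiff_translate (-a)).contDiffOn fun w hw => hw.2
  have h2 : ContDiffOn ℝ ∞ G.symm G.target := by
    refine (contDiff_translate a).comp_contDiffOn
      ((hD₁.toSmoothChart.contDiffOn_transition hD.toSmoothChart).mono fun w hw => ?_) |>.congr
      fun w hw => ?_
    · have := hw.1
      simpa only [mfld_simps] using this
    · exact hTrs _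
  have hsymm : ∀ w, (D.trans G).symm w = D.symm (D (D₁.symm w) + a) := fun w => by
    change D.symm (Tr.symm _) = _
    rw [hTrs]
    rfl
  have htarget : ∀ w, w ∈ (D.trans G).target ↔
      w ∈ D₁.target ∧ D₁.symm w ∈ D.source ∧ D (D₁.symm w) + a ∈ D.target := fun w => by
    have e1 : w ∈ (D.trans G).target ↔
        ((w ∈ D₁.target ∧ D₁.symm w ∈ D.source) ∧ True) ∧ Tr.symm (D (D₁.symm w)) ∈ D.target := by
      simp only [hG, mfld_simps, hTr]
    rw [e1, hTrs]
    tauto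
  have hmem0 : D x₁ + a ∈ D.target := hline _ ⟨by linarith, le_rfl⟩ _ (by simpa using hr)
  have hsrc : D.symm (D x₁ + a) ∈ (D.trans G).source := by
    refine ⟨D.map_target hmem0, ?_⟩
    change D (D.symm (D x₁ + a)) ∈ G.source
    rw [D.right_inv hmem0]
    refine ⟨trivial, ?_, ?_⟩
    · change D x₁ + a + -a ∈ D.target
      rw [add_neg_cancel_right]
      exact D.map_source hxD
    · change D.symm (D x₁ + a + -a) ∈ D₁.source
      rwa [add_neg_cancel_right, D.left_inv hxD]
  have hchart : SmoothChart d (D.trans G) := hD.toSmoothChart.trans h1 h2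
  refine ⟨D.trans G, ⟨hchart, fun w hw b b' => ?_, fun w hw => ?_⟩, hsrc, ?_, ?_⟩
  · obtain ⟨hw1, hw2, hw3⟩ := (htarget w).1 hw
    have hder : ∀ b, chartDerivSymm d (D.trans G) w b = chartDerivSymm d D (D (D₁.symm w) + a)
        (chartDeriv d D (D₁.symm w) (chartDerivSymm d D₁ w b)) := by
      have e1 := (hD.toSmoothChart.hasMFDerivAt hw2).comp w
        (hD₁.toSmoothChart.hasMFDerivAt_symm hw1)
      have e2 : HasMFDerivAt 𝓘(ℝ, DarbouxModel m) 𝓘(ℝ, DarbouxModel m)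
          (fun w : DarbouxModel m => w + a) (D (D₁.symm w))
          (ContinuousLinearMap.id ℝ (DarbouxModel m)) :=
        ((hasFDerivAt_id _).add_const a).hasMFDerivAt
      have e3 := (hD.toSmoothChart.hasMFDerivAt_symm hw3).comp w (e2.comp w e1)
      have e4 : ((D.trans G).symm : DarbouxModel m → M) =
          D.symm ∘ (fun w => w + a) ∘ D ∘ D₁.symm := funext hsymm
      have e5 : HasMFDerivAt 𝓘(ℝ, DarbouxModel m) (𝓡 d) (D.trans G).symm w _ := e4 ▸ e3
      exact fun b => DFunLike.congr_fun e5.mfderiv b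
    have e6 := hD.symp _ hw3 (chartDeriv d D (D₁.symm w) (chartDerivSymm d D₁ w b))
      (chartDeriv d D (D₁.symm w) (chartDerivSymm d D₁ w b'))
    rw [← hD.form_eq hw2, hD₁.symp w hw1] at e6
    rw [hder, hder, ← e6]
    -- The base points on the two sides are equal only by `hsymm`; as all tangent spaces are the
    -- same model space, the forms are compared as functions on it.
    exact congrFun (congrArg (fun x => fun v : Fin 2 → Euc d => (σ.form x : (Fin 2 → Euc d) → ℝ) v)
      (hsymm w)) _
  · obtain ⟨hw1, hw2, hw3⟩ := (htarget w).1 hw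
    rw [hsymm, hD.ham _ hw3, ← hD₁.ham w hw1, hD.ham_apply hw2]
    simp [ha, timeDir]
  · change D₁ (D.symm (D (D.symm (D x₁ + a)) + -a)) = 0
    rw [D.right_inv hmem0, add_neg_cancel_right, D.left_inv hxD, hD₁0]
  · have hs0 : D₁.symm 0 = x₁ := by rw [← hD₁0, D₁.left_inv hx₁]
    have h0t : (0 : DarbouxModel m) ∈ D₁.target := by rw [← hD₁0]; exact D₁.map_source hx₁
    have hc : ContinuousAt D₁.symm 0 := D₁.symm.continuousAt h0t
    have hcD : ContinuousAt D (D₁.symm 0) := by rw [hs0]; exact D.continuousAt hxD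
    have hcc : ContinuousAt (fun w => D (D₁.symm w)) 0 := ContinuousAt.comp hcD hc
    have hnear : ∀ᶠ w in 𝓝 (0 : DarbouxModel m), D₁.symm w ∈ D.source ∧
        ‖D (D₁.symm w) - D x₁‖ < r := by
      refine (hc.tendsto.eventually_mem (by rw [hs0]; exact D.open_source.mem_nhds hxD)).and ?_
      have := hcc.tendsto.eventually_mem (Metric.ball_mem_nhds _ hr)
      simpa only [hs0, mem_ball_iff_norm] using this
    filter_upwards [hp, hnear] with w ⟨hw1, c, hc0, hc1, hcX⟩ ⟨hw2, hw3⟩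
    refine ⟨(htarget w).2 ⟨hw1, hw2, hline _ ⟨by linarith, le_rfl⟩ _ hw3⟩, ?_⟩
    have hl := hD.isMIntegralCurveOn_line hH (D (D₁.symm w)) s₁ (s := Icc s₁ s₂) fun t ht =>
      hline (t - s₁) ⟨by linarith [ht.1], by linarith [ht.2]⟩ _ hw3
    refine ⟨_, ?_, ?_, IsMIntegralCurveOn.glue hs₁ hs hcX hl ?_⟩
    · simp [hs₁, hc0]
    · rcases eq_or_lt_of_le hs with rfl | hlt
      · rw [if_pos le_rfl, hc1, hsymm]
        simp [ha, D.left_inv hw2]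
      · rw [if_neg (not_le.2 hlt), hsymm]
        rfl
    · simp [hc1, D.left_inv hw2]

/-- The compact arc is covered by finitely many flow boxes, and the initial chart is carried from
one to the next. -/
theorem exists_propagates (hd : d = 2 * (m + 1)) (hH : ContMDiff (𝓡 d) 𝓘(ℝ, ℝ) ∞ H) {γ : ℝ → M}
    {T : ℝ} (hγ : IsMIntegralCurveOn γ (hamiltonianField σ H) (Icc 0 T))
    (hX : hamiltonianField σ H (γ 0) ≠ 0) {D₀ : OpenPartialHomeomorph M (DarbouxModel m)}
    (hD₀ : IsDarbouxChart σ H (H (γ 0)) D₀) (h0 : γ 0 ∈ D₀.source) (hD₀0 : D₀ (γ 0) = 0) :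
    ∀ s ∈ Icc 0 T, ∃ D : OpenPartialHomeomorph M (DarbouxModel m),
      IsDarbouxChart σ H (H (γ 0)) D ∧ γ s ∈ D.source ∧ D (γ s) = 0 ∧ Propagates σ H D₀ D s := by
  have hXs := contMDiff_hamiltonianField σ hH
  -- flow boxes along the arc
  have hbox : ∀ s ∈ Icc 0 T, ∃ (D : OpenPartialHomeomorph M (DarbouxModel m)) (r : ℝ),
      IsDarbouxChart σ H (H (γ 0)) D ∧ 0 < r ∧ Metric.ball 0 r ⊆ D.target ∧
      ∀ t ∈ Icc 0 T, |t - s| < r / 2 → γ t = D.symm ((t - s) • timeDir m) := by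
    intro s hs
    obtain ⟨D, hD, hsD, hDs⟩ := exists_darbouxChart_of_ne_zero (σ := σ) hd hH
      (hamiltonianField_ne_zero_of_isMIntegralCurveOn hH hγ hX hs)
    rw [hamiltonian_eq_of_isMIntegralCurveOn σ hH hγ hs] at hD
    have h0t : (0 : DarbouxModel m) ∈ D.target := by rw [← hDs]; exact D.map_source hsD
    obtain ⟨r, hr, hball⟩ := Metric.isOpen_iff.1 D.open_target 0 h0t
    refine ⟨D, r, hD, hr, hball, fun t ht hts => ?_⟩
    have hl := hD.isMIntegralCurveOn_line hH 0 s (s := Icc (max 0 (s - r / 2)) (min T (s + r / 2)))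
      fun t ht => hball (by
        rw [mem_ball_zero_iff, zero_add, norm_smul]
        change _ * ‖timeDir m‖ < r
        rw [norm_timeDir, mul_one, Real.norm_eq_abs, abs_lt]
        have h1 := (le_max_right _ _).trans ht.1
        have h2 := ht.2.trans (min_le_right _ _)
        constructor <;> linarith)
    have hms : s ∈ Icc (max 0 (s - r / 2)) (min T (s + r / 2)) :=
      ⟨max_le hs.1 (by linarith), le_min hs.2 (by linarith)⟩
    have := eqOn_Icc_of_isMIntegralCurveOn hXs (IsMIntegralCurveOn.mono hγ
      (Icc_subset_Icc (le_max_left _ _) (min_le_left _ _))) hl hms (by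
        have h1 : D.symm 0 = γ s := by rw [← hDs, D.left_inv hsD]
        simp [h1])
    rw [abs_lt] at hts
    rw [this ⟨max_le ht.1 (by linarith), le_min ht.2 (by linarith)⟩]
    change D.symm (0 + (t - s) • timeDir m) = _
    rw [zero_add]
  have : Nonempty (OpenPartialHomeomorph M (DarbouxModel m)) := ⟨D₀⟩
  choose! Ds r hDs hr hball hline using hbox
  intro s hs
  obtain ⟨u, hu0, hum, ⟨N, hN⟩, hucov⟩ := exists_monotone_Icc_subset_open_cover_Icc (a := 0) (b := s)
    hs.1 (ι := Icc (0 : ℝ) T) 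
    (c := fun i => (Subtype.val ⁻¹' Metric.ball (i : ℝ) (r i / 2) : Set (Icc 0 s)))
    (fun i => Metric.isOpen_ball.preimage continuous_subtype_val)
    (fun x _ => mem_iUnion.2 ⟨⟨x.1, x.2.1, x.2.2.trans hs.2⟩, by
      simpa using half_pos (hr _ ⟨x.2.1, x.2.2.trans hs.2⟩)⟩)
  have key : ∀ k : ℕ, ∃ D : OpenPartialHomeomorph M (DarbouxModel m),
      IsDarbouxChart σ H (H (γ 0)) D ∧ γ (u k) ∈ D.source ∧ D (γ (u k)) = 0 ∧
        Propagates σ H D₀ D (u k) := by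
    intro k
    induction k with
    | zero =>
      rw [hu0]
      refine ⟨D₀, hD₀, h0, hD₀0, ?_⟩
      have h0t : (0 : DarbouxModel m) ∈ D₀.target := by rw [← hD₀0]; exact D₀.map_source h0
      filter_upwards [D₀.open_target.mem_nhds h0t] with w hw
      refine ⟨hw, fun t => D₀.symm (w + (t - 0) • ((1, 0), 0)), by simp, by simp, ?_⟩
      refine hD₀.isMIntegralCurveOn_line hH w 0 fun t ht => ?_
      obtain rfl : t = 0 := by simpa using ht
      simpa using hw
    | succ k ih =>
      obtain ⟨D₁, hD₁, hs₁, hD₁0, hp⟩ := ih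
      obtain ⟨i, hi⟩ := hucov k
      set D := Ds i with hDdef
      have hmono : (u k : ℝ) ≤ u (k + 1) := hum (Nat.le_succ k)
      have hmemT : ∀ j, (u j : ℝ) ∈ Icc 0 T := fun j => ⟨(u j).2.1, (u j).2.2.trans hs.2⟩
      have habs : ∀ t ∈ Icc (u k) (u (k + 1)), |(t : ℝ) - i| < r i / 2 := fun t ht => by
        have := hi ht
        simpa [Real.dist_eq] using this
      have hk := habs (u k) ⟨le_rfl, hum (Nat.le_succ k)⟩
      have hk1 := habs (u (k + 1)) ⟨hum (Nat.le_succ k), le_rfl⟩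
      have hik := hline i i.2 _ (hmemT k) hk
      have hik1 := hline i i.2 _ (hmemT (k + 1)) hk1
      have hri := hr i i.2
      have hnorm : ∀ a : ℝ, ‖a • timeDir m‖ = |a| := fun a => by
        rw [norm_smul, norm_timeDir, mul_one, Real.norm_eq_abs]
      have htk : ((u k : ℝ) - i) • timeDir m ∈ (Ds i).target := hball i i.2 (by
        rw [mem_ball_zero_iff, hnorm]; linarith)
      have hDk : Ds i (γ (u k)) = ((u k : ℝ) - i) • timeDir m := by
        rw [hik, (Ds i).right_inv htk]
      obtain ⟨D₂, hD₂, hs₂, hD₂0, hp₂⟩ := propagates_step hH hmono (u k).2.1 hD₁ hs₁ hD₁0 hp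
        -- Half of the radius is reserved for the time shift along the arc, the other half for the
        -- deviation from it.
        (hDs i i.2) (by rw [hik]; exact (Ds i).map_target htk) (half_pos hri) (fun t ht w hw => by
          refine hball i i.2 ?_
          rw [hDk] at hw
          rw [mem_ball_zero_iff]
          have e1 : w + t • timeDir m = (w - ((u k : ℝ) - i) • timeDir m) +
              (t + ((u k : ℝ) - i)) • timeDir m := by rw [add_smul]; abel
          rw [e1]
          have e2 : ‖(t + ((u k : ℝ) - i)) • timeDir m‖ < r i / 2 := by
            rw [hnorm, abs_lt]
            rw [abs_lt] at hk hk1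
            constructor <;> linarith [ht.1, ht.2]
          linarith [norm_add_le (w - ((u k : ℝ) - i) • timeDir m)
            ((t + ((u k : ℝ) - i)) • timeDir m)])
      have e3 : (Ds i).symm (Ds i (γ (u k)) + ((u (k + 1) : ℝ) - u k) • timeDir m) =
          γ (u (k + 1)) := by
        rw [hDk, hik1, ← add_smul]
        congr 2
        ring
      rw [e3] at hs₂ hD₂0
      exact ⟨D₂, hD₂, hs₂, hD₂0, hp₂⟩
  have := key N
  rwa [hN N le_rfl] at this

/-- The orbits near a given arc, in Darboux charts at its beginning and near time `s`. -/
theorem Propagates.exists_arcs (hH : ContMDiff (𝓡 d) 𝓘(ℝ, ℝ) ∞ H)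
    {D₀ D : OpenPartialHomeomorph M (DarbouxModel m)} {s : ℝ} (hs : 0 < s)
    (hp : Propagates σ H D₀ D s) (hD : IsDarbouxChart σ H h D) (h0 : (0 : DarbouxModel m) ∈ D.target) :
    ∃ ε > 0, ε ≤ s ∧ ∀ w : DarbouxModel m, ‖w‖ < ε →
      (∀ r : ℝ, |r| ≤ ε → w + r • timeDir m ∈ D.target) ∧
      ∃ c : ℝ → M, c 0 = D₀.symm w ∧ IsMIntegralCurveOn c (hamiltonianField σ H) (Icc 0 (s + ε)) ∧
        ∀ t ∈ Icc (s - ε) (s + ε), c t = D.symm (w + (t - s) • timeDir m) := by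
  have hXs := contMDiff_hamiltonianField σ hH
  obtain ⟨r, hr, hball⟩ := Metric.isOpen_iff.1 D.open_target 0 h0
  obtain ⟨r', hr', hp'⟩ := Metric.eventually_nhds_iff_ball.1 hp
  set ε := min s (min (r / 3) r') with hε
  have hεpos : 0 < ε := lt_min hs (lt_min (by positivity) hr')
  have hε1 : ε ≤ s := min_le_left _ _
  have hε2 : ε ≤ r / 3 := (min_le_right _ _).trans (min_le_left _ _)
  have hε3 : ε ≤ r' := (min_le_right _ _).trans (min_le_right _ _)
  refine ⟨ε, hεpos, hε1, fun w hw => ?_⟩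
  have hl : ∀ a : ℝ, |a| ≤ ε → w + a • timeDir m ∈ D.target := fun a ha => by
    refine hball ?_
    rw [mem_ball_zero_iff]
    have : ‖a • timeDir m‖ = |a| := by rw [norm_smul, norm_timeDir, mul_one, Real.norm_eq_abs]
    linarith [norm_add_le w (a • timeDir m)]
  refine ⟨hl, ?_⟩
  obtain ⟨-, c, hc0, hcs, hcX⟩ := hp' w (by rw [mem_ball_zero_iff]; linarith)
  have hline := hD.isMIntegralCurveOn_line hH w s (s := Icc (s - ε) (s + ε)) fun t ht =>
    hl (t - s) (by rw [abs_le]; constructor <;> linarith [ht.1, ht.2])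
  -- Uniqueness backwards from time `s`: the propagated curve is already a straight line in `D`
  -- shortly before `s`.
  have hback := eqOn_Icc_of_isMIntegralCurveOn hXs (t₀ := s)
    (IsMIntegralCurveOn.mono hcX (Icc_subset_Icc (by linarith) le_rfl) :
      IsMIntegralCurveOn c _ (Icc (s - ε) s))
    (IsMIntegralCurveOn.mono hline (Icc_subset_Icc le_rfl (by linarith)))
    ⟨by linarith, le_rfl⟩ (by simp [hcs])
  refine ⟨_, ?_, IsMIntegralCurveOn.glue hs.le (by linarith) hcX (IsMIntegralCurveOn.mono hline
    (Icc_subset_Icc (by linarith) le_rfl)) (by simp [hcs]), fun t ht => ?_⟩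
  · simp [hs.le, hc0]
  · by_cases hts : t ≤ s
    · rw [if_pos hts]
      exact hback ⟨ht.1, hts⟩
    · rw [if_neg hts]
      rfl

end Propagation


/-! ### Disjointness of trajectory arcs -/

section FirstHit

variable {d : ℕ} {M : Type*} [TopologicalSpace M] [ChartedSpace (Euc d) M]
  [IsManifold (𝓡 d) ∞ M] [T2Space M] {X : (x : M) → TangentSpace (𝓡 d) x}

/-- Two trajectory arcs that meet run into the section at the same point. -/
theorem IsFirstHitArc.eq_of_meet_aux (hX : ContMDiff (𝓡 d) (𝓡 d).tangent 1
      (fun x => (⟨x, X x⟩ : TangentBundle (𝓡 d) M))) {B : Set M} {y w : M} {T T' : ℝ}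
    {γ γ' : ℝ → M} (h : IsFirstHitArc X B y T γ) (h' : IsFirstHitArc X B w T' γ') {a b : ℝ}
    (ha : a ∈ Ico 0 T) (hb : b ∈ Ico 0 T') (hab : γ a = γ' b) (hle : T - a ≤ T' - b) :
    T - a = T' - b ∧ γ T = γ' T' := by
  have h1 : IsMIntegralCurveOn (fun t => γ (t + a)) X (Icc 0 (T - a)) := by
    have := IsMIntegralCurveOn.shift h.integral a
    exact IsMIntegralCurveOn.mono this (Icc_subset_Icc (by linarith [ha.1]) le_rfl)
  have h2 : IsMIntegralCurveOn (fun t => γ' (t + b)) X (Icc 0 (T - a)) := by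
    have := IsMIntegralCurveOn.shift h'.integral b
    exact IsMIntegralCurveOn.mono this (Icc_subset_Icc (by linarith [hb.1]) hle)
  have hTa : 0 < T - a := by linarith [ha.2]
  have h3 := eqOn_Icc_of_isMIntegralCurveOn hX h1 h2 (t₀ := 0) ⟨le_rfl, hTa.le⟩
    (by simpa using hab) ⟨hTa.le, le_rfl⟩
  simp only [sub_add_cancel] at h3
  have h4 : T - a + b = T' := by
    by_contra hne
    refine h'.avoid (T - a + b) ⟨by linarith [hb.1], lt_of_le_of_ne (by linarith) hne⟩ ?_
    rw [← h3]
    exact h.hit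
  exact ⟨by linarith, by rw [h3, h4]⟩

theorem IsFirstHitArc.eq_of_meet (hX : ContMDiff (𝓡 d) (𝓡 d).tangent 1
      (fun x => (⟨x, X x⟩ : TangentBundle (𝓡 d) M))) {B : Set M} {y w : M} {T T' : ℝ}
    {γ γ' : ℝ → M} (h : IsFirstHitArc X B y T γ) (h' : IsFirstHitArc X B w T' γ') {a b : ℝ}
    (ha : a ∈ Ico 0 T) (hb : b ∈ Ico 0 T') (hab : γ a = γ' b) :
    T - a = T' - b ∧ γ T = γ' T' := by
  rcases le_total (T - a) (T' - b) with hle | hle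
  · exact h.eq_of_meet_aux hX h' ha hb hab hle
  · obtain ⟨h1, h2⟩ := h'.eq_of_meet_aux hX h hb ha hab.symm hle
    exact ⟨h1.symm, h2.symm⟩

theorem IsFirstHitArc.eqOn (hX : ContMDiff (𝓡 d) (𝓡 d).tangent 1
      (fun x => (⟨x, X x⟩ : TangentBundle (𝓡 d) M))) {B : Set M} {y : M} {T T' : ℝ}
    {γ γ' : ℝ → M} (h : IsFirstHitArc X B y T γ) (h' : IsFirstHitArc X B y T' γ') :
    T = T' ∧ EqOn γ γ' (Icc 0 T) := by
  obtain ⟨h1, -⟩ := h.eq_of_meet hX h' ⟨le_rfl, h.pos⟩ ⟨le_rfl, h'.pos⟩ (h.start.trans h'.start.symm)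
  have hT : T = T' := by linarith
  subst hT
  exact ⟨rfl, eqOn_Icc_of_isMIntegralCurveOn hX h.integral h'.integral ⟨le_rfl, h.pos.le⟩
    (h.start.trans h'.start.symm)⟩

/-- Arcs that start from different points of the domain of an injective Poincaré map are
disjoint. -/
theorem eq_and_eq_of_arcs_meet (hX : ContMDiff (𝓡 d) (𝓡 d).tangent 1
      (fun x => (⟨x, X x⟩ : TangentBundle (𝓡 d) M))) {A B : Set M} {R : M → M} (hR : InjOn R A)
    {τ : M → ℝ} {γ : M → ℝ → M}
    (hγ : ∀ y ∈ A, IsFirstHitArc X B y (τ y) (γ y) ∧ γ y (τ y) = R y) {y w : M} (hy : y ∈ A)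
    (hw : w ∈ A) {a b : ℝ} (ha : a ∈ Ico 0 (τ y)) (hb : b ∈ Ico 0 (τ w)) (hab : γ y a = γ w b) :
    y = w ∧ a = b := by
  obtain ⟨h1, h2⟩ := (hγ y hy).1.eq_of_meet hX (hγ w hw).1 ha hb hab
  rw [(hγ y hy).2, (hγ w hw).2] at h2
  obtain rfl := hR hy hw h2
  exact ⟨rfl, by linarith⟩

end FirstHit

/-! ### The three charts along the arc -/

section FlowCharts

variable {d m : ℕ} {M : Type*} [TopologicalSpace M] [ChartedSpace (Euc d) M]
  [IsManifold (𝓡 d) ∞ M] {σ : SymplecticForm d M} {H : M → ℝ} {h : ℝ}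

/-- Darboux charts at the beginning, in the middle, and at the end of the trajectory arcs `γ y` of
`y ∈ S₀`, in which the flow and the Poincaré map `R` are translations of the time coordinate. -/
structure FlowCharts (σ : SymplecticForm d M) (H : M → ℝ) (h : ℝ) (S₀ : Set M) (R : M → M)
    (τ : M → ℝ) (γ : M → ℝ → M) (s ε : ℝ) (D₀ D₁ D₂ : OpenPartialHomeomorph M (DarbouxModel m)) :
    Prop where
  pos : 0 < ε
  lt : ε < s
  chart₀ : IsDarbouxChart σ H h D₀
  chart₁ : IsDarbouxChart σ H h D₁
  chart₂ : IsDarbouxChart σ H h D₂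
  mem_iff : ∀ x ∈ D₀.source, x ∈ S₀ ↔ (D₀ x).1.1 = 0
  mem_target : ∀ w, ‖w‖ < ε → w ∈ D₀.target
  lt_time : ∀ w, ‖w‖ < ε → w.1.1 = 0 → s + ε < τ (D₀.symm w)
  mem_target₁ : ∀ w, ‖w‖ < ε → ∀ r : ℝ, |r| ≤ ε → w + r • timeDir m ∈ D₁.target
  arc : ∀ w, ‖w‖ < ε → w.1.1 = 0 → ∀ r : ℝ, |r| ≤ ε →
    γ (D₀.symm w) (s + r) = D₁.symm (w + r • timeDir m)
  map : ∀ w, ‖w‖ < ε → w.1.1 = 0 → ∃ r : ℝ, w + r • timeDir m ∈ D₂.target ∧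
    R (D₀.symm w) = D₂.symm (w + r • timeDir m)

variable [T2Space M]

/-- Propagation to the times `s` and `T = τ y₀` gives the middle and the final chart. Continuity of
`τ` keeps the hitting times of nearby points close to `T`; hence their images under `R` stay in the
final chart, displaced from the starting point only in time, by `τ - T`. -/
theorem exists_flowCharts (hd : d = 2 * (m + 1)) (hH : ContMDiff (𝓡 d) 𝓘(ℝ, ℝ) ∞ H) {S₀ S₁ : Set M}
    (hS₀ : IsSection (hamiltonianField σ H) S₀) {R : M → M} {τ : M → ℝ} {γ : M → ℝ → M}
    (hτ : ContinuousOn τ S₀)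
    (hγ : ∀ y ∈ S₀, IsFirstHitArc (hamiltonianField σ H) S₁ y (τ y) (γ y) ∧ γ y (τ y) = R y)
    {y₀ : M} (hy₀ : y₀ ∈ S₀) {s : ℝ} (hs : s ∈ Ioo 0 (τ y₀)) {U : Set M} (hU : U ∈ 𝓝 (γ y₀ s)) :
    ∃ (ε : ℝ) (D₀ D₁ D₂ : OpenPartialHomeomorph M (DarbouxModel m)),
      FlowCharts σ H (H y₀) S₀ R τ γ s ε D₀ D₁ D₂ ∧ y₀ ∈ D₀.source ∧ D₀ y₀ = 0 ∧
      R y₀ ∈ D₂.source ∧ D₂ (R y₀) = 0 ∧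
      ∀ w : DarbouxModel m, ‖w‖ < ε → ∀ r : ℝ, |r| ≤ ε → D₁.symm (w + r • timeDir m) ∈ U := by
  have hXs := contMDiff_hamiltonianField σ hH
  set T := τ y₀ with hT
  obtain ⟨O, f, hO, hyO, hf, hSO, hfX⟩ := hS₀ y₀ hy₀
  have hmemO : ∀ x ∈ O, x ∈ S₀ ↔ f x = 0 := fun x hx => by
    have := Set.ext_iff.1 hSO x
    simpa [hx] using this
  obtain ⟨D₀, hD₀, hyD₀, hD₀O, hD₀0, hD₀f⟩ := exists_darbouxChart (σ := σ) hd hH hO hyO hf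
    ((hmemO y₀ hyO).1 hy₀) hfX
  have hX0 : hamiltonianField σ H y₀ ≠ 0 := by
    intro h0
    rw [h0] at hfX
    exact hfX (map_zero _)
  obtain ⟨harc, hend⟩ := hγ y₀ hy₀
  have hstart := harc.start
  have hprop := exists_propagates hd hH harc.integral (by rwa [hstart]) (by rwa [hstart])
    (by rwa [hstart]) (by rwa [hstart])
  rw [hstart] at hprop
  obtain ⟨D₁, hD₁, hsD₁, hD₁0, hp₁⟩ := hprop s ⟨hs.1.le, hs.2.le⟩
  obtain ⟨D₂, hD₂, hsD₂, hD₂0, hp₂⟩ := hprop T ⟨harc.pos.le, le_rfl⟩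
  have ht₁ : (0 : DarbouxModel m) ∈ D₁.target := by rw [← hD₁0]; exact D₁.map_source hsD₁
  have ht₂ : (0 : DarbouxModel m) ∈ D₂.target := by rw [← hD₂0]; exact D₂.map_source hsD₂
  have ht₀ : (0 : DarbouxModel m) ∈ D₀.target := by rw [← hD₀0]; exact D₀.map_source hyD₀
  have hsymm₀ : D₀.symm 0 = y₀ := by rw [← hD₀0, D₀.left_inv hyD₀]
  have hsymm₁ : D₁.symm 0 = γ y₀ s := by rw [← hD₁0, D₁.left_inv hsD₁]
  obtain ⟨ε₁, hε₁, hε₁s, harcs₁⟩ := hp₁.exists_arcs hH hs.1 hD₁ ht₁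
  obtain ⟨ε₂, hε₂, -, harcs₂⟩ := hp₂.exists_arcs hH harc.pos hD₂ ht₂
  have hS₀mem : ∀ x ∈ D₀.source, x ∈ S₀ ↔ (D₀ x).1.1 = 0 := fun x hx =>
    (hmemO x (hD₀O hx)).trans (hD₀f x hx)
  -- Thirds of `T - s`: then `s + ε` stays below `T - κ`, and so below every nearby hitting time.
  set κ := min ε₂ ((T - s) / 3) with hκ
  have hTs : 0 < T - s := by linarith [hs.2]
  have hκ0 : 0 < κ := lt_min hε₂ (by positivity)
  have hnear : ∀ᶠ w in 𝓝 (0 : DarbouxModel m), w ∈ D₀.target ∧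
      (D₀.symm w ∈ S₀ → |τ (D₀.symm w) - T| < κ) := by
    refine Eventually.and (D₀.open_target.mem_nhds ht₀) ?_
    have h1 : ∀ᶠ x in 𝓝 y₀, x ∈ S₀ → |τ x - T| < κ := by
      have := (hτ y₀ hy₀).tendsto.eventually_mem (Metric.ball_mem_nhds _ hκ0)
      rw [eventually_nhdsWithin_iff] at this
      filter_upwards [this] with x hx hxS
      simpa [Real.dist_eq] using hx hxS
    have h2 := (D₀.symm.continuousAt ht₀).tendsto
    rw [hsymm₀] at h2
    exact h2.eventually h1
  obtain ⟨ε₃, hε₃, hnear⟩ := Metric.eventually_nhds_iff_ball.1 hnear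
  have hUn : ∀ᶠ w in 𝓝 (0 : DarbouxModel m), D₁.symm w ∈ U := by
    have h2 := (D₁.symm.continuousAt ht₁).tendsto
    rw [hsymm₁] at h2
    exact h2.eventually_mem hU
  obtain ⟨ε₄, hε₄, hUn⟩ := Metric.eventually_nhds_iff_ball.1 hUn
  obtain ⟨ε, hε, hle₁, hle₂, hle₃, hle₄, hle₅, hle₆⟩ : ∃ ε > 0, ε ≤ ε₁ ∧ ε ≤ ε₂ ∧ ε ≤ ε₃ ∧
      ε ≤ ε₄ / 2 ∧ ε ≤ s / 2 ∧ ε ≤ (T - s) / 3 := by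
    refine ⟨min ε₁ (min ε₂ (min ε₃ (min (ε₄ / 2) (min (s / 2) ((T - s) / 3))))), ?_, ?_⟩
    · have := hs.1
      positivity
    · simp only [min_le_iff, le_refl, true_or, or_true, and_self]
  have hκ1 : κ ≤ ε₂ := min_le_left _ _
  have hκ2 : κ ≤ (T - s) / 3 := min_le_right _ _
  have htar : ∀ w : DarbouxModel m, ‖w‖ < ε → w ∈ D₀.target := fun w hw =>
    (hnear w (by rw [mem_ball_zero_iff]; linarith)).1
  have hmem : ∀ w : DarbouxModel m, ‖w‖ < ε → w.1.1 = 0 → D₀.symm w ∈ S₀ := fun w hw hw0 => by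
    rw [hS₀mem _ (D₀.map_target (htar w hw)), D₀.right_inv (htar w hw)]
    exact hw0
  have htime : ∀ w : DarbouxModel m, ‖w‖ < ε → w.1.1 = 0 → |τ (D₀.symm w) - T| < κ :=
    fun w hw hw0 => (hnear w (by rw [mem_ball_zero_iff]; linarith)).2 (hmem w hw hw0)
  have hlt : ∀ w : DarbouxModel m, ‖w‖ < ε → w.1.1 = 0 → s + ε < τ (D₀.symm w) :=
    fun w hw hw0 => by
      have := abs_lt.1 (htime w hw hw0)
      linarith
  refine ⟨ε, D₀, D₁, D₂, ⟨hε, by linarith [hs.1], hD₀, hD₁, hD₂, hS₀mem, htar, hlt,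
    fun w hw r hr => (harcs₁ w (by linarith)).1 r (by linarith), fun w hw hw0 r hr => ?_,
    fun w hw hw0 => ?_⟩, hyD₀, hD₀0, by rwa [← hend], by rwa [← hend], fun w hw r hr => hUn _ ?_⟩
  · obtain ⟨-, c, hc0, hcX, hc⟩ := harcs₁ w (by linarith)
    have har := (hγ _ (hmem w hw hw0)).1
    have hr' := abs_le.1 hr
    have h1 := eqOn_Icc_of_isMIntegralCurveOn hXs (t₀ := 0) (b := s + ε)
      (IsMIntegralCurveOn.mono har.integral (Icc_subset_Icc le_rfl (hlt w hw hw0).le))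
      (IsMIntegralCurveOn.mono hcX (Icc_subset_Icc le_rfl (by linarith)))
      ⟨le_rfl, by linarith [hs.1]⟩ (har.start.trans hc0.symm)
      (show s + r ∈ Icc 0 (s + ε) from ⟨by linarith, by linarith⟩)
    rw [h1, hc _ ⟨by linarith, by linarith⟩, add_sub_cancel_left]
  · obtain ⟨htar₂, c, hc0, hcX, hc⟩ := harcs₂ w (by linarith)
    obtain ⟨har, hRw⟩ := hγ _ (hmem w hw hw0)
    have hr' := abs_lt.1 (htime w hw hw0)
    refine ⟨τ (D₀.symm w) - T, htar₂ _ (by linarith [htime w hw hw0]), ?_⟩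
    have h1 := eqOn_Icc_of_isMIntegralCurveOn hXs (t₀ := 0) har.integral
      (IsMIntegralCurveOn.mono hcX (Icc_subset_Icc le_rfl (by linarith)))
      ⟨le_rfl, har.pos.le⟩ (har.start.trans hc0.symm) ⟨har.pos.le, le_rfl⟩
    rw [← hRw, h1, hc _ ⟨by linarith, by linarith⟩]
  · rw [mem_ball_zero_iff]
    have : ‖r • timeDir m‖ = |r| := by rw [norm_smul, norm_timeDir, mul_one, Real.norm_eq_abs]
    linarith [norm_add_le w (r • timeDir m)]

end FlowCharts


/-! ### Autonomous perturbations of the energy coordinate -/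

section ModelPerturbation

/-- Evaluating the momentum coordinate of the energy-time plane. -/
def energyCoord (m : ℕ) : DarbouxModel m →L[ℝ] ℝ :=
  (ContinuousLinearMap.snd ℝ ℝ ℝ).comp (ContinuousLinearMap.fst ℝ (ℝ × ℝ) (Euc m × Euc m))

/-- Forgetting the energy coordinate. -/
def forgetEnergy (m : ℕ) : DarbouxModel m →L[ℝ] ℝ × (Euc m × Euc m) :=
  ((ContinuousLinearMap.fst ℝ ℝ ℝ).comp
    (ContinuousLinearMap.fst ℝ (ℝ × ℝ) (Euc m × Euc m))).prod
      (ContinuousLinearMap.snd ℝ (ℝ × ℝ) (Euc m × Euc m))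

/-- The orbits of `p + K(q, z)` on the zero energy surface are the graphs of the orbits of `K`. -/
theorem model_curve {m : ℕ} {G : DarbouxModel m → ℝ} {K : ℝ × (Euc m × Euc m) → ℝ}
    (hK : ContDiff ℝ ∞ K) {b : ℝ} (hKb : ∀ x, |K x| < b)
    (hGK : ∀ w : DarbouxModel m, |w.1.2| < b → G w = K (w.1.1, w.2)) {c c' : ℝ → Euc m × Euc m}
    (hc : ∀ t, HasDerivAt c (c' t) t)
    (hcK : ∀ t v, stdForm (Euc m) (c' t) v = fderiv ℝ K (t, c t) (0, v)) (t : ℝ) :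
    HasDerivAt (fun t => (((t, -K (t, c t)), c t) : DarbouxModel m))
      ((1, -fderiv ℝ K (t, c t) (1, 0)), c' t) t ∧
    ∀ v, modelForm ((1, -fderiv ℝ K (t, c t) (1, 0)), c' t) v =
      fderiv ℝ (fun w : DarbouxModel m => w.1.2 + G w) ((t, -K (t, c t)), c t) v := by
  have hKd : ∀ x, HasFDerivAt K (fderiv ℝ K x) x := fun x =>
    ((hK.contDiffAt).differentiableAt (by simp)).hasFDerivAt
  have hself : stdForm (Euc m) (c' t) (c' t) = 0 := by
    rw [stdForm_apply, real_inner_comm, sub_self]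
  refine ⟨?_, fun v => ?_⟩
  · have h1 : HasDerivAt (fun t => (t, c t)) (1, c' t) t := (hasDerivAt_id t).prodMk (hc t)
    have h2 := (hKd (t, c t)).comp_hasDerivAt t h1
    -- A Hamiltonian changes along its own orbit only through its explicit time dependence.
    have h3 : fderiv ℝ K (t, c t) (1, c' t) = fderiv ℝ K (t, c t) (1, 0) := by
      have : ((1, c' t) : ℝ × (Euc m × Euc m)) = (1, 0) + (0, c' t) := by simp
      rw [this, map_add, ← hcK, hself, add_zero]
    rw [h3] at h2
    exact ((hasDerivAt_id t).prodMk h2.neg).prodMk (hc t)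
  · set w₀ : DarbouxModel m := ((t, -K (t, c t)), c t) with hw₀
    have hopen : ∀ᶠ w in 𝓝 w₀, |w.1.2| < b := by
      have hcont : ContinuousAt (fun w : DarbouxModel m => |w.1.2|) w₀ := by fun_prop
      exact hcont.eventually_lt continuousAt_const (by simpa [hw₀] using hKb (t, c t))
    have hev : (fun w : DarbouxModel m => w.1.2 + G w) =ᶠ[𝓝 w₀]
        fun w => energyCoord m w + K (forgetEnergy m w) := by
      filter_upwards [hopen] with w hw
      rw [hGK w hw]
      rfl
    have hd : HasFDerivAt (fun w => energyCoord m w + K (forgetEnergy m w))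
        (energyCoord m + (fderiv ℝ K (forgetEnergy m w₀)).comp (forgetEnergy m)) w₀ :=
      (energyCoord m).hasFDerivAt.add ((hKd _).comp w₀ (forgetEnergy m).hasFDerivAt)
    rw [hev.fderiv_eq, hd.fderiv]
    change 1 * v.1.2 - -fderiv ℝ K (t, c t) (1, 0) * v.1.1 + stdForm (Euc m) (c' t) v.2 =
      v.1.2 + fderiv ℝ K (t, c t) (v.1.1, v.2)
    have : ((v.1.1, v.2) : ℝ × (Euc m × Euc m)) = v.1.1 • ((1 : ℝ), (0 : Euc m × Euc m)) +
        (0, v.2) := by simp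
    rw [this, map_add, map_smul, ← hcK, smul_eq_mul]
    ring

/-- Symplectic maps near the identity are realized by the flow of a small perturbation of the
energy coordinate, supported in a prescribed box. -/
theorem exists_model_perturbation {m : ℕ} (hm : 0 < m) {ρ δ b : ℝ} (hρ : 0 < ρ) (hδ : 0 < δ)
    (hb : 0 < b) (r : ℕ) {ε : ℝ} (hε : 0 < ε) :
    ∃ k : ℕ, ∃ ε₁ > 0, ∀ φ : Euc m × Euc m → Euc m × Euc m, ContDiff ℝ ∞ φ →
      (∀ z, ρ < ‖z‖ → φ z = z) →
      (∀ z u v, stdForm (Euc m) (fderiv ℝ φ z u) (fderiv ℝ φ z v) = stdForm (Euc m) u v) →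
      (∀ j ≤ k, ∀ z, ‖iteratedFDeriv ℝ j (fun z => φ z - z) z‖ ≤ ε₁) →
      ∃ G : DarbouxModel m → ℝ, ContDiff ℝ ∞ G ∧ (∀ j ≤ r, ∀ w, ‖iteratedFDeriv ℝ j G w‖ ≤ ε) ∧
        (∀ w, (δ / 2 < |w.1.1| ∨ b < |w.1.2| ∨ ρ < ‖w.2‖) → G w = 0) ∧
        ∀ z₀, ∃ c c' : ℝ → DarbouxModel m, c (-δ) = ((-δ, 0), z₀) ∧ c δ = ((δ, 0), φ z₀) ∧
          ∀ t, HasDerivAt c (c' t) t ∧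
            (∀ v, modelForm (c' t) v = fderiv ℝ (fun w => w.1.2 + G w) (c t) v) ∧
            (c t).1.1 = t ∧ |(c t).1.2| < b ∧ ‖(c t).2‖ ≤ max ρ ‖z₀‖ := by
  have : Nonempty (Fin m) := ⟨⟨0, hm⟩⟩
  -- The admissible maps themselves index the family, along the filter generated by their `C^k`
  -- neighbourhoods of the identity. An eventual statement along this filter is exactly one that
  -- holds for some order `k` and some bound, here `1 / (k + 1)`.
  set S : ℕ → Set (Euc m × Euc m → Euc m × Euc m) := fun k => {φ | (ContDiff ℝ ∞ φ ∧
    (∀ z, ρ < ‖z‖ → φ z = z) ∧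
    ∀ z u v, stdForm (Euc m) (fderiv ℝ φ z u) (fderiv ℝ φ z v) = stdForm (Euc m) u v) ∧
    ∀ j ≤ k, ∀ z, ‖iteratedFDeriv ℝ j (fun z => φ z - z) z‖ ≤ 1 / ((k : ℝ) + 1)} with hS
  have hanti : Antitone S := fun k l hkl φ hφ => ⟨hφ.1, fun j hj z =>
    (hφ.2 j (hj.trans hkl) z).trans (by gcongr)⟩
  set 𝓕 := ⨅ k, 𝓟 (S k) with h𝓕
  have hbasis : 𝓕.HasBasis (fun _ : ℕ => True) S :=
    hasBasis_iInf_principal (directed_of_isDirected_le hanti)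
  have hne : NeBot 𝓕 := by
    refine hbasis.neBot_iff.2 fun {k} _ => ⟨id, ⟨contDiff_id, fun _ _ => rfl, fun z u v => ?_⟩, ?_⟩
    · simp
    · intro j hj z
      have : (fun z : Euc m × Euc m => id z - z) = fun _ => 0 := by ext1 z; simp
      rw [this, iteratedFDeriv_fun_zero]
      simp only [Pi.zero_apply, norm_zero]
      positivity
  have hev : ∀ k, S k ∈ 𝓕 := fun k => hbasis.mem_of_mem trivial
  have hsm : SmallFam 𝓕 (fun (φ : Euc m × Euc m → Euc m × Euc m) z => φ z - z) := by
    refine ⟨?_, fun j η hη => ?_⟩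
    · filter_upwards [hev 0] with φ hφ using hφ.1.1.sub contDiff_id
    · obtain ⟨n, hn⟩ := exists_nat_one_div_lt hη
      filter_upwards [hev (max j n)] with φ hφ z
      refine (hφ.2 j (le_max_left _ _) z).trans (le_trans ?_ hn.le)
      gcongr
      exact_mod_cast le_max_right _ _
  obtain ⟨K, hK, hKgen⟩ := exists_generating_family hρ hδ hsm
    (by filter_upwards [hev 0] with φ hφ using hφ.1.2.1)
    (by filter_upwards [hev 0] with φ hφ using hφ.1.2.2)
  -- The cutoff equals one for `|p| ≤ b / 2`. As `|K|` is made smaller than this, the orbits `p =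
  -- -K` never notice the cutoff.
  let β : ContDiffBump (0 : ℝ) := ⟨b / 2, b, by positivity, by linarith⟩
  have hβ : ContDiff ℝ ∞ β := β.contDiff
  have hG : SmallFam 𝓕 fun φ (w : DarbouxModel m) =>
      (β ∘ energyCoord m) w • (K φ ∘ forgetEnergy m) w :=
    (hK.comp (bddDer_clm (forgetEnergy m))).smul (hβ.comp (energyCoord m).contDiff)
      (exists_bound_comp_clm hβ (exists_bound_of_hasCompactSupport hβ β.hasCompactSupport) _)
  have hfin := (hKgen.and ((hG.small_le r hε).and (hK.small 0 (b / 4) (by positivity)))).and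
    (hK.smooth.and hG.smooth)
  obtain ⟨k, -, hk⟩ := hbasis.mem_iff.1 hfin
  refine ⟨k, 1 / ((k : ℝ) + 1), by positivity, fun φ h1 h2 h3 h4 => ?_⟩
  obtain ⟨⟨⟨hK0, hcurve⟩, hGs, hKs⟩, hKsm, hGsm⟩ := hk ⟨⟨h1, h2, h3⟩, h4⟩
  have hKb : ∀ x, |K φ x| < b / 2 := fun x => by
    have := hKs x
    rw [norm_iteratedFDeriv_zero, Real.norm_eq_abs] at this
    linarith
  refine ⟨_, hGsm, hGs, fun w hw => ?_, fun z₀ => ?_⟩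
  · change β w.1.2 • K φ (w.1.1, w.2) = 0
    rcases hw with hw | hw | hw
    · rw [hK0 _ _ (Or.inl hw), smul_zero]
    · rw [β.zero_of_le_dist, zero_smul]
      rw [Real.dist_eq, sub_zero]
      exact hw.le
    · rw [hK0 _ _ (Or.inr hw), smul_zero]
  · obtain ⟨c, c', hc0, hc1, hc⟩ := hcurve z₀
    have hmc := model_curve hKsm hKb (G := fun w => (β ∘ energyCoord m) w • (K φ ∘ forgetEnergy m) w)
      (fun w hw => by
        change β w.1.2 • K φ (w.1.1, w.2) = _
        rw [β.one_of_mem_closedBall, one_smul]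
        rw [mem_closedBall_iff_norm, sub_zero, Real.norm_eq_abs]
        exact hw.le) (fun t => (hc t).1) fun t => (hc t).2.1
    refine ⟨fun t => ((t, -K φ (t, c t)), c t), _, ?_, ?_, fun t => ⟨(hmc t).1, (hmc t).2, rfl, ?_,
      (hc t).2.2⟩⟩
    -- `K` vanishes for `|t| > δ / 2`, so the orbit starts (and likewise ends) with momentum zero.
    · change ((-δ, -K φ (-δ, c (-δ))), c (-δ)) = _
      rw [hc0, hK0 _ _ (Or.inl (by rw [abs_neg, abs_of_pos hδ]; linarith)), neg_zero]
    · change ((δ, -K φ (δ, c δ)), c δ) = _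
      rw [hc1, hK0 _ _ (Or.inl (by rw [abs_of_pos hδ]; linarith)), neg_zero]
    · change |-K φ (t, c t)| < b
      rw [abs_neg]
      linarith [hKb (t, c t)]

end ModelPerturbation


/-! ### Perturbations in a chart and the strong topology -/

section Perturbation

variable {d : ℕ} {M : Type*} [TopologicalSpace M] [ChartedSpace (Euc d) M]
  [IsManifold (𝓡 d) ∞ M] [T2Space M] {V : Type*} [NormedAddCommGroup V] [NormedSpace ℝ V]
  {D : OpenPartialHomeomorph M V}

theorem isClosed_symm_image {C : Set V} (hC : IsCompact C) (hCt : C ⊆ D.target) :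
    IsClosed (D.symm '' C) :=
  (hC.image_of_continuousOn (D.continuousOn_symm.mono hCt)).isClosed

/-- A function with compact support in a chart can be added to a smooth function. -/
theorem exists_add_in_chart (hD : SmoothChart d D) {C : Set V} (hC : IsCompact C)
    (hCt : C ⊆ D.target) {G : V → ℝ} (hG : ContDiff ℝ ∞ G) (hG0 : ∀ w, w ∉ C → G w = 0)
    (H : C^∞⟮𝓡 d, M; 𝓘(ℝ, ℝ), ℝ⟯) :
    ∃ Ht : C^∞⟮𝓡 d, M; 𝓘(ℝ, ℝ), ℝ⟯, (∀ w ∈ D.target, Ht (D.symm w) = H (D.symm w) + G w) ∧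
      ∀ x, x ∉ D.symm '' C → Ht x = H x := by
  classical
  set g : M → ℝ := fun x => if x ∈ D.source then G (D x) else 0 with hg
  have hg0 : ∀ x, x ∉ D.symm '' C → g x = 0 := fun x hx => by
    by_cases hxs : x ∈ D.source
    · rw [hg]
      simp only [hxs, if_true]
      exact hG0 _ fun hxC => hx ⟨_, hxC, D.left_inv hxs⟩
    · simp [hg, hxs]
  have hgs : ContMDiff (𝓡 d) 𝓘(ℝ, ℝ) ∞ g := by
    intro x
    by_cases hxs : x ∈ D.source
    · have h1 : ContMDiffAt (𝓡 d) 𝓘(ℝ, ℝ) ∞ (G ∘ D) x :=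
        hG.contMDiff.contMDiffAt.comp x (hD.smooth.contMDiffAt (D.open_source.mem_nhds hxs))
      refine h1.congr_of_eventuallyEq ?_
      filter_upwards [D.open_source.mem_nhds hxs] with y hy
      simp [hg, hy]
    · have hx : x ∈ (D.symm '' C)ᶜ := by
        rintro ⟨w, hw, rfl⟩
        exact hxs (D.map_target (hCt hw))
      refine (contMDiffAt_const (c := (0 : ℝ))).congr_of_eventuallyEq ?_
      filter_upwards [(isClosed_symm_image hC hCt).isOpen_compl.mem_nhds hx] with y hy
      exact hg0 y hy
  refine ⟨⟨fun x => H x + g x, H.contMDiff.add hgs⟩, fun w hw => ?_, fun x hx => ?_⟩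
  · change H _ + g _ = _
    rw [hg]
    simp only [D.map_target hw, if_true, D.right_inv hw]
  · change H _ + g _ = _
    rw [hg0 x hx, add_zero]

/-- The chain rule for higher derivatives, with the derivatives of the fixed map `T` bounded on the
compact set. Since the bound `B` is at least one, one power `B ^ r` serves for all orders. -/
theorem exists_bound_iteratedFDeriv_comp {E F : Type*} [NormedAddCommGroup E] [NormedSpace ℝ E]
    [NormedAddCommGroup F] [NormedSpace ℝ F] {T : E → F} {O C : Set E} (hO : IsOpen O)
    (hT : ContDiffOn ℝ ∞ T O) (hC : IsCompact C) (hCO : C ⊆ O) (r : ℕ) {ε : ℝ} (hε : 0 < ε) :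
    ∃ ε' > 0, ∀ G : F → ℝ, ContDiff ℝ ∞ G → (∀ j ≤ r, ∀ w, ‖iteratedFDeriv ℝ j G w‖ ≤ ε') →
      ∀ z ∈ C, ∀ j ≤ r, ‖iteratedFDeriv ℝ j (G ∘ T) z‖ < ε := by
  have hb : ∀ j ≤ r, ∃ B : ℝ, ∀ᶠ _u in (⊤ : Filter Unit), ∀ z ∈ C, ‖iteratedFDeriv ℝ j T z‖ ≤ B :=
    fun j hj => by
      have h1 : ContinuousOn (iteratedFDerivWithin ℝ j T O) O :=
        hT.continuousOn_iteratedFDerivWithin (by exact_mod_cast le_top) hO.uniqueDiffOn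
      obtain ⟨B, hB⟩ := hC.exists_bound_of_continuousOn (h1.mono hCO)
      refine ⟨B, Eventually.of_forall fun _ z hz => ?_⟩
      have := hB z hz
      rwa [iteratedFDerivWithin_of_isOpen j hO (hCO hz)] at this
  obtain ⟨B, hB1, hB⟩ := exists_uniform_bound (𝓕 := (⊤ : Filter Unit))
    (p := fun j B _ => ∀ z ∈ C, ‖iteratedFDeriv ℝ j T z‖ ≤ B)
    (fun k C C' i hCC h x hx => (h x hx).trans hCC) r hb
  have hB : ∀ j ≤ r, ∀ z ∈ C, ‖iteratedFDeriv ℝ j T z‖ ≤ B := by simpa using hB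
  refine ⟨ε / (2 * (r.factorial * B ^ r)), by positivity, fun G hG hGb z hz j hj => ?_⟩
  have h1 := norm_iteratedFDerivWithin_comp_le (g := G) (f := T) (n := j) (N := ∞) (t := univ)
    (s := O) (x := z) (C := ε / (2 * (r.factorial * B ^ r))) (D := B)
    hG.contDiffOn hT (by exact_mod_cast le_top) uniqueDiffOn_univ hO.uniqueDiffOn (mapsTo_univ _ _)
    (hCO hz) (fun i hi => by
      rw [iteratedFDerivWithin_univ]
      exact hGb i (hi.trans hj) _) (fun i hi1 hi => by
      rw [iteratedFDerivWithin_of_isOpen i hO (hCO hz)]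
      exact (hB i (hi.trans hj) z hz).trans (le_self_pow₀ hB1 (by omega)))
  rw [iteratedFDerivWithin_of_isOpen j hO (hCO hz)] at h1
  refine h1.trans_lt ?_
  calc (j.factorial : ℝ) * (ε / (2 * (r.factorial * B ^ r))) * B ^ j
      ≤ r.factorial * (ε / (2 * (r.factorial * B ^ r))) * B ^ r := by
        gcongr
    _ = ε / 2 := by
        have : (r.factorial : ℝ) ≠ 0 := by positivity
        field_simp
    _ < ε := by linarith

/-- Small perturbations in a compact part of a chart stay in a Whitney neighbourhood. -/
theorem IsWhitneyNhd.exists_small (hD : SmoothChart d D) {C : Set V} (hC : IsCompact C)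
    (hCt : C ⊆ D.target) {H : C^∞⟮𝓡 d, M; 𝓘(ℝ, ℝ), ℝ⟯} {𝒩 : Set C^∞⟮𝓡 d, M; 𝓘(ℝ, ℝ), ℝ⟯}
    (h𝒩 : IsWhitneyNhd H 𝒩) :
    ∃ (r : ℕ) (ε : ℝ), 0 < ε ∧ ∀ (G : V → ℝ) (Ht : C^∞⟮𝓡 d, M; 𝓘(ℝ, ℝ), ℝ⟯), ContDiff ℝ ∞ G →
      (∀ j ≤ r, ∀ w, ‖iteratedFDeriv ℝ j G w‖ ≤ ε) →
      (∀ w ∈ D.target, Ht (D.symm w) = H (D.symm w) + G w) →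
      (∀ x, x ∉ D.symm '' C → Ht x = H x) → Ht ∈ 𝒩 := by
  obtain ⟨r, e, K, ε, he, hK, hfin, hε, hmem⟩ := h𝒩
  have hN : IsCompact (D.symm '' C) := hC.image_of_continuousOn (D.continuousOn_symm.mono hCt)
  have hNs : D.symm '' C ⊆ D.source := by
    rintro _ ⟨w, hw, rfl⟩
    exact D.map_target (hCt hw)
  -- Only finitely many of the locally finite compact sets meet the support, so a single positive
  -- bound suffices although the tolerances `ε i` may tend to zero.
  have hI := hfin.finite_nonempty_inter_compact hN
  have hi : ∀ i, ∃ ε' > 0, ∀ G : V → ℝ, ContDiff ℝ ∞ G →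
      (∀ j ≤ r, ∀ w, ‖iteratedFDeriv ℝ j G w‖ ≤ ε') → ∀ z ∈ e i '' (K i ∩ D.symm '' C), ∀ j ≤ r,
        ‖iteratedFDeriv ℝ j (G ∘ (D ∘ (e i).symm)) z‖ < ε i := fun i => by
    have heS := smoothChart_of_mem_maximalAtlas (he i)
    refine exists_bound_iteratedFDeriv_comp ((e i).symm.trans D).open_source
      (heS.contDiffOn_transition hD) ?_ ?_ r (hε i)
    · refine ((hK i).1.inter_right hN.isClosed).image_of_continuousOn
        ((e i).continuousOn.mono fun x hx => (hK i).2 hx.1)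
    · rintro _ ⟨x, hx, rfl⟩
      refine ⟨(e i).map_source ((hK i).2 hx.1), ?_⟩
      change (e i).symm (e i x) ∈ D.source
      rw [(e i).left_inv ((hK i).2 hx.1)]
      exact hNs hx.2
  choose ε' hε' hb using hi
  have hsmall : ∀ᶠ t in 𝓝[>] (0 : ℝ), ∀ i ∈ {i | (K i ∩ D.symm '' C).Nonempty}, t ≤ ε' i :=
    (eventually_all_finite hI).2 fun i _ =>
      mem_nhdsWithin_of_mem_nhds (Iic_mem_nhds (hε' i))
  obtain ⟨t, ht, ht0⟩ := (hsmall.and self_mem_nhdsWithin).exists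
  refine ⟨r, t, ht0, fun G Ht hG hGb hHt hHt0 => hmem Ht fun i x hx j hj => ?_⟩
  have hxs := (hK i).2 hx
  have hcont : ContinuousAt (e i).symm (e i x) := (e i).symm.continuousAt ((e i).map_source hxs)
  have hinv : (e i).symm (e i x) = x := (e i).left_inv hxs
  by_cases hxN : x ∈ D.symm '' C
  · have hHs : ∀ f : C^∞⟮𝓡 d, M; 𝓘(ℝ, ℝ), ℝ⟯, ContDiffAt ℝ j (f ∘ (e i).symm) (e i x) := fun f => by
      have h1 := f.contMDiff.comp_contMDiffOn
        (contMDiffOn_symm_of_mem_maximalAtlas (n := ∞) (he i))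
      have h2 := (contMDiffOn_iff_contDiffOn.1 h1).contDiffAt
        ((e i).open_target.mem_nhds ((e i).map_source hxs))
      exact h2.of_le (by exact_mod_cast le_top)
    have hev : G ∘ (D ∘ (e i).symm) =ᶠ[𝓝 (e i x)] (Ht ∘ (e i).symm) - (H ∘ (e i).symm) := by
      have h1 : ∀ᶠ z in 𝓝 (e i x), (e i).symm z ∈ D.source :=
        hcont.tendsto.eventually_mem (by rw [hinv]; exact D.open_source.mem_nhds (hNs hxN))
      filter_upwards [h1] with z hz
      have h2 := hHt _ (D.map_source hz)
      rw [D.left_inv hz] at h2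
      change G (D ((e i).symm z)) = Ht ((e i).symm z) - H ((e i).symm z)
      rw [h2]
      ring
    have h1 := hb i G hG (fun j hj w => (hGb j hj w).trans (ht i ⟨x, hx, hxN⟩)) (e i x)
      ⟨x, ⟨hx, hxN⟩, rfl⟩ j hj
    rw [(hev.iteratedFDeriv ℝ j).eq_of_nhds, iteratedFDeriv_sub_apply (hHs Ht) (hHs H)] at h1
    exact h1
  · have hev : Ht ∘ (e i).symm =ᶠ[𝓝 (e i x)] H ∘ (e i).symm := by
      have h1 : ∀ᶠ z in 𝓝 (e i x), (e i).symm z ∈ (D.symm '' C)ᶜ :=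
        hcont.tendsto.eventually_mem (by rw [hinv]; exact hN.isClosed.isOpen_compl.mem_nhds hxN)
      filter_upwards [h1] with z hz using hHt0 _ hz
    rw [(hev.iteratedFDeriv ℝ j).eq_of_nhds, sub_self, norm_zero]
    exact hε i

end Perturbation


/-! ### The Poincaré map of the perturbed system -/

section Realization

variable {d m : ℕ} {M : Type*} [TopologicalSpace M] [ChartedSpace (Euc d) M]
  [IsManifold (𝓡 d) ∞ M] {σ : SymplecticForm d M}

theorem hamiltonianField_congr {H H' : M → ℝ} {x : M} (h : H =ᶠ[𝓝 x] H') :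
    hamiltonianField σ H x = hamiltonianField σ H' x := by
  refine eq_of_form_eq σ _ _ _ fun v => ?_
  rw [hamiltonianField_spec, hamiltonianField_spec]
  exact DFunLike.congr_fun h.mfderiv_eq v

/-- Boxes in the model space. -/
def modelBox (m : ℕ) (δ b ρ : ℝ) : Set (DarbouxModel m) :=
  {w | |w.1.1| ≤ δ ∧ |w.1.2| ≤ b ∧ ‖w.2‖ ≤ ρ}

theorem isCompact_modelBox (δ b ρ : ℝ) : IsCompact (modelBox m δ b ρ) := by
  have : modelBox m δ b ρ = (Metric.closedBall 0 δ ×ˢ Metric.closedBall 0 b) ×ˢ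
      Metric.closedBall 0 ρ := by
    ext w
    simp only [modelBox, mem_ofPred_eq, mem_prod, mem_closedBall_zero_iff, Real.norm_eq_abs, and_assoc]
  rw [this]
  exact ((isCompact_closedBall _ _).prod (isCompact_closedBall _ _)).prod (isCompact_closedBall _ _)

variable {H : M → ℝ} {h : ℝ} {S₀ S₁ : Set M} {R : M → M} {τ : M → ℝ} {γ : M → ℝ → M} {s ε : ℝ}
  {D₀ D₁ D₂ : OpenPartialHomeomorph M (DarbouxModel m)}

theorem FlowCharts.symm_mem (hF : FlowCharts σ H h S₀ R τ γ s ε D₀ D₁ D₂) {w : DarbouxModel m}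
    (hw : ‖w‖ < ε) (hw0 : w.1.1 = 0) : D₀.symm w ∈ S₀ := by
  rw [hF.mem_iff _ (D₀.map_target (hF.mem_target w hw)), D₀.right_inv (hF.mem_target w hw)]
  exact hw0

theorem norm_energy_slice {w : DarbouxModel m} {b : ℝ} (hb : |w.1.2| < b) (hz : ‖w.2‖ < b) :
    ‖(((0, w.1.2), w.2) : DarbouxModel m)‖ < b := by
  rw [Prod.norm_def, Prod.norm_def, max_lt_iff, max_lt_iff]
  exact ⟨⟨by simpa using (abs_nonneg _).trans_lt hb, hb⟩, hz⟩

theorem eq_add_timeDir (w : DarbouxModel m) :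
    w = ((0, w.1.2), w.2) + w.1.1 • timeDir m := by
  ext <;> simp [timeDir]

/-- The points of the middle chart lie on the trajectory arcs. -/
theorem FlowCharts.symm_eq_arc (hF : FlowCharts σ H h S₀ R τ γ s ε D₀ D₁ D₂) {δ b ρ : ℝ}
    (hδ : δ < ε) (hb : b < ε) (hρ : ρ < ε) {w : DarbouxModel m} (hw : w ∈ modelBox m δ b ρ) :
    w ∈ D₁.target ∧ D₀.symm ((0, w.1.2), w.2) ∈ S₀ ∧ ((0, w.1.2), w.2) ∈ D₀.target ∧
      s + w.1.1 ∈ Ioo 0 (τ (D₀.symm ((0, w.1.2), w.2))) ∧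
      D₁.symm w = γ (D₀.symm ((0, w.1.2), w.2)) (s + w.1.1) := by
  obtain ⟨h1, h2, h3⟩ := hw
  have hn : ‖(((0, w.1.2), w.2) : DarbouxModel m)‖ < ε :=
    norm_energy_slice (by linarith) (by linarith)
  have h4 := hF.mem_target₁ _ hn w.1.1 (by linarith)
  have h5 := hF.arc _ hn rfl w.1.1 (by linarith)
  rw [← eq_add_timeDir] at h4 h5
  have h6 := hF.lt_time _ hn rfl
  have h7 := abs_le.1 h1
  have h8 := hF.lt
  exact ⟨h4, hF.symm_mem hn rfl, hF.mem_target _ hn, ⟨by linarith, by linarith⟩, h5.symm⟩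

variable [T2Space M]

/-- Every point of the box lies on a trajectory arc strictly before its first hit. -/
theorem FlowCharts.notMem_section (hF : FlowCharts σ H h S₀ R τ γ s ε D₀ D₁ D₂) {δ b ρ : ℝ}
    (hδ : δ < ε) (hb : b < ε) (hρ : ρ < ε)
    (hγ : ∀ y ∈ S₀, IsFirstHitArc (hamiltonianField σ H) S₁ y (τ y) (γ y) ∧ γ y (τ y) = R y)
    {x : M} (hx : x ∈ D₁.symm '' modelBox m δ b ρ) : x ∉ S₁ := by
  obtain ⟨w, hw, rfl⟩ := hx
  obtain ⟨-, h1, -, h2, h3⟩ := hF.symm_eq_arc hδ hb hρ hw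
  rw [h3]
  exact (hγ _ h1).1.avoid _ h2

/-- The trajectory arcs meet the box of the middle chart only in the obvious way. -/
theorem FlowCharts.arc_mem_box (hF : FlowCharts σ H h S₀ R τ γ s ε D₀ D₁ D₂) {δ b ρ : ℝ}
    (hδ : δ < ε) (hb : b < ε) (hρ : ρ < ε) (hH : ContMDiff (𝓡 d) 𝓘(ℝ, ℝ) ∞ H) (hR : InjOn R S₀)
    (hγ : ∀ y ∈ S₀, IsFirstHitArc (hamiltonianField σ H) S₁ y (τ y) (γ y) ∧ γ y (τ y) = R y)
    {y : M} (hy : y ∈ S₀) (hyh : H y = h) {t : ℝ} (ht : t ∈ Icc 0 (τ y))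
    (hx : γ y t ∈ D₁.symm '' modelBox m δ b ρ) :
    |t - s| ≤ δ ∧ ∃ z, ‖z‖ ≤ ρ ∧ y = D₀.symm ((0, 0), z) := by
  have hnS := hF.notMem_section hδ hb hρ hγ hx
  have htτ : t ≠ τ y := by
    rintro rfl
    exact hnS (hγ y hy).1.hit
  obtain ⟨w, hw, hwx⟩ := hx
  obtain ⟨-, h1, h4, h2, h3⟩ := hF.symm_eq_arc hδ hb hρ hw
  obtain ⟨h5, h6⟩ := eq_and_eq_of_arcs_meet (contMDiff_hamiltonianField σ hH) hR hγ hy h1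
    ⟨ht.1, lt_of_le_of_ne ht.2 htτ⟩ ⟨h2.1.le, h2.2⟩ (hwx.symm.trans h3)
  refine ⟨by rw [h6, add_sub_cancel_left]; exact hw.1, w.2, hw.2.2, ?_⟩
  have h7 := hF.chart₀.ham _ h4
  rw [← h5, hyh] at h7
  have h8 : w.1.2 = 0 := by
    have : h = h + w.1.2 := h7
    linarith
  rw [h5, h8]

/-- Away from the perturbation trajectories do not change. -/
theorem isMIntegralCurveOn_of_avoid {Ht : M → ℝ} {C : Set (DarbouxModel m)} (hC : IsCompact C)
    (hCt : C ⊆ D₁.target) (hHt : ∀ x, x ∉ D₁.symm '' C → Ht x = H x) {c : ℝ → M} {I : Set ℝ}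
    (hc : IsMIntegralCurveOn c (hamiltonianField σ H) I) (hav : ∀ t ∈ I, c t ∉ D₁.symm '' C) :
    IsMIntegralCurveOn c (hamiltonianField σ Ht) I := by
  refine IsMIntegralCurveOn.congr_field hc fun t ht => hamiltonianField_congr ?_
  filter_upwards [(isClosed_symm_image hC hCt).isOpen_compl.mem_nhds (hav t ht)] with x hx
  exact (hHt x hx).symm

/-- A perturbation in the box of the middle chart that moves `((-δ, 0), z)` to `((δ, 0), φ z)`
changes the Poincaré map on the energy surface by `φ`. -/
theorem FlowCharts.isPoincareMap_perturbed (hF : FlowCharts σ H h S₀ R τ γ s ε D₀ D₁ D₂)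
    {δ b ρ : ℝ} (hδ0 : 0 < δ) (hδ : δ < ε) (hb : b < ε) (hρ : ρ < ε)
    (hH : ContMDiff (𝓡 d) 𝓘(ℝ, ℝ) ∞ H) (hR : BijOn R S₀ S₁)
    (hγ : ∀ y ∈ S₀, IsFirstHitArc (hamiltonianField σ H) S₁ y (τ y) (γ y) ∧ γ y (τ y) = R y)
    (hτ : ContinuousOn τ S₀) {g : M → M} (hg : LeftInvOn g R S₀) (hgc : ContinuousOn g S₁)
    {Rt : M → M} (hRt : MapsTo Rt (slice S₀ H h) (slice S₁ H h))
    (hRtc : ContinuousOn Rt (slice S₀ H h)) {φ : Euc m × Euc m → Euc m × Euc m}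
    (hin : ∀ z, ‖z‖ ≤ ρ → g (Rt (D₀.symm ((0, 0), z))) = D₀.symm ((0, 0), φ z))
    (hout : ∀ y ∈ slice S₀ H h, (∀ z, ‖z‖ ≤ ρ → y ≠ D₀.symm ((0, 0), z)) → Rt y = R y)
    {G : DarbouxModel m → ℝ} (hG : ∀ z₀, ∃ c c' : ℝ → DarbouxModel m, c (-δ) = ((-δ, 0), z₀) ∧
      c δ = ((δ, 0), φ z₀) ∧ ∀ t, HasDerivAt c (c' t) t ∧
        (∀ v, modelForm (c' t) v = fderiv ℝ (fun w => w.1.2 + G w) (c t) v) ∧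
        (c t).1.1 = t ∧ |(c t).1.2| < b ∧ ‖(c t).2‖ ≤ max ρ ‖z₀‖)
    {Ht : M → ℝ} (hHt : ContMDiff (𝓡 d) 𝓘(ℝ, ℝ) ∞ Ht)
    (hHtG : ∀ w ∈ D₁.target, Ht (D₁.symm w) = H (D₁.symm w) + G w)
    (hHt0 : ∀ x, x ∉ D₁.symm '' modelBox m (δ / 2) b ρ → Ht x = H x) :
    IsPoincareMap (hamiltonianField σ Ht) (slice S₀ H h) S₁ Rt := by
  have hgm : MapsTo g S₁ S₀ := fun x hx => by
    obtain ⟨y, hy, rfl⟩ := hR.surjOn hx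
    rwa [hg hy]
  have hRg : ∀ x ∈ S₁, R (g x) = x := fun x hx => by
    obtain ⟨y, hy, rfl⟩ := hR.surjOn hx
    rw [hg hy]
  have hRt₁ : MapsTo Rt (slice S₀ H h) S₁ := fun y hy => (hRt hy).1
  have hCt : modelBox m (δ / 2) b ρ ⊆ D₁.target := fun w hw =>
    (hF.symm_eq_arc (by linarith) hb hρ hw).1
  have hC := isCompact_modelBox (m := m) (δ / 2) b ρ
  -- The new hitting time is that of the point `g (Rt y)` whose unperturbed image is `Rt y`:
  -- crossing the box takes the same time `2 * δ` as before, because the time coordinate still has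
  -- speed one on these orbits.
  refine ⟨fun y => τ (g (Rt y)), hτ.comp (hgc.comp hRtc hRt₁) fun y hy => hgm (hRt₁ hy),
    fun y hy => ?_⟩
  have hRtend : ∀ y ∈ slice S₀ H h, γ (g (Rt y)) (τ (g (Rt y))) = Rt y := fun y hy => by
    rw [(hγ _ (hgm (hRt₁ hy))).2, hRg _ (hRt₁ hy)]
  change ∃ η, IsFirstHitArc _ S₁ y (τ (g (Rt y))) η ∧ η (τ (g (Rt y))) = Rt y
  by_cases hcase : ∀ z, ‖z‖ ≤ ρ → y ≠ D₀.symm ((0, 0), z)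
  · have hgy : g (Rt y) = y := by rw [hout y hy hcase, hg hy.1]
    have har := (hγ y hy.1).1
    refine ⟨γ y, ?_, by have := hRtend y hy; rwa [hgy] at this ⊢⟩
    rw [hgy]
    refine ⟨har.pos, har.start, isMIntegralCurveOn_of_avoid hC hCt hHt0 har.integral
      fun t ht hmem => ?_, har.avoid, har.hit⟩
    obtain ⟨-, z, hz, hyz⟩ := hF.arc_mem_box (by linarith) hb hρ hH hR.injOn hγ hy.1 hy.2 ht hmem
    exact hcase z hz hyz
  · push Not at hcase
    obtain ⟨z, hz, hyz⟩ := hcase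
    obtain ⟨c, c', hc₀, hc₁, hc⟩ := hG z
    have hcz : ∀ t, ‖(c t).2‖ ≤ ρ := fun t => by
      have := (hc t).2.2.2.2
      rwa [max_eq_left hz] at this
    have hφz : ‖φ z‖ ≤ ρ := by
      have := hcz δ
      rwa [hc₁] at this
    have hnorm : ∀ z : Euc m × Euc m, ‖z‖ ≤ ρ → ‖(((0, 0), z) : DarbouxModel m)‖ < ε :=
      fun z hz => by
        refine norm_energy_slice (w := ((0, 0), z)) ?_ ?_
        · simpa using hF.pos
        · exact hz.trans_lt hρ
    -- The perturbed orbit consists of the arc of `y` up to time `s - δ`, the model orbit across the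
    -- box, and the arc of `y'` from time `s + δ` on.
    set y' := D₀.symm ((0, 0), φ z) with hy'
    have hgy : g (Rt y) = y' := by rw [hyz, hin z hz]
    have hy'S : y' ∈ S₀ := hF.symm_mem (hnorm _ hφz) rfl
    have hy'h : H y' = h := by
      have := hF.chart₀.ham _ (hF.mem_target _ (hnorm _ hφz))
      simpa using this
    have har := (hγ y hy.1).1
    have har' := (hγ y' hy'S).1
    have hτy : s + ε < τ y := by rw [hyz]; exact hF.lt_time _ (hnorm _ hz) rfl
    have hτy' : s + ε < τ y' := hF.lt_time _ (hnorm _ hφz) rfl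
    have hsε := hF.lt
    have hbox : ∀ t ∈ Icc (s - δ) (s + δ), c (t - s) ∈ modelBox m δ b ρ := fun t ht => by
      refine ⟨?_, (hc _).2.2.2.1.le, hcz _⟩
      rw [(hc _).2.2.1, abs_le]
      constructor <;> linarith [ht.1, ht.2]
    have hI₁ : IsMIntegralCurveOn (γ y) (hamiltonianField σ Ht) (Icc 0 (s - δ)) := by
      refine isMIntegralCurveOn_of_avoid hC hCt hHt0
        (IsMIntegralCurveOn.mono har.integral (Icc_subset_Icc le_rfl (by linarith)))
        fun t ht hmem => ?_
      have := (hF.arc_mem_box (by linarith) hb hρ hH hR.injOn hγ hy.1 hy.2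
        ⟨ht.1, by linarith [ht.2]⟩ hmem).1
      have := (abs_le.1 this).1
      linarith [ht.2]
    have hI₃ : IsMIntegralCurveOn (γ y') (hamiltonianField σ Ht) (Icc (s + δ) (τ y')) := by
      refine isMIntegralCurveOn_of_avoid hC hCt hHt0
        (IsMIntegralCurveOn.mono har'.integral (Icc_subset_Icc (by linarith) le_rfl))
        fun t ht hmem => ?_
      have := (hF.arc_mem_box (by linarith) hb hρ hH hR.injOn hγ hy'S hy'h
        ⟨by linarith [ht.1], ht.2⟩ hmem).1
      have := (abs_le.1 this).2
      linarith [ht.1]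
    have hI₂ : IsMIntegralCurveOn (fun t => D₁.symm (c (t - s))) (hamiltonianField σ Ht)
        (Icc (s - δ) (s + δ)) := by
      refine hF.chart₁.toSmoothChart.isMIntegralCurveOn (c := fun t => c (t - s))
        (c' := fun t => c' (t - s)) (fun t ht => ?_)
        (fun t ht => (hF.symm_eq_arc hδ hb hρ (hbox t ht)).1) fun t ht => ?_
      · have := (hc (t - s)).1.scomp t ((hasDerivAt_id t).sub_const s)
        rw [one_smul] at this
        exact this.hasDerivWithinAt
      · have hct := (hF.symm_eq_arc hδ hb hρ (hbox t ht)).1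
        refine hF.chart₁.hamiltonianField_eq hct ((hHt _).mdifferentiableAt (by simp))
          (G := fun w => h + (w.1.2 + G w)) ?_ fun v => ?_
        · filter_upwards [D₁.open_target.mem_nhds hct] with w hw
          change Ht (D₁.symm w) = _
          rw [hHtG w hw, hF.chart₁.ham w hw, add_assoc]
        · rw [fderiv_const_add]
          exact (hc (t - s)).2.1 v
    have hj₁ : γ y (s - δ) = D₁.symm (c (s - δ - s)) := by
      have h1 : s - δ - s = -δ := by ring
      have h2 := hF.arc _ (hnorm z hz) rfl (-δ) (by rw [abs_neg, abs_of_pos hδ0]; exact hδ.le)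
      rw [h1, hc₀, sub_eq_add_neg, hyz, h2]
      congr 1
      ext <;> simp [timeDir]
    have hj₂ : D₁.symm (c (s + δ - s)) = γ y' (s + δ) := by
      have h2 := hF.arc _ (hnorm _ hφz) rfl δ (by rw [abs_of_pos hδ0]; exact hδ.le)
      rw [add_sub_cancel_left, hc₁, h2]
      congr 1
      ext <;> simp [timeDir]
    have hI₁₂ := IsMIntegralCurveOn.glue (by linarith) (by linarith) hI₁ hI₂ hj₁
    have hI := IsMIntegralCurveOn.glue (by linarith) (by linarith) hI₁₂ hI₃
      (by rw [if_neg (by linarith), hj₂])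
    have hstart : (if (0 : ℝ) ≤ s - δ then γ y 0 else D₁.symm (c (0 - s))) = y := by
      rw [if_pos (by linarith), har.start]
    rw [hgy]
    refine ⟨_, ⟨har'.pos, ?_, hI, fun t ht => ?_, ?_⟩, ?_⟩
    · rw [if_pos (by linarith), hstart]
    -- No piece meets `S₁` too early: the outer two are parts of first-hit arcs, the middle one lies
    -- in the box.
    · split_ifs with h1 h2
      · exact har.avoid t ⟨ht.1, by linarith⟩
      · push Not at h2
        exact hF.notMem_section hδ hb hρ hγ ⟨_, hbox t ⟨h2.le, h1⟩, rfl⟩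
      · exact har'.avoid t ht
    · rw [if_neg (by linarith)]
      exact har'.hit
    · rw [if_neg (by linarith), ← hgy, hRtend y hy]

/-- The perturbation does not change the energy surface inside the sections. -/
theorem FlowCharts.slice_perturbed (hF : FlowCharts σ H h S₀ R τ γ s ε D₀ D₁ D₂)
    {δ b ρ : ℝ} (hδ : δ < ε) (hb : b < ε) (hρ : ρ < ε) (hH : ContMDiff (𝓡 d) 𝓘(ℝ, ℝ) ∞ H)
    (hR : InjOn R S₀)
    (hγ : ∀ y ∈ S₀, IsFirstHitArc (hamiltonianField σ H) S₁ y (τ y) (γ y) ∧ γ y (τ y) = R y)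
    {Ht : M → ℝ} (hHt0 : ∀ x, x ∉ D₁.symm '' modelBox m δ b ρ → Ht x = H x) :
    slice S₀ Ht h = slice S₀ H h ∧ slice S₁ Ht h = slice S₁ H h := by
  have h₀ : ∀ x ∈ S₀, Ht x = H x := fun x hx => by
    refine hHt0 x ?_
    rintro ⟨w, hw, rfl⟩
    obtain ⟨-, h1, -, h2, h3⟩ := hF.symm_eq_arc hδ hb hρ hw
    -- A point of `S₀` in the box would be the starting point of one arc and an interior point of
    -- another one.
    obtain ⟨-, h4⟩ := eq_and_eq_of_arcs_meet (contMDiff_hamiltonianField σ hH) hR hγ hx h1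
      ⟨le_rfl, (hγ _ hx).1.pos⟩ ⟨h2.1.le, h2.2⟩ ((hγ _ hx).1.start.trans h3)
    exact h2.1.ne h4
  have h₁ : ∀ x ∈ S₁, Ht x = H x := fun x hx =>
    hHt0 x fun hmem => hF.notMem_section hδ hb hρ hγ hmem hx
  constructor
  · ext x
    exact and_congr_right fun hx => by rw [h₀ x hx]
  · ext x
    exact and_congr_right fun hx => by rw [h₁ x hx]

end Realization


/-! ### The perturbed map in reduced coordinates -/

section Reduction

variable {d m : ℕ} {M : Type*} [TopologicalSpace M] [ChartedSpace (Euc d) M]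
  [IsManifold (𝓡 d) ∞ M] {σ : SymplecticForm d M} {H : M → ℝ} {h : ℝ} {S₀ S₁ : Set M} {R : M → M}
  {τ : M → ℝ} {γ : M → ℝ → M} {s ε : ℝ} {D₀ D₁ D₂ D : OpenPartialHomeomorph M (DarbouxModel m)}

theorem IsDarbouxChart.pullback_eq (hD : IsDarbouxChart σ H h D) {k : ℕ} {F : Euc k → M} {z : Euc k}
    (hF : MDifferentiableAt (𝓡 k) (𝓡 d) F z) (hz : F z ∈ D.source) (u v : Euc k) :
    pullback σ.form F z ![u, v] =
      modelForm (fderiv ℝ (D ∘ F) z u) (fderiv ℝ (D ∘ F) z v) := by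
  have h1 : HasMFDerivAt (𝓡 k) 𝓘(ℝ, DarbouxModel m) (D ∘ F) z _ :=
    (hD.toSmoothChart.hasMFDerivAt hz).comp z hF.hasMFDerivAt
  have h2 : ∀ u : Euc k, fderiv ℝ (D ∘ F) z u =
      chartDeriv d D (F z) (mfderiv (𝓡 k) (𝓡 d) F z u) := fun u => by
    rw [← mfderiv_eq_fderiv]
    exact DFunLike.congr_fun h1.mfderiv u
  rw [h2, h2, ← hD.form_eq hz]
  exact congrArg (σ.form (F z)) (pair_comp (mfderiv (𝓡 k) (𝓡 d) F z) u v)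

/-- The inclusion of the zero section of the energy-time plane. -/
def zeroSection (m : ℕ) : Euc m × Euc m →L[ℝ] DarbouxModel m :=
  ContinuousLinearMap.inr ℝ (ℝ × ℝ) (Euc m × Euc m)

theorem zeroSection_apply (z : Euc m × Euc m) : zeroSection m z = ((0, 0), z) := rfl

theorem norm_zeroSection (z : Euc m × Euc m) : ‖zeroSection m z‖ = ‖z‖ := by
  simp [zeroSection_apply, Prod.norm_def]

theorem FlowCharts.symm_mem_slice (hF : FlowCharts σ H h S₀ R τ γ s ε D₀ D₁ D₂)
    {z : Euc m × Euc m} (hz : ‖z‖ < ε) : D₀.symm (zeroSection m z) ∈ slice S₀ H h := by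
  have hn : ‖zeroSection m z‖ < ε := by rwa [norm_zeroSection]
  refine ⟨hF.symm_mem hn rfl, ?_⟩
  rw [hF.chart₀.ham _ (hF.mem_target _ hn), zeroSection_apply, add_zero]

theorem FlowCharts.eq_zeroSection (hF : FlowCharts σ H h S₀ R τ γ s ε D₀ D₁ D₂) {y : M}
    (hy : y ∈ slice S₀ H h) (hyD : y ∈ D₀.source) : D₀ y = zeroSection m (D₀ y).2 := by
  have h1 := (hF.mem_iff y hyD).1 hy.1
  have h2 := hF.chart₀.ham_apply hyD
  rw [hy.2] at h2
  have h3 : (D₀ y).1.2 = 0 := by linarith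
  rw [zeroSection_apply]
  ext <;> simp [h1, h3]

/-- In `D₀` the slice is the coordinate plane where time and energy coordinates vanish. -/
theorem FlowCharts.isLocalParam (hF : FlowCharts σ H h S₀ R τ γ s ε D₀ D₁ D₂) {k : ℕ}
    (L : Euc k ≃L[ℝ] Euc m × Euc m) {ρ : ℝ} (hρ : ρ ≤ ε) :
    IsLocalParam d (slice S₀ H h) (L ⁻¹' Metric.ball 0 ρ)
      (fun z => D₀.symm (zeroSection m (L z))) := by
  have hlt : ∀ z ∈ L ⁻¹' Metric.ball 0 ρ, ‖L z‖ < ε := fun z hz => by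
    rw [mem_preimage, mem_ball_zero_iff] at hz
    exact hz.trans_le hρ
  have htar : ∀ z ∈ L ⁻¹' Metric.ball 0 ρ, zeroSection m (L z) ∈ D₀.target := fun z hz =>
    hF.mem_target _ (by rw [norm_zeroSection]; exact hlt z hz)
  refine ⟨Metric.isOpen_ball.preimage L.continuous, D₀.source ∩ D₀ ⁻¹' Metric.ball 0 ρ,
    D₀.isOpen_inter_preimage Metric.isOpen_ball, ⟨fun z hz => ?_, fun z hz z' hz' he => ?_,
    fun y hy => ?_⟩, ?_, fun y => L.symm (D₀ y).2, fun z hz => ?_, ?_⟩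
  · refine ⟨hF.symm_mem_slice (hlt z hz), D₀.map_target (htar z hz), ?_⟩
    rw [mem_preimage, D₀.right_inv (htar z hz), mem_ball_zero_iff, norm_zeroSection]
    simpa using hz
  · have := D₀.symm.injOn (htar z hz) (htar z' hz') he
    exact L.injective (congrArg Prod.snd this)
  · have h1 := hF.eq_zeroSection hy.1 hy.2.1
    refine ⟨L.symm (D₀ y).2, ?_, ?_⟩
    · have h2 := hy.2.2
      rw [mem_preimage, h1, mem_ball_zero_iff, norm_zeroSection] at h2
      simpa using h2
    · change D₀.symm (zeroSection m (L (L.symm (D₀ y).2))) = y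
      rw [L.apply_symm_apply, ← h1, D₀.left_inv hy.2.1]
  · exact hF.chart₀.smooth_symm.comp
      (((zeroSection m).contDiff.comp L.contDiff).contMDiff.contMDiffOn) htar
  · change L.symm (D₀ (D₀.symm (zeroSection m (L z)))).2 = z
    rw [D₀.right_inv (htar z hz), zeroSection_apply, L.symm_apply_apply]
  · exact (L.symm.contDiff.comp contDiff_snd).contMDiff.comp_contMDiffOn
      (hF.chart₀.smooth.mono fun y hy => hy.2.1)

/-- The map between the slices in the Darboux charts. -/
def reducedMap (D₀ D₂ : OpenPartialHomeomorph M (DarbouxModel m)) (ρ : ℝ) (f : M → M)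
    (z : Euc m × Euc m) : Euc m × Euc m :=
  if ‖z‖ < ρ then (D₂ (f (D₀.symm (zeroSection m z)))).2 else z

theorem reducedMap_of_lt {ρ : ℝ} {f : M → M} {z : Euc m × Euc m} (hz : ‖z‖ < ρ) :
    reducedMap D₀ D₂ ρ f z = (D₂ (f (D₀.symm (zeroSection m z)))).2 := if_pos hz

/-- The Poincaré map only changes the time coordinate, so it is the identity in the reduced
coordinates. -/
theorem FlowCharts.map_zeroSection (hF : FlowCharts σ H h S₀ R τ γ s ε D₀ D₁ D₂)
    {z : Euc m × Euc m} (hz : ‖z‖ < ε) : R (D₀.symm (zeroSection m z)) ∈ D₂.source ∧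
      (D₂ (R (D₀.symm (zeroSection m z)))).2 = z := by
  obtain ⟨r, h1, h2⟩ := hF.map (zeroSection m z) (by rwa [norm_zeroSection]) rfl
  rw [h2, D₂.right_inv h1]
  refine ⟨D₂.map_target h1, ?_⟩
  simp [zeroSection_apply, timeDir]

/-- The assumptions on the perturbed map between the slices in the charts. -/
structure IsReducible (S₀ S₁ : Set M) (H : M → ℝ) (h : ℝ) (R : M → M)
    (D₀ D₂ : OpenPartialHomeomorph M (DarbouxModel m)) (ρ ρ' : ℝ) (f : M → M) : Prop where
  smooth : IsSmoothMap d (slice S₀ H h) (slice S₁ H h) f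
  mem_source : ∀ z : Euc m × Euc m, ‖z‖ < ρ' → f (D₀.symm (zeroSection m z)) ∈ D₂.source
  eq_of_le : ∀ z : Euc m × Euc m, ρ ≤ ‖z‖ → ‖z‖ < ρ' →
    f (D₀.symm (zeroSection m z)) = R (D₀.symm (zeroSection m z))

variable {ρ ρ' : ℝ} {f : M → M}

theorem IsReducible.reducedMap_eq (hf : IsReducible (d := d) S₀ S₁ H h R D₀ D₂ ρ ρ' f)
    (hF : FlowCharts σ H h S₀ R τ γ s ε D₀ D₁ D₂) (hρ' : ρ' ≤ ε) {z : Euc m × Euc m}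
    (hz : ρ ≤ ‖z‖) : reducedMap D₀ D₂ ρ' f z = z := by
  by_cases hz' : ‖z‖ < ρ'
  · rw [reducedMap_of_lt hz', hf.eq_of_le z hz hz', (hF.map_zeroSection (hz'.trans_le hρ')).2]
  · exact if_neg hz'

theorem IsReducible.contMDiffOn (hf : IsReducible (d := d) S₀ S₁ H h R D₀ D₂ ρ ρ' f)
    (hF : FlowCharts σ H h S₀ R τ γ s ε D₀ D₁ D₂) (hρ' : ρ' ≤ ε) {k : ℕ}
    (L : Euc k ≃L[ℝ] Euc m × Euc m) :
    ContMDiffOn (𝓡 k) (𝓡 d) ∞ (f ∘ fun z => D₀.symm (zeroSection m (L z)))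
      (L ⁻¹' Metric.ball 0 ρ') := by
  obtain ⟨-, O, -, -, h1, -⟩ := hF.isLocalParam L hρ'
  refine hf.smooth.2.comp h1 fun z hz => hF.symm_mem_slice ?_
  rw [mem_preimage, mem_ball_zero_iff] at hz
  exact hz.trans_le hρ'

theorem IsReducible.contDiffOn (hf : IsReducible (d := d) S₀ S₁ H h R D₀ D₂ ρ ρ' f)
    (hF : FlowCharts σ H h S₀ R τ γ s ε D₀ D₁ D₂) (hρ' : ρ' ≤ ε) {k : ℕ}
    (L : Euc k ≃L[ℝ] Euc m × Euc m) :
    ContDiffOn ℝ ∞ (D₂ ∘ f ∘ fun z => D₀.symm (zeroSection m (L z))) (L ⁻¹' Metric.ball 0 ρ') := by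
  rw [← contMDiffOn_iff_contDiffOn]
  refine hF.chart₂.smooth.comp (hf.contMDiffOn hF hρ' L) fun z hz => hf.mem_source _ ?_
  rwa [mem_preimage, mem_ball_zero_iff] at hz

/-- The two branches in the definition of `reducedMap` agree on the shell `ρ ≤ ‖z‖ < ρ'`, where `f`
equals `R`; this is why two radii are used. -/
theorem IsReducible.contDiff (hf : IsReducible (d := d) S₀ S₁ H h R D₀ D₂ ρ ρ' f)
    (hF : FlowCharts σ H h S₀ R τ γ s ε D₀ D₁ D₂) (hρ : ρ < ρ') (hρ' : ρ' ≤ ε) {k : ℕ}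
    (L : Euc k ≃L[ℝ] Euc m × Euc m) : ContDiff ℝ ∞ (reducedMap D₀ D₂ ρ' f) := by
  rw [contDiff_iff_contDiffAt]
  intro z
  by_cases hz : ‖z‖ < ρ'
  · have h1 := (hf.contDiffOn hF hρ' L).comp (t := L ⁻¹' Metric.ball 0 ρ') (s := Metric.ball 0 ρ')
      L.symm.contDiff.contDiffOn fun z hz => by simpa using hz
    have h2 := (contDiff_snd.comp_contDiffOn h1).contDiffAt
      (Metric.isOpen_ball.mem_nhds (mem_ball_zero_iff.2 hz))
    refine h2.congr_of_eventuallyEq ?_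
    filter_upwards [Metric.isOpen_ball.mem_nhds (mem_ball_zero_iff.2 hz)] with w hw
    rw [reducedMap_of_lt (mem_ball_zero_iff.1 hw)]
    simp
  · refine contDiffAt_id.congr_of_eventuallyEq ?_
    filter_upwards [continuous_norm.continuousAt.eventually_const_lt
      (hρ.trans_le (not_lt.1 hz))] with w hw using hf.reducedMap_eq hF hρ' hw.le

/-- Both slices lie in the energy surface, so the derivatives have no energy component. The
time–energy term of the model form then drops out, whatever the time components are, and only the
standard form in `z` is left. -/
theorem IsReducible.symplectic (hf : IsReducible (d := d) S₀ S₁ H h R D₀ D₂ ρ ρ' f)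
    (hF : FlowCharts σ H h S₀ R τ γ s ε D₀ D₁ D₂) (hρ : ρ < ρ') (hρ' : ρ' ≤ ε) {k : ℕ}
    (L : Euc k ≃L[ℝ] Euc m × Euc m) (hs : IsSymplecticOn k σ.form (slice S₀ H h) f)
    (z u v : Euc m × Euc m) :
    stdForm (Euc m) (fderiv ℝ (reducedMap D₀ D₂ ρ' f) z u)
      (fderiv ℝ (reducedMap D₀ D₂ ρ' f) z v) = stdForm (Euc m) u v := by
  by_cases hz : ‖z‖ < ρ'
  · set A := L ⁻¹' Metric.ball 0 ρ' with hA
    set P : Euc k → M := fun z => D₀.symm (zeroSection m (L z)) with hP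
    have hloc := hF.isLocalParam L hρ'
    have hAo : IsOpen A := hloc.1
    obtain ⟨-, O, -, -, hPs, -⟩ := id hloc
    set ζ := L.symm z with hζ
    have hLζ : L ζ = z := L.apply_symm_apply z
    have hζA : ζ ∈ A := by
      rw [hA, mem_preimage, hLζ]
      simpa using hz
    have hAn := hAo.mem_nhds hζA
    have hlt : ∀ x ∈ A, ‖L x‖ < ρ' := fun x hx => by rwa [hA, mem_preimage, mem_ball_zero_iff] at hx
    have htar : ∀ x ∈ A, zeroSection m (L x) ∈ D₀.target := fun x hx =>
      hF.mem_target _ (by rw [norm_zeroSection]; exact (hlt x hx).trans_le hρ')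
    have h1 := DFunLike.congr_fun (hs A P hloc ζ hζA) ![L.symm u, L.symm v]
    rw [hF.chart₂.pullback_eq (((hf.contMDiffOn hF hρ' L).contMDiffAt hAn).mdifferentiableAt
      (by simp)) (hf.mem_source _ (hlt ζ hζA)), hF.chart₀.pullback_eq
      ((hPs.contMDiffAt hAn).mdifferentiableAt (by simp)) (D₀.map_target (htar ζ hζA))] at h1
    have h2 : HasFDerivAt (D₀ ∘ P) ((zeroSection m).comp (L : Euc k →L[ℝ] Euc m × Euc m)) ζ := by
      refine ((zeroSection m).comp (L : Euc k →L[ℝ] Euc m × Euc m)).hasFDerivAt.congr_of_eventuallyEq ?_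
      filter_upwards [hAn] with x hx using D₀.right_inv (htar x hx)
    have h3 : HasFDerivAt (D₂ ∘ f ∘ P) (fderiv ℝ (D₂ ∘ f ∘ P) ζ) ζ :=
      (((hf.contDiffOn hF hρ' L).contDiffAt hAn).differentiableAt (by simp)).hasFDerivAt
    have h4 : ∀ a, (fderiv ℝ (D₂ ∘ f ∘ P) ζ a).1.2 = 0 := fun a => by
      have e1 := (energyCoord m).hasFDerivAt.comp ζ h3
      have e2 : HasFDerivAt (energyCoord m ∘ (D₂ ∘ f ∘ P)) (0 : Euc k →L[ℝ] ℝ) ζ := by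
        refine (hasFDerivAt_const (0 : ℝ) ζ).congr_of_eventuallyEq ?_
        filter_upwards [hAn] with x hx
        have e3 := hF.chart₂.ham_apply (hf.mem_source _ (hlt x hx))
        rw [(hf.smooth.1 (hF.symm_mem_slice ((hlt x hx).trans_le hρ'))).2] at e3
        change (D₂ (f (D₀.symm (zeroSection m (L x))))).1.2 = 0
        linarith
      exact DFunLike.congr_fun (e1.unique e2) a
    have h5 : ∀ a, fderiv ℝ (reducedMap D₀ D₂ ρ' f) z a =
        (fderiv ℝ (D₂ ∘ f ∘ P) ζ (L.symm a)).2 := fun a => by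
      have e1 : HasFDerivAt (fun w => (D₂ ∘ f ∘ P) (L.symm w))
          ((fderiv ℝ (D₂ ∘ f ∘ P) ζ).comp (L.symm : Euc m × Euc m →L[ℝ] Euc k)) z :=
        HasFDerivAt.comp z h3 L.symm.hasFDerivAt
      have e2 : HasFDerivAt (reducedMap D₀ D₂ ρ' f)
          ((ContinuousLinearMap.snd ℝ (ℝ × ℝ) (Euc m × Euc m)).comp
            ((fderiv ℝ (D₂ ∘ f ∘ P) ζ).comp (L.symm : Euc m × Euc m →L[ℝ] Euc k))) z := by
        refine e1.snd.congr_of_eventuallyEq ?_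
        filter_upwards [Metric.isOpen_ball.mem_nhds (mem_ball_zero_iff.2 hz)] with w hw
        rw [reducedMap_of_lt (mem_ball_zero_iff.1 hw)]
        simp [hP]
      rw [e2.fderiv]
      rfl
    rw [h5, h5]
    rw [h2.fderiv, modelForm, h4, h4, mul_zero, zero_mul, sub_zero, zero_add] at h1
    rw [h1]
    simp [modelForm, zeroSection_apply]
  · have h1 : reducedMap D₀ D₂ ρ' f =ᶠ[𝓝 z] id := by
      filter_upwards [continuous_norm.continuousAt.eventually_const_lt
        (hρ.trans_le (not_lt.1 hz))] with w hw using hf.reducedMap_eq hF hρ' hw.le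
    rw [h1.fderiv_eq]
    simp

end Reduction


/-! ### Closeness in the weak topology and choice of radii -/

section Closeness

variable {d m : ℕ} {M : Type*} [TopologicalSpace M] [ChartedSpace (Euc d) M]
  [IsManifold (𝓡 d) ∞ M] {σ : SymplecticForm d M} {H : M → ℝ} {h : ℝ} {S₀ S₁ : Set M} {R : M → M}
  {τ : M → ℝ} {γ : M → ℝ → M} {s ε : ℝ} {D₀ D₁ D₂ : OpenPartialHomeomorph M (DarbouxModel m)}
  {ρ ρ' : ℝ}

/-- If `f` is close to `R` then its reduction is close to the identity. -/
theorem IsReducible.exists_close (hF : FlowCharts σ H h S₀ R τ γ s ε D₀ D₁ D₂) (hρ : ρ < ρ')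
    (hρ' : ρ' ≤ ε) (hR : IsReducible (d := d) S₀ S₁ H h R D₀ D₂ ρ ρ' R) {k : ℕ}
    (L : Euc k ≃L[ℝ] Euc m × Euc m) (L' : DarbouxModel m ≃L[ℝ] Euc d) (r : ℕ) {ε₁ : ℝ}
    (hε₁ : 0 < ε₁) :
    ∃ ε₀ > 0, ∀ f, IsReducible (d := d) S₀ S₁ H h R D₀ D₂ ρ ρ' f →
      (∀ z ∈ L ⁻¹' Metric.closedBall 0 ρ, ∀ j ≤ r,
        ‖iteratedFDeriv ℝ j (L' ∘ D₂ ∘ f ∘ fun z => D₀.symm (zeroSection m (L z))) z -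
          iteratedFDeriv ℝ j (L' ∘ D₂ ∘ R ∘ fun z => D₀.symm (zeroSection m (L z))) z‖ < ε₀) →
      ∀ j ≤ r, ∀ z, ‖iteratedFDeriv ℝ j (fun z => reducedMap D₀ D₂ ρ' f z - z) z‖ ≤ ε₁ := by
  set P : Euc d →L[ℝ] Euc m × Euc m :=
    (ContinuousLinearMap.snd ℝ (ℝ × ℝ) (Euc m × Euc m)).comp
      (L'.symm : Euc d →L[ℝ] DarbouxModel m) with hP
  set N := ‖(L.symm : Euc m × Euc m →L[ℝ] Euc k)‖ with hN
  have hN0 : 0 ≤ N := norm_nonneg _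
  -- `P` and `L.symm` undo the linear identifications with Euclidean spaces; the added ones keep the
  -- denominator positive and let one power serve for all orders up to `r`.
  refine ⟨ε₁ / ((‖P‖ + 1) * (N + 1) ^ r), by positivity, fun f hf hclose j hj z => ?_⟩
  by_cases hz : ‖z‖ ≤ ρ
  · set A := L ⁻¹' Metric.ball 0 ρ' with hA
    have hAo : IsOpen A := Metric.isOpen_ball.preimage L.continuous
    have hzA : L.symm z ∈ A := by
      rw [hA, mem_preimage, L.apply_symm_apply, mem_ball_zero_iff]
      exact hz.trans_lt hρ
    have hsm : ∀ f, IsReducible (d := d) S₀ S₁ H h R D₀ D₂ ρ ρ' f → ContDiffAt ℝ ∞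
        (L' ∘ D₂ ∘ f ∘ fun z => D₀.symm (zeroSection m (L z))) (L.symm z) := fun f hf =>
      L'.contDiff.contDiffAt.comp _ ((hf.contDiffOn hF hρ' L).contDiffAt (hAo.mem_nhds hzA))
    have hj' : (j : WithTop ℕ∞) ≤ ∞ := by exact_mod_cast le_top
    set Δ := (L' ∘ D₂ ∘ f ∘ fun z => D₀.symm (zeroSection m (L z))) -
      (L' ∘ D₂ ∘ R ∘ fun z => D₀.symm (zeroSection m (L z))) with hΔ
    have h1 := hclose (L.symm z) (by simpa using hz) j hj
    rw [← iteratedFDeriv_sub_apply ((hsm f hf).of_le hj') ((hsm R hR).of_le hj'), ← hΔ] at h1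
    have hev : (fun z => reducedMap D₀ D₂ ρ' f z - z) =ᶠ[𝓝 z] (P ∘ Δ) ∘ L.symm := by
      filter_upwards [Metric.isOpen_ball.mem_nhds (mem_ball_zero_iff.2 (hz.trans_lt hρ))] with w hw
      have hw' := mem_ball_zero_iff.1 hw
      simp only [Function.comp_apply, hΔ, Pi.sub_apply, map_sub, L.apply_symm_apply, hP,
        ContinuousLinearMap.comp_apply, ContinuousLinearEquiv.coe_coe, L'.symm_apply_apply,
        ContinuousLinearMap.coe_snd', reducedMap_of_lt hw',
        (hF.map_zeroSection (hw'.trans_le hρ')).2]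
    have h2 := L.symm.iteratedFDerivWithin_comp_right (P ∘ Δ) uniqueDiffOn_univ
      (mem_univ (L.symm z)) j
    rw [preimage_univ, iteratedFDerivWithin_univ, iteratedFDerivWithin_univ] at h2
    rw [(hev.iteratedFDeriv ℝ j).eq_of_nhds, h2]
    have h3 := P.norm_iteratedFDeriv_comp_left (n := j) (((hsm f hf).sub (hsm R hR)).of_le hj') le_rfl
    have h4 := (ContinuousMultilinearMap.norm_compContinuousLinearMap_le
      (iteratedFDeriv ℝ j (P ∘ Δ) (L.symm z))
      fun _ => (L.symm : Euc m × Euc m →L[ℝ] Euc k))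
    rw [Finset.prod_const, Finset.card_univ, Fintype.card_fin] at h4
    calc _ ≤ ‖iteratedFDeriv ℝ j (P ∘ Δ) (L.symm z)‖ * N ^ j := h4
      _ ≤ (‖P‖ * ‖iteratedFDeriv ℝ j Δ (L.symm z)‖) * N ^ j := by gcongr; exact h3
      _ ≤ ((‖P‖ + 1) * (ε₁ / ((‖P‖ + 1) * (N + 1) ^ r))) * (N + 1) ^ r := by
          have h5 : N ^ j ≤ (N + 1) ^ r :=
            (pow_le_pow_left₀ hN0 (by linarith) j).trans (pow_le_pow_right₀ (by linarith) hj)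
          gcongr
          linarith
      _ = ε₁ := by field_simp
  · have hev : (fun z => reducedMap D₀ D₂ ρ' f z - z) =ᶠ[𝓝 z] fun _ => 0 := by
      filter_upwards [continuous_norm.continuousAt.eventually_const_lt (not_le.1 hz)] with w hw
      rw [hf.reducedMap_eq hF hρ' hw.le, sub_self]
    rw [(hev.iteratedFDeriv ℝ j).eq_of_nhds, iteratedFDeriv_fun_zero]
    simpa using hε₁.le

theorem FlowCharts.hamiltonian_map (hH : ContMDiff (𝓡 d) 𝓘(ℝ, ℝ) ∞ H)
    (hγ : ∀ y ∈ S₀, IsFirstHitArc (hamiltonianField σ H) S₁ y (τ y) (γ y) ∧ γ y (τ y) = R y)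
    {y : M} (hy : y ∈ S₀) : H (R y) = H y := by
  obtain ⟨h1, h2⟩ := hγ y hy
  have h3 := hamiltonian_eq_of_isMIntegralCurveOn σ hH h1.integral ⟨h1.pos.le, le_rfl⟩
  rwa [h2, h1.start] at h3

/-- The inverse of the Poincaré map in the Darboux charts. -/
theorem FlowCharts.exists_inverse_eq (hF : FlowCharts σ H h S₀ R τ γ s ε D₀ D₁ D₂)
    (hH : ContMDiff (𝓡 d) 𝓘(ℝ, ℝ) ∞ H) (hR : BijOn R S₀ S₁)
    (hγ : ∀ y ∈ S₀, IsFirstHitArc (hamiltonianField σ H) S₁ y (τ y) (γ y) ∧ γ y (τ y) = R y)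
    {g : M → M} (hg : LeftInvOn g R S₀) (hgc : ContinuousOn g S₁) {y₀ : M} (hy₀ : y₀ ∈ S₀)
    (hyD : y₀ ∈ D₀.source) (hD0 : D₀ y₀ = 0) (hRD : R y₀ ∈ D₂.source) (hRD0 : D₂ (R y₀) = 0) :
    ∃ η > 0, ∀ x ∈ slice S₁ H h, x ∈ D₂.source → ‖D₂ x‖ < η →
      g x = D₀.symm (zeroSection m (D₂ x).2) := by
  have h0t : (0 : DarbouxModel m) ∈ D₂.target := by rw [← hRD0]; exact D₂.map_source hRD
  have h0s : D₂.symm 0 = R y₀ := by rw [← hRD0, D₂.left_inv hRD]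
  have h1 : ∀ᶠ y in 𝓝 y₀, y ∈ D₀.source ∧ ‖D₀ y‖ < ε := by
    refine Eventually.and (D₀.open_source.mem_nhds hyD) ?_
    have := (D₀.continuousAt hyD).norm
    refine this.eventually_lt continuousAt_const ?_
    rw [hD0, norm_zero]
    exact hF.pos
  -- Continuity of the inverse `g` at `R y₀` brings preimages into the domain where `R` is known to
  -- be the identity in `z`.
  have h2 : ∀ᶠ x in 𝓝 (R y₀), x ∈ S₁ → g x ∈ D₀.source ∧ ‖D₀ (g x)‖ < ε := by
    have := (hgc (R y₀) (hR.mapsTo hy₀)).tendsto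
    rw [hg hy₀] at this
    exact eventually_nhdsWithin_iff.1 (this.eventually h1)
  have h3 := (D₂.symm.continuousAt h0t).tendsto
  rw [h0s] at h3
  obtain ⟨η, hη, h4⟩ := Metric.eventually_nhds_iff_ball.1 (h3.eventually h2)
  refine ⟨η, hη, fun x hx hxD hxη => ?_⟩
  have h5 := h4 (D₂ x) (mem_ball_zero_iff.2 hxη)
  rw [D₂.left_inv hxD] at h5
  obtain ⟨h6, h7⟩ := h5 hx.1
  obtain ⟨y, hy, rfl⟩ := hR.surjOn hx.1
  rw [hg hy] at h6 h7 ⊢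
  have hyh : y ∈ slice S₀ H h := ⟨hy, by rw [← FlowCharts.hamiltonian_map hH hγ hy]; exact hx.2⟩
  have h8 := hF.eq_zeroSection hyh h6
  rw [h8, norm_zeroSection] at h7
  have h9 := (hF.map_zeroSection h7).2
  rw [← h8, D₀.left_inv h6] at h9
  rw [h9, ← h8, D₀.left_inv h6]

/-- Points near `y₀` have images so close to `R y₀` that, also after a small perturbation of the
map, the inverse of `R` can be computed in the charts. -/
theorem FlowCharts.exists_radius (hF : FlowCharts σ H h S₀ R τ γ s ε D₀ D₁ D₂)
    (hR : ContinuousOn R S₀) {y₀ : M} (hy₀ : y₀ ∈ S₀)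
    (hyD : y₀ ∈ D₀.source) (hD0 : D₀ y₀ = 0) (hRD : R y₀ ∈ D₂.source) (hRD0 : D₂ (R y₀) = 0)
    {η : ℝ} (hη : 0 < η) :
    ∃ ρ > 0, ρ ≤ ε ∧ ∀ z : Euc m × Euc m, ‖z‖ < ρ → ‖D₂ (R (D₀.symm (zeroSection m z)))‖ < η := by
  have h0t : (0 : DarbouxModel m) ∈ D₀.target := by rw [← hD0]; exact D₀.map_source hyD
  have h0s : D₀.symm 0 = y₀ := by rw [← hD0, D₀.left_inv hyD]
  have h1 : ∀ᶠ x in 𝓝 (R y₀), ‖D₂ x‖ < η := by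
    refine (D₂.continuousAt hRD).norm.eventually_lt continuousAt_const ?_
    rwa [hRD0, norm_zero]
  have h2 : ∀ᶠ y in 𝓝 y₀, y ∈ S₀ → ‖D₂ (R y)‖ < η :=
    eventually_nhdsWithin_iff.1 ((hR y₀ hy₀).tendsto.eventually h1)
  have h3 := (D₀.symm.continuousAt h0t).tendsto
  rw [h0s] at h3
  obtain ⟨ρ, hρ, h4⟩ := Metric.eventually_nhds_iff_ball.1 (h3.eventually h2)
  refine ⟨min ρ ε, lt_min hρ hF.pos, min_le_right _ _, fun z hz => ?_⟩
  rw [lt_min_iff] at hz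
  exact h4 _ (by rw [mem_ball_zero_iff, norm_zeroSection]; exact hz.1) (hF.symm_mem_slice hz.2).1

/-- A neighbourhood of the base point in the slice. -/
theorem FlowCharts.slice_mem_nhdsWithin (hF : FlowCharts σ H h S₀ R τ γ s ε D₀ D₁ D₂) {y₀ : M}
    (hyD : y₀ ∈ D₀.source) (hD0 : D₀ y₀ = 0) (hρ : 0 < ρ) :
    {y | y ∈ slice S₀ H h ∧ ∃ z : Euc m × Euc m, ‖z‖ < ρ ∧ y = D₀.symm (zeroSection m z)} ∈
      𝓝[slice S₀ H h] y₀ := by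
  have h1 : ∀ᶠ y in 𝓝 y₀, ‖D₀ y‖ < ρ := by
    refine (D₀.continuousAt hyD).norm.eventually_lt continuousAt_const ?_
    rwa [hD0, norm_zero]
  filter_upwards [self_mem_nhdsWithin, mem_nhdsWithin_of_mem_nhds h1,
    mem_nhdsWithin_of_mem_nhds (D₀.open_source.mem_nhds hyD)] with y hy hyρ hys
  have h2 := hF.eq_zeroSection hy hys
  have h3 : ‖D₀ y‖ < ρ := hyρ
  rw [h2, norm_zeroSection] at h3
  exact ⟨hy, _, h3, by rw [← h2, D₀.left_inv hys]⟩

theorem nonempty_equiv_slice {k : ℕ} (hk : k = 2 * m) :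
    Nonempty (Euc k ≃L[ℝ] Euc m × Euc m) := by
  refine ⟨ContinuousLinearEquiv.ofFinrankEq ?_⟩
  rw [Module.finrank_prod, finrank_euclideanSpace_fin, finrank_euclideanSpace_fin, hk]
  ring

theorem nonempty_equiv_model {k : ℕ} (hk : k = 2 * (m + 1)) :
    Nonempty (DarbouxModel m ≃L[ℝ] Euc k) := by
  refine ⟨ContinuousLinearEquiv.ofFinrankEq ?_⟩
  rw [Module.finrank_prod, Module.finrank_prod, Module.finrank_prod,
    Module.finrank_self, finrank_euclideanSpace_fin, finrank_euclideanSpace_fin, hk]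
  ring

theorem norm_iteratedFDeriv_zero_sub {E V : Type*} [NormedAddCommGroup E] [NormedSpace ℝ E]
    [NormedAddCommGroup V] [NormedSpace ℝ V] (f g : E → V) (x : E) :
    ‖iteratedFDeriv ℝ 0 f x - iteratedFDeriv ℝ 0 g x‖ = ‖f x - g x‖ := by
  simp only [iteratedFDeriv_zero_eq_comp, Function.comp_apply]
  rw [← map_sub, LinearIsometryEquiv.norm_map]

/-- Closeness of values in a chart composed with a linear isomorphism. -/
theorem norm_apply_lt_of_close {V V' : Type*} [NormedAddCommGroup V] [NormedSpace ℝ V]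
    [NormedAddCommGroup V'] [NormedSpace ℝ V'] (L : V ≃L[ℝ] V') {a b : V} {η κ : ℝ}
    (hb : ‖b‖ < η / 2) (hκ : κ ≤ η / 2 / (‖(L.symm : V' →L[ℝ] V)‖ + 1))
    (hab : ‖L a - L b‖ < κ) : ‖a‖ < η := by
  set N := ‖(L.symm : V' →L[ℝ] V)‖ with hN
  have hN0 : 0 ≤ N := norm_nonneg _
  have h1 : ‖a - b‖ ≤ N * ‖L a - L b‖ := by
    have := (L.symm : V' →L[ℝ] V).le_opNorm (L a - L b)
    rwa [ContinuousLinearEquiv.coe_coe, map_sub, L.symm_apply_apply, L.symm_apply_apply] at this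
  have h2 : N * ‖L a - L b‖ ≤ (N + 1) * (η / 2 / (N + 1)) :=
    mul_le_mul (by linarith) (hab.le.trans hκ) (norm_nonneg _) (by linarith)
  have h3 : (N + 1) * (η / 2 / (N + 1)) = η / 2 := by field_simp
  linarith [norm_sub_norm_le a b]

end Closeness


end PoincareRealization

end

/-! ### Assembly: choice of the neighbourhoods and of the perturbation -/

theorem mainTheorem4 (n : ℕ) (hn : 2 ≤ n)
    {Ω : Type*} [TopologicalSpace Ω] [T2Space Ω] [SecondCountableTopology Ω]
    [ChartedSpace (Euc (2 * n)) Ω] [IsManifold (𝓡 (2 * n)) ∞ Ω]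
    (σ : SymplecticForm (2 * n) Ω)
    (H : C^∞⟮𝓡 (2 * n), Ω; 𝓘(ℝ, ℝ), ℝ⟯)
    (S₀ S₁ : Set Ω)
    (hS₀ : IsSection (hamiltonianField σ H) S₀)
    (hS₁ : IsSection (hamiltonianField σ H) S₁)
    (R : Ω → Ω)
    (hR : IsPoincareMap (hamiltonianField σ H) S₀ S₁ R)
    (hRdiff : IsDiffeoOn (2 * n) (2 * n) S₀ S₁ R)
    (y₀ x₀ : Ω) (hy₀ : y₀ ∈ S₀)
    (hx₀ : IsBetween (hamiltonianField σ H) S₁ y₀ x₀)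
    (h : ℝ) (hh : h = H x₀) :
    ∀ U ∈ 𝓝 x₀,
      ∃ V ⊆ slice S₀ H h,
        V ∈ 𝓝[slice S₀ H h] y₀ ∧
        ∀ 𝓗 : Set C^∞⟮𝓡 (2 * n), Ω; 𝓘(ℝ, ℝ), ℝ⟯, IsWhitneyNhd H 𝓗 →
          ∃ 𝓓 : Set (Ω → Ω),
            IsWeakNhd (2 * n) (2 * n - 2)
              (slice S₀ H h) (slice S₁ H h) R 𝓓 ∧
            ∀ Rt ∈ 𝓓,
              IsSmoothMap (2 * n)
                (slice S₀ H h) (slice S₁ H h) Rt →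
              IsSymplecticOn (2 * n - 2) σ.form
                (slice S₀ H h) Rt →
              (∀ y ∈ slice S₀ H h \ V, Rt y = R y) →
              ∃ Ht ∈ 𝓗,
                (∀ x, H x = h → x ∉ U → Ht x = H x) ∧
                slice S₀ Ht h = slice S₀ H h ∧
                slice S₁ Ht h = slice S₁ H h ∧
                IsPoincareMap (hamiltonianField σ Ht)
                  (slice S₀ H h) S₁ Rt := by
  obtain ⟨m, rfl⟩ : ∃ m, n = m + 1 := ⟨n - 1, by omega⟩
  have hm : 0 < m := by omega
  intro U hU
  have hH : ContMDiff (𝓡 (2 * (m + 1))) 𝓘(ℝ, ℝ) ∞ H := H.contMDiff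
  obtain ⟨τ, hτ, hγ⟩ := hR
  have : Nonempty Ω := ⟨x₀⟩
  choose! γ hγ using hγ
  obtain ⟨T, γ', hT, s, hs, hsx⟩ := hx₀
  obtain ⟨hτT, heq⟩ := (hγ y₀ hy₀).1.eqOn (contMDiff_hamiltonianField σ hH) hT
  have hs' : s ∈ Ioo 0 (τ y₀) := by rwa [hτT]
  have hsx' : γ y₀ s = x₀ := (heq ⟨hs'.1.le, hs'.2.le⟩).trans hsx
  have hy₀h : H y₀ = h := by
    have h1 := hamiltonian_eq_of_isMIntegralCurveOn σ hH (hγ y₀ hy₀).1.integral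
      ⟨hs'.1.le, hs'.2.le⟩
    rw [hsx', (hγ y₀ hy₀).1.start] at h1
    rw [hh, h1]
  obtain ⟨ε, D₀, D₁, D₂, hF, hyD, hD0, hRD, hRD0, hDU⟩ := exists_flowCharts (m := m) rfl hH hS₀ hτ hγ
    hy₀ hs' (by rwa [hsx'])
  rw [hy₀h] at hF
  obtain ⟨hbij, hRs, g, hg, hgs⟩ := hRdiff
  obtain ⟨η, hη, hinv⟩ := hF.exists_inverse_eq hH hbij hγ hg hgs.continuousOn hy₀ hyD hD0 hRD hRD0
  -- Half of `η` is kept for `R`; the other half is the tolerance for the perturbed map.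
  obtain ⟨ρ', hρ'0, hρ'ε, hRη⟩ := hF.exists_radius hRs.continuousOn hy₀ hyD hD0 hRD hRD0 (half_pos hη)
  set ρ := ρ' / 2 with hρdef
  have hρ0 : 0 < ρ := half_pos hρ'0
  have hρρ' : ρ < ρ' := half_lt_self hρ'0
  have hρε : ρ < ε := hρρ'.trans_le hρ'ε
  set δ := ε / 2 with hδdef
  have hδ0 : 0 < δ := half_pos hF.pos
  have hδε : δ < ε := half_lt_self hF.pos
  obtain ⟨L⟩ := nonempty_equiv_slice (m := m) (k := 2 * (m + 1) - 2) (by omega)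
  obtain ⟨L'⟩ := nonempty_equiv_model (m := m) (k := 2 * (m + 1)) rfl
  have hVn : ∀ z : Euc m × Euc m, ρ ≤ ‖z‖ → ‖z‖ < ρ' → D₀.symm (zeroSection m z) ∉
      {y | y ∈ slice S₀ H h ∧ ∃ z : Euc m × Euc m, ‖z‖ < ρ ∧ y = D₀.symm (zeroSection m z)} := by
    rintro z hz hz' ⟨-, z', hz'ρ, he⟩
    have h1 := D₀.symm.injOn (hF.mem_target _ (by rw [norm_zeroSection]; linarith))
      (hF.mem_target _ (by rw [norm_zeroSection]; linarith)) he
    have h2 : z = z' := congrArg Prod.snd h1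
    rw [h2] at hz
    linarith
  have hslice : MapsTo R (slice S₀ H h) (slice S₁ H h) := fun y hy =>
    ⟨hbij.mapsTo hy.1, by rw [FlowCharts.hamiltonian_map hH hγ hy.1, hy.2]⟩
  have hRred : IsReducible (d := 2 * (m + 1)) S₀ S₁ H h R D₀ D₂ ρ ρ' R :=
    ⟨⟨hslice, hRs.mono fun y hy => hy.1⟩, fun z hz => (hF.map_zeroSection (hz.trans_le hρ'ε)).1,
      fun z _ _ => rfl⟩
  have hloc := hF.isLocalParam L hρ'ε
  -- The neighbourhood `V` is the ball `‖z‖ < ρ` in the slice. It depends only on the charts and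
  -- hence on `U`; all orders and tolerances below are chosen after `𝓗`.
  refine ⟨_, fun y hy => hy.1, hF.slice_mem_nhdsWithin hyD hD0 hρ0, fun 𝓗 h𝓗 => ?_⟩
  have hbox : ∀ w ∈ modelBox m (δ / 2) δ ρ, w ∈ D₁.target := fun w hw =>
    (hF.symm_eq_arc (by linarith) hδε hρε hw).1
  -- The constants are chosen backwards: from `𝓗` to the size of the perturbation, from this to the
  -- closeness of the reduced map to the identity, and from this to the closeness of the map to `R`.
  obtain ⟨r, ε₂, hε₂, hwhit⟩ := h𝓗.exists_small hF.chart₁.toSmoothChart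
    (isCompact_modelBox (δ / 2) δ ρ) hbox
  obtain ⟨k, ε₁, hε₁, hpert⟩ := exists_model_perturbation hm hρ0 hδ0 hδ0 r hε₂
  obtain ⟨ε₀, hε₀, hclose⟩ := IsReducible.exists_close hF hρρ' hρ'ε hRred L L' k hε₁
  set N := ‖(L'.symm : Euc (2 * (m + 1)) →L[ℝ] DarbouxModel m)‖ with hN
  have hN0 : 0 ≤ N := norm_nonneg _
  set ψ : OpenPartialHomeomorph Ω (Euc (2 * (m + 1))) :=
    D₂.trans L'.toHomeomorph.toOpenPartialHomeomorph with hψ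
  have hψs : ∀ x, x ∈ ψ.source ↔ x ∈ D₂.source := fun x => by simp [hψ]
  have hψS : SmoothChart (2 * (m + 1)) ψ := hF.chart₂.toSmoothChart.trans
    L'.contDiff.contDiffOn L'.symm.contDiff.contDiffOn
  set φ₀ : Euc (2 * (m + 1) - 2) → Ω := fun z => D₀.symm (zeroSection m (L z)) with hφ₀
  set K := L ⁻¹' Metric.closedBall 0 ρ with hK
  -- One parametrization and one compact ball suffice, as the maps in question equal `R` elsewhere.
  -- The minimum controls the derivatives by `ε₀` and keeps the values in the region where the
  -- inverse of `R` is known.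
  refine ⟨{f | IsSmoothMap (2 * (m + 1)) (slice S₀ H h) (slice S₁ H h) f ∧
    MapsTo (f ∘ φ₀) K ψ.source ∧ ∀ z ∈ K, ∀ j ≤ k,
      ‖iteratedFDeriv ℝ j (ψ ∘ f ∘ φ₀) z - iteratedFDeriv ℝ j (ψ ∘ R ∘ φ₀) z‖ <
        min ε₀ (η / 2 / (N + 1))},
    ⟨1, k, min ε₀ (η / 2 / (N + 1)), fun _ => L ⁻¹' Metric.ball 0 ρ', fun _ => φ₀, fun _ => K,
      fun _ => ψ, by positivity, fun _ => hloc, fun _ => ⟨?_, ?_⟩, fun _ => ?_, fun _ z hz => ?_,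
      fun f hf hfc => ⟨hf, (hfc 0).1, (hfc 0).2⟩⟩, fun Rt hRt hRts hRtσ hRtV => ?_⟩
  · exact L.toHomeomorph.isCompact_preimage.2 (isCompact_closedBall 0 ρ)
  · exact preimage_mono (Metric.closedBall_subset_ball hρρ')
  · exact (IsManifold.mem_maximalAtlas_iff_contMDiffOn ψ).2 ⟨hψS.smooth, hψS.smooth_symm⟩
  · rw [hK, mem_preimage, mem_closedBall_zero_iff] at hz
    exact (hψs _).2 (hF.map_zeroSection (hz.trans_lt hρε)).1
  · obtain ⟨-, hmaps, hRtc⟩ := hRt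
    have hKmem : ∀ z : Euc m × Euc m, ‖z‖ ≤ ρ → L.symm z ∈ K := fun z hz => by
      rw [hK, mem_preimage, L.apply_symm_apply, mem_closedBall_zero_iff]
      exact hz
    have hφL : ∀ z, φ₀ (L.symm z) = D₀.symm (zeroSection m z) := fun z => by
      simp [hφ₀]
    have hsource : ∀ z : Euc m × Euc m, ‖z‖ ≤ ρ →
        Rt (D₀.symm (zeroSection m z)) ∈ D₂.source := fun z hz => by
      have := hmaps (hKmem z hz)
      rwa [hψs, Function.comp_apply, hφL] at this
    have hred : IsReducible (d := 2 * (m + 1)) S₀ S₁ H h R D₀ D₂ ρ ρ' Rt := by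
      have heq : ∀ z : Euc m × Euc m, ρ ≤ ‖z‖ → ‖z‖ < ρ' →
          Rt (D₀.symm (zeroSection m z)) = R (D₀.symm (zeroSection m z)) := fun z hz hz' =>
        hRtV _ ⟨hF.symm_mem_slice (hz'.trans_le hρ'ε), hVn z hz hz'⟩
      refine ⟨hRts, fun z hz => ?_, heq⟩
      rcases le_total ‖z‖ ρ with h1 | h1
      · exact hsource z h1
      · rw [heq z h1 hz]
        exact (hF.map_zeroSection (hz.trans_le hρ'ε)).1
    have hsmall : ∀ z : Euc m × Euc m, ‖z‖ ≤ ρ → ‖D₂ (Rt (D₀.symm (zeroSection m z)))‖ < η :=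
      fun z hz => by
        have h1 := hRtc _ (hKmem z hz) 0 (Nat.zero_le k)
        rw [norm_iteratedFDeriv_zero_sub] at h1
        have h2 : ‖L' (D₂ (Rt (φ₀ (L.symm z)))) - L' (D₂ (R (φ₀ (L.symm z))))‖ <
          min ε₀ (η / 2 / (N + 1)) := h1
        rw [hφL] at h2
        exact norm_apply_lt_of_close L' (hRη z (by linarith)) (min_le_right _ _) h2
    have hφclose := hclose Rt hred fun z hz j hj => (hRtc z hz j hj).trans_le (min_le_left _ _)
    obtain ⟨G, hGs, hGb, hG0, hGc⟩ := hpert (reducedMap D₀ D₂ ρ' Rt)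
      (hred.contDiff hF hρρ' hρ'ε L) (fun z hz => hred.reducedMap_eq hF hρ'ε hz.le)
      (hred.symplectic hF hρρ' hρ'ε L hRtσ) hφclose
    have hG0' : ∀ w, w ∉ modelBox m (δ / 2) δ ρ → G w = 0 := fun w hw => by
      refine hG0 w ?_
      by_contra! hcon
      exact hw ⟨hcon.1, hcon.2.1, hcon.2.2⟩
    obtain ⟨Ht, hHtG, hHt0⟩ := exists_add_in_chart hF.chart₁.toSmoothChart
      (isCompact_modelBox (δ / 2) δ ρ) hbox hGs hG0' H
    obtain ⟨hs₀, hs₁⟩ := hF.slice_perturbed (by linarith) hδε hρε hH hbij.injOn hγ hHt0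
    refine ⟨Ht, hwhit G Ht hGs hGb hHtG hHt0, fun x _ hxU => hHt0 x ?_, hs₀, hs₁, ?_⟩
    · rintro ⟨w, hw, rfl⟩
      refine hxU ?_
      -- The box is contained in the set of time translates `w + r • timeDir m` that `D₁` maps into
      -- `U`.
      rw [eq_add_timeDir w]
      refine hDU _ (norm_energy_slice (hw.2.1.trans_lt hδε) (hw.2.2.trans_lt hρε)) _ ?_
      linarith [hw.1]
    · refine hF.isPoincareMap_perturbed hδ0 hδε hδε hρε hH hbij hγ hτ hg hgs.continuousOn hRts.1
        hRts.2.continuousOn (φ := reducedMap D₀ D₂ ρ' Rt) (fun z hz => ?_) (fun y hy hyz => ?_) hGc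
        Ht.contMDiff hHtG hHt0
      · have h1 := hinv _ (hRts.1 (hF.symm_mem_slice (hz.trans_lt hρε))) (hsource z hz) (hsmall z hz)
        rw [reducedMap_of_lt (hz.trans_lt hρρ')]
        exact h1
      · refine hRtV y ⟨hy, ?_⟩
        rintro ⟨-, z, hz, he⟩
        exact hyz z hz.le he
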